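/- Let $\mathcal{L}$ be a computable language: a language whose symbols are effectively coded by natural numbers, with arities computable from the codes; function and constant symbols and infinitely many symbols are allowed. A computable $\mathcal{L}$-structure is a structure whose domain is a non-empty computable subset of $\mathbb{N}$ and whose basic functions and relations are computable, uniformly in the symbol. All structures are non-empty, and countable means finite or countably infinite. The classes $\Sigma_n$ and $\Pi_n$ ($n \in \mathbb{N}$) of formulas of $\mathcal{L}_{\omega_1\omega}$ are defined as follows. The $\Sigma_0$ formulas and the $\Pi_0$ formulas are the finitary quantifier-free formulas. A $\Sigma_{n+1}$ formula is a countable disjunction $\bigvee_i \exists \bar{x}_i\, \psi_i$ with each $\bar x_i$ a finite tuple of variables and each $\psi_i$ a $\Pi_n$ formula. A $\Pi_{n+1}$ formula is a countable conjunction $\bigwedge_i \forall \bar{x}_i\, \psi_i$ with each $\psi_i$ a $\Sigma_n$ formula. For $X \subseteq \mathbb{N}$, let $W_e^X$ be the $e$-th set that is computably enumerable in $X$, and let $X' = \{e : e \in W_e^X\}$; $\mathbf{0}^{(n)}$ is the $n$-th iterate of this jump applied to $\emptyset$. The $X$-computable $\Sigma_n$ and $\Pi_n$ formulas and their indices are defined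 by recursion on $n$. An index of a finitary quantifier-free formula, as an $X$-computable $\Sigma_0$ or $\Pi_0$ formula, is its Gödel number. The number $e$ is an index of an $X$-computable $\Sigma_{n+1}$ formula if every element of $W_e^X$ is (the code of) a pair $\langle \bar{x}, e'\rangle$ with $\bar x$ a finite tuple of variables and $e'$ an index of an $X$-computable $\Pi_n$ formula $\psi_{e'}$; the formula is then $\bigvee_{\langle \bar{x}, e'\rangle \in W_e^X} \exists \bar{x}\, \psi_{e'}$. Dually, $X$-computable $\Pi_{n+1}$ formulas are the conjunctions $\bigwedge_{\langle \bar{x}, e'\rangle \in W_e^X} \forall \bar{x}\, \psi_{e'}$ with each $e'$ an index of an $X$-computable $\Sigma_n$ formula $\psi_{e'}$. A Scott sentence of a countable structure $\mathcal{A}$ is a sentence $\varphi$ of $\mathcal{L}_{\omega_1\omega}$ such that for every countable $\mathcal{L}$-structure $\mathcal{B}$, $\mathcal{B} \models \varphi$ if and only if $\mathcal{B} \cong \mathcal{A}$. **Theorem.** Let $\mathcal{A}$ be a computable $\mathcal{L}$-structure and $n \in \mathbb{N}$. If $\mathcal{A}$ has a $\Pi_n$ Scott sentence, then $\mathcal{A}$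 has a Scott sentence that is a $\mathbf{0}^{(n)}$-computable $\Pi_n$ formula. -/

import Mathlib

/-!
Infinitary logic, oracle computability and computable structures, as needed for Scott sentences.
-/

namespace ScottAnalysis

open FirstOrder

/-! ### Oracle computability and the Turing jump -/

section Oracle

open Classical in
/-- The finite binary string formed by the first `s` values of the characteristic function
of `X`. -/
noncomputable def initSeg (X : Set ℕ) (s : ℕ) : List Bool :=
  (List.range s).map fun i => decide (i ∈ X)

/-- `W X e` is the `e`-th set computably enumerable in `X`: the `e`-th computation halts on
input `x` after having consulted only a finite initial segment of the oracle `X`, that is,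
`x ∈ W X e` iff for some initial segment `σ` of `X` the `e`-th partial computable function
(in Mathlib's numbering of codes) is defined at `⟨x, σ⟩`. -/
def W (X : Set ℕ) (e : ℕ) : Set ℕ :=
  {x | ∃ s : ℕ, ((Denumerable.ofNat Nat.Partrec.Code e).eval
    (Nat.pair x (Encodable.encode (initSeg X s)))).Dom}

/-- The Turing jump `X' = {e | e ∈ W_e^X}`. -/
def jump (X : Set ℕ) : Set ℕ := {e | e ∈ W X e}

/-- The `n`-th iterated jump `0⁽ⁿ⁾` of the empty set. -/
def zeroJump : ℕ → Set ℕ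
  | 0 => ∅
  | n + 1 => jump (zeroJump n)

end Oracle

/-! ### Formulas of `L_{ω₁ω}` -/

/-- Formulas of `L_{ω₁ω}` in negation normal form, with variables `x₀, x₁, …` : they are built
from finitary quantifier-free formulas by countable disjunctions and conjunctions (over
arbitrary index sets of natural numbers, the finite ones and the empty one included) and by
existential and universal quantifiers. -/
inductive InfFormula (L : FirstOrder.Language.{0, 0}) : Type
  | qf (θ : L.Formula ℕ) (hθ : θ.IsQF) : InfFormula L
  | iSup (I : Set ℕ) (ψ : I → InfFormula L) : InfFormula L
  | iInf (I : Set ℕ) (ψ : I → InfFormula L) : InfFormula L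
  | ex (x : ℕ) (ψ : InfFormula L) : InfFormula L
  | all (x : ℕ) (ψ : InfFormula L) : InfFormula L

namespace InfFormula

variable {L : FirstOrder.Language.{0, 0}}

/-- Satisfaction of a formula in a structure under an assignment of the variables. -/
def Realize {M : Type} [L.Structure M] : InfFormula L → (ℕ → M) → Prop
  | qf θ _, v => θ.Realize v
  | iSup _ ψ, v => ∃ i, (ψ i).Realize v
  | iInf _ ψ, v => ∀ i, (ψ i).Realize v
  | ex x ψ, v => ∃ a : M, ψ.Realize (Function.update v x a)
  | all x ψ, v => ∀ a : M, ψ.Realize (Function.update v x a)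

/-- The set of free variables. -/
def freeVars : InfFormula L → Set ℕ
  | qf θ _ => (θ.freeVarFinset : Set ℕ)
  | iSup _ ψ => ⋃ i, (ψ i).freeVars
  | iInf _ ψ => ⋃ i, (ψ i).freeVars
  | ex x ψ => ψ.freeVars \ {x}
  | all x ψ => ψ.freeVars \ {x}

/-- A sentence is a formula without free variables. -/
def IsSentence (φ : InfFormula L) : Prop := φ.freeVars = ∅

/-- `M ⊨ φ`, for a sentence `φ`. -/
def Models (M : Type) [L.Structure M] (φ : InfFormula L) : Prop :=
  ∀ v : ℕ → M, φ.Realize v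

/-- The formula `∃ x̄ ψ`, for a finite tuple `x̄` of variables. -/
def exs (xs : List ℕ) (ψ : InfFormula L) : InfFormula L := xs.foldr ex ψ

/-- The formula `∀ x̄ ψ`, for a finite tuple `x̄` of variables. -/
def alls (xs : List ℕ) (ψ : InfFormula L) : InfFormula L := xs.foldr all ψ

mutual

/-- `Σ_n` formulas: the `Σ_0` formulas are the finitary quantifier-free ones, and a `Σ_{n+1}`
formula is of the form `⋁_i ∃ x̄_i ψ_i` with every `ψ_i` being `Π_n`. -/
def IsSigma : ℕ → InfFormula L → Prop
  | 0, φ => ∃ θ hθ, φ = qf θ hθ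
  | n + 1, φ => ∃ (I : Set ℕ) (xs : I → List ℕ) (ψ : I → InfFormula L),
      φ = iSup I (fun i => exs (xs i) (ψ i)) ∧ ∀ i, IsPi n (ψ i)

/-- `Π_n` formulas: the `Π_0` formulas are the finitary quantifier-free ones, and a `Π_{n+1}`
formula is of the form `⋀_i ∀ x̄_i ψ_i` with every `ψ_i` being `Σ_n`. -/
def IsPi : ℕ → InfFormula L → Prop
  | 0, φ => ∃ θ hθ, φ = qf θ hθ
  | n + 1, φ => ∃ (I : Set ℕ) (xs : I → List ℕ) (ψ : I → InfFormula L),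
      φ = iInf I (fun i => alls (xs i) (ψ i)) ∧ ∀ i, IsSigma n (ψ i)

end

end InfFormula

/-! ### Scott sentences -/

/-- `φ` is a Scott sentence of `M`: its countable models are exactly the structures isomorphic
to `M`. (Structures are non-empty, and countable means finite or countably infinite.) -/
def IsScottSentence {L : FirstOrder.Language.{0, 0}} (M : Type) [L.Structure M] (φ : InfFormula L) : Prop :=
  φ.IsSentence ∧ ∀ (N : Type) [L.Structure N] [Countable N] [Nonempty N],
    φ.Models N ↔ Nonempty (M ≃[L] N)

/-! ### Computable formulas -/

section Codes

variable {L : FirstOrder.Language.{0, 0}} [Primcodable (Σ k, L.Functions k)]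

/-- Gödel numbers of terms. -/
def termCode {α : Type} [Encodable α] : L.Term α → ℕ
  | .var a => 2 * Encodable.encode a
  | .func (l := l) f ts =>
      2 * Nat.pair (Encodable.encode (⟨l, f⟩ : Σ k, L.Functions k))
        (Encodable.encode (List.ofFn fun i => termCode (ts i))) + 1

variable [Primcodable (Σ k, L.Relations k)]

/-- Gödel numbers of finitary formulas. -/
def formulaCode : {m : ℕ} → L.BoundedFormula ℕ m → ℕ
  | _, .falsum => 0
  | _, .equal t₁ t₂ => 4 * Nat.pair (termCode t₁) (termCode t₂) + 1
  | _, .rel (l := l) R ts =>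
      4 * Nat.pair (Encodable.encode (⟨l, R⟩ : Σ k, L.Relations k))
        (Encodable.encode (List.ofFn fun i => termCode (ts i))) + 2
  | _, .imp φ ψ => 4 * Nat.pair (formulaCode φ) (formulaCode ψ) + 3
  | _, .all φ => 4 * formulaCode φ + 4

mutual

/-- `e` is an index of `φ` as an `X`-computable `Σ_n` formula: for `n = 0` it is the Gödel number
of `φ`, and an index `e` of an `X`-computable `Σ_{n+1}` formula denotes the disjunction, over
all `⟨x̄, e'⟩` in the `X`-c.e. set `W X e`, of the formulas `∃ x̄ ψ`, where `ψ` is the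
`X`-computable `Π_n` formula with index `e'`. -/
def IsSigmaIndex (X : Set ℕ) : ℕ → ℕ → InfFormula L → Prop
  | 0, e, φ => ∃ θ hθ, φ = InfFormula.qf θ hθ ∧ e = formulaCode θ
  | n + 1, e, φ => ∃ ψ : W X e → InfFormula L,
      φ = InfFormula.iSup (W X e)
        (fun i => (ψ i).exs (Denumerable.ofNat (List ℕ) (Nat.unpair i).1)) ∧
      ∀ i : W X e, IsPiIndex X n (Nat.unpair i).2 (ψ i)

/-- `e` is an index of `φ` as an `X`-computable `Π_n` formula: for `n = 0` it is the Gödel number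
of `φ`, and an index `e` of an `X`-computable `Π_{n+1}` formula denotes the conjunction, over
all `⟨x̄, e'⟩` in the `X`-c.e. set `W X e`, of the formulas `∀ x̄ ψ`, where `ψ` is the
`X`-computable `Σ_n` formula with index `e'`. -/
def IsPiIndex (X : Set ℕ) : ℕ → ℕ → InfFormula L → Prop
  | 0, e, φ => ∃ θ hθ, φ = InfFormula.qf θ hθ ∧ e = formulaCode θ
  | n + 1, e, φ => ∃ ψ : W X e → InfFormula L,
      φ = InfFormula.iInf (W X e)
        (fun i => (ψ i).alls (Denumerable.ofNat (List ℕ) (Nat.unpair i).1)) ∧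
      ∀ i : W X e, IsSigmaIndex X n (Nat.unpair i).2 (ψ i)

end

/-- `φ` is an `X`-computable `Π_n` formula. -/
def IsComputablePi (X : Set ℕ) (n : ℕ) (φ : InfFormula L) : Prop :=
  ∃ e : ℕ, IsPiIndex X n e φ

end Codes

/-! ### Computable languages and structures -/

section Structures

variable (L : FirstOrder.Language.{0, 0}) [Primcodable (Σ k, L.Functions k)] [Primcodable (Σ k, L.Relations k)]

/-- A language whose symbols are coded by natural numbers is computable if the arity of a symbol
can be computed from its code. -/
def IsComputableLanguage : Prop :=
  Computable (fun f : Σ k, L.Functions k => f.1) ∧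
    Computable (fun R : Σ k, L.Relations k => R.1)

/-- A structure whose domain is a set `D` of natural numbers is computable if `D` is computable
and the basic functions and relations are computable, uniformly in the symbol. -/
def IsComputableStructure (D : Set ℕ) [L.Structure D] : Prop :=
  ComputablePred (fun x => x ∈ D) ∧
  (∃ F : (Σ k, L.Functions k) × List ℕ → ℕ, Computable F ∧
    ∀ (k : ℕ) (f : L.Functions k) (v : Fin k → D),
      F (⟨k, f⟩, List.ofFn fun i => (v i : ℕ)) = (FirstOrder.Language.Structure.funMap f v : D)) ∧
  (∃ P : (Σ k, L.Relations k) × List ℕ → Bool, Computable P ∧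
    ∀ (k : ℕ) (R : L.Relations k) (v : Fin k → D),
      P (⟨k, R⟩, List.ofFn fun i => (v i : ℕ)) = true ↔ FirstOrder.Language.Structure.RelMap R v)

end Structures

end ScottAnalysis

open ScottAnalysis

namespace ScottAnalysis

open FirstOrder FirstOrder.Language Encodable InfFormula

variable {L : FirstOrder.Language.{0, 0}}

-- A quantifier-free Scott sentence is already indexed by its Gödel number. If `n = 1`, the
-- universal theory of the structure is a Scott sentence; it is `family L e 1` at the empty tuple.
-- The substance is the case `n = m + 2`.
--
-- Let `e` enumerate the structure `M`. The formulas `family L e k j` are `Π_k`, and every `Π_k`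
-- type realized in `M` is generated by them (`generates`): for `k = 0` they are the quantifier-free
-- formulas, and for each tuple `s`, member `s` of level `k + 1` says that no level-`k` existential
-- statement false of `s` holds.
--
-- A `Π_{m+2}` Scott sentence makes every tuple of `M` satisfy an existentially quantified member of
-- `family L e m` that decides all formulas of this shape (`exists_supporting`,
-- `exists_isComplete`). Otherwise the type of some tuple `p` can be omitted. Forcing with the
-- formulas of level `m` gives a generic sequence of conditions, and its variables name a countable
-- substructure of an ultrapower of `M`. This substructure satisfies the Scott sentence by the truth
-- lemma `realize_genericModel`, so it is isomorphic to `M`, yet each of its tuples satisfies an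
-- existential formula that fails of `p`.
--
-- The canonical sentence says that every tuple satisfies a complete formula, and that complete
-- formulas refute and entail what they refute and entail in `M`. Tuples of `M` and of a countable
-- model that satisfy a common complete formula can then be extended back and forth (`Linked.forth`,
-- `Linked.back`). Refutation of quantifier-free formulas turns the limit into an isomorphism.
--
-- It remains to find the canonical sentence effectively. Satisfaction of level-`k` formulas in a
-- computable structure is only `Π_{2k}`, and completeness is `Π_{2m+2}`, too complex to be
-- enumerated from `0⁽ⁿ⁾` in general. But the formula can absorb part of the quantifiers: the truth
-- value of a `Σ_{n+k+1}` predicate is expressed by a `0⁽ⁿ⁾`-computable `Σ_{k+1}` sentence built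
-- from `⊤` (`effSigma_truth`). So a guard of that complexity can be hidden in a `Π_{k+1}`
-- conjunction or a `Σ_{k+1}` disjunction (`EffSigma.guardedInf`, `EffPi.guardedSup`). With `n = m +
-- 2` all guards fit, and completeness in the cover sentence fits with nothing to spare.

/-! ### Sets computably enumerable in an oracle -/

/-- `S` is computably enumerable in `X`, in normal form. -/
def CEIn (X S : Set ℕ) : Prop :=
  ∃ c : ℕ × List Bool × ℕ → Bool, Computable c ∧
    ∀ x, x ∈ S ↔ ∃ s y, c (x, initSeg X s, y) = true

/-- The oracle enters only through the finite string `initSeg X s`, which is part of the input.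
Currying one oracle-free program therefore gives the index map, and `h` needs no oracle. -/
theorem CEIn.smn {X S : Set ℕ} (hS : CEIn X S) :
    ∃ h : ℕ → ℕ, Computable h ∧ ∀ i, W X (h i) = {x | Nat.pair i x ∈ S} := by
  obtain ⟨c, hc, hS⟩ := hS
  let p : ℕ → ℕ → Bool := fun z y =>
    c (Nat.pair z.unpair.1 z.unpair.2.unpair.1,
      (decode (α := List Bool) z.unpair.2.unpair.2).getD [], y)
  have hp : Computable₂ p := by
    have hu : Computable (fun a : ℕ × ℕ => a.1.unpair) := (Primrec.unpair.comp Primrec.fst).to_comp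
    have hu1 : Computable (fun a : ℕ × ℕ => a.1.unpair.1) := Computable.fst.comp hu
    have hu2 : Computable (fun a : ℕ × ℕ => a.1.unpair.2.unpair) :=
      Primrec.unpair.to_comp.comp (Computable.snd.comp hu)
    have h1 : Computable (fun a : ℕ × ℕ => Nat.pair a.1.unpair.1 a.1.unpair.2.unpair.1) :=
      Primrec₂.natPair.to_comp.comp hu1 (Computable.fst.comp hu2)
    have h2 : Computable (fun a : ℕ × ℕ =>
        (decode (α := List Bool) a.1.unpair.2.unpair.2).getD []) :=
      Primrec.option_getD.to_comp.comp (Computable.decode.comp (Computable.snd.comp hu2))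
        (Computable.const _)
    exact hc.comp (h1.pair (h2.pair Computable.snd))
  have hr : Nat.Partrec (fun z => Nat.rfind (p z : ℕ →. Bool)) :=
    Partrec.nat_iff.1 (Partrec.rfind hp.partrec₂)
  obtain ⟨c0, hc0⟩ := Nat.Partrec.Code.exists_code.1 hr
  refine ⟨fun i => encode (c0.curry i), ?_, fun i => ?_⟩
  · exact (Primrec.encode.comp
      (Nat.Partrec.Code.primrec₂_curry.comp (Primrec.const c0) Primrec.id)).to_comp
  · ext x
    simp only [W, Set.mem_ofPred_eq, hS, Denumerable.ofNat_encode, Nat.Partrec.Code.eval_curry, hc0]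
    refine exists_congr fun s => ?_
    rw [Nat.rfind_dom]
    constructor
    · rintro ⟨y, hy, -⟩
      refine ⟨y, ?_⟩
      simpa [p] using hy
    · rintro ⟨y, hy⟩
      refine ⟨y, ?_, fun _ => trivial⟩
      simpa [p] using hy

/-- Halting within a given number of steps is decidable by `evaln`; the step bound becomes the
number witness of the normal form. -/
theorem ceIn_univ (X : Set ℕ) : CEIn X {z | z.unpair.2 ∈ W X z.unpair.1} := by
  refine ⟨fun a => (Nat.Partrec.Code.evaln a.2.2
    (Denumerable.ofNat Nat.Partrec.Code a.1.unpair.1)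
    (Nat.pair a.1.unpair.2 (encode a.2.1))).isSome, ?_, fun z => ?_⟩
  · have hu : Computable (fun a : ℕ × List Bool × ℕ => a.1.unpair) :=
      Primrec.unpair.to_comp.comp Computable.fst
    refine Primrec.option_isSome.to_comp.comp (Nat.Partrec.Code.primrec_evaln.to_comp.comp
      (((Computable.snd.comp Computable.snd).pair
        ((Primrec.ofNat _).to_comp.comp (Computable.fst.comp hu))).pair
        (Primrec₂.natPair.to_comp.comp (Computable.snd.comp hu)
          (Computable.encode.comp (Computable.fst.comp Computable.snd)))))
  · simp only [W, Set.mem_ofPred_eq, Part.dom_iff_mem, Nat.Partrec.Code.evaln_complete,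
      Option.isSome_iff_exists, Option.mem_def]
    refine exists_congr fun s => ?_
    rw [exists_comm]

theorem CEIn.comap {X S : Set ℕ} (hS : CEIn X S) {f : ℕ → ℕ} (hf : Computable f) :
    CEIn X {x | f x ∈ S} := by
  obtain ⟨c, hc, hS⟩ := hS
  exact ⟨fun a => c (f a.1, a.2), hc.comp ((hf.comp Computable.fst).pair Computable.snd),
    fun x => hS _⟩

theorem CEIn.exists_pair {X S : Set ℕ} (hS : CEIn X S) :
    CEIn X {x | ∃ y, Nat.pair x y ∈ S} := by
  obtain ⟨c, hc, hS⟩ := hS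
  refine ⟨fun a => c (Nat.pair a.1 a.2.2.unpair.1, a.2.1, a.2.2.unpair.2), ?_, fun x => ?_⟩
  · have hu : Computable (fun a : ℕ × List Bool × ℕ => a.2.2.unpair) :=
      Primrec.unpair.to_comp.comp (Computable.snd.comp Computable.snd)
    exact hc.comp ((Primrec₂.natPair.to_comp.comp Computable.fst (Computable.fst.comp hu)).pair
      ((Computable.fst.comp Computable.snd).pair (Computable.snd.comp hu)))
  · simp only [Set.mem_ofPred_eq, hS]
    constructor
    · rintro ⟨y, s, w, h⟩
      exact ⟨s, Nat.pair y w, by simpa using h⟩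
    · rintro ⟨s, w, h⟩
      exact ⟨_, s, _, h⟩

theorem CEIn.and_computable {X S : Set ℕ} (hS : CEIn X S) {p : ℕ → Bool} (hp : Computable p) :
    CEIn X {x | p x = true ∧ x ∈ S} := by
  obtain ⟨c, hc, hS⟩ := hS
  refine ⟨fun a => p a.1 && c a,
    Primrec.and.to_comp.comp (hp.comp Computable.fst) hc, fun x => ?_⟩
  simp [hS]

theorem CEIn.union {X S T : Set ℕ} (hS : CEIn X S) (hT : CEIn X T) : CEIn X (S ∪ T) := by
  obtain ⟨c, hc, hS⟩ := hS
  obtain ⟨d, hd, hT⟩ := hT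
  refine ⟨fun a => c a || d a, Primrec.or.to_comp.comp hc hd, fun x => ?_⟩
  simp only [Set.mem_union, hS, hT, Bool.or_eq_true]
  constructor
  · rintro (⟨s, y, h⟩ | ⟨s, y, h⟩)
    exacts [⟨s, y, .inl h⟩, ⟨s, y, .inr h⟩]
  · rintro ⟨s, y, h | h⟩
    exacts [.inl ⟨s, y, h⟩, .inr ⟨s, y, h⟩]

theorem ceIn_of_computable (X : Set ℕ) {p : ℕ → Bool} (hp : Computable p) :
    CEIn X {x | p x = true} :=
  ⟨fun a => p a.1, hp.comp Computable.fst, fun x => by simp⟩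

/-- The image of a c.e. set under a computable function is uniformly c.e. -/
theorem exists_image_index (X : Set ℕ) {f : ℕ → ℕ → ℕ} (hf : Computable₂ f) {S : Set ℕ}
    (hS : CEIn X S) :
    ∃ h : ℕ → ℕ, Computable h ∧ ∀ i, W X (h i) = {z | ∃ y, Nat.pair i y ∈ S ∧ z = f i y} := by
  have hu : Computable Nat.unpair := Primrec.unpair.to_comp
  have h1 : Computable (fun w : ℕ => w.unpair.1.unpair.1) :=
    Computable.fst.comp (hu.comp (Computable.fst.comp hu))
  have h2 : Computable (fun w : ℕ => w.unpair.1.unpair.2) :=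
    Computable.snd.comp (hu.comp (Computable.fst.comp hu))
  have h3 : Computable (fun w : ℕ => w.unpair.2) := Computable.snd.comp hu
  have key := ((hS.comap (Primrec₂.natPair.to_comp.comp h1 h3)).and_computable
    (p := fun w => decide (w.unpair.1.unpair.2 = f w.unpair.1.unpair.1 w.unpair.2))
    (Primrec.eq.decide.to_comp.comp h2 (hf.comp h1 h3))).exists_pair
  obtain ⟨h, hh, hW⟩ := key.smn
  refine ⟨h, hh, fun i => ?_⟩
  rw [hW]
  ext x
  simp [and_comm]

theorem exists_index_union (X : Set ℕ) {f g : ℕ → ℕ} (hf : Computable f) (hg : Computable g) :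
    ∃ h : ℕ → ℕ, Computable h ∧ ∀ i, W X (h i) = W X (f i) ∪ W X (g i) := by
  have hu : Computable Nat.unpair := Primrec.unpair.to_comp
  have aux : ∀ {k : ℕ → ℕ}, Computable k → CEIn X {z | z.unpair.2 ∈ W X (k z.unpair.1)} := by
    intro k hk
    have := (ceIn_univ X).comap (f := fun z => Nat.pair (k z.unpair.1) z.unpair.2)
      (Primrec₂.natPair.to_comp.comp (hk.comp (Computable.fst.comp hu)) (Computable.snd.comp hu))
    simpa using this
  obtain ⟨h, hh, hW⟩ := ((aux hf).union (aux hg)).smn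
  refine ⟨h, hh, fun i => ?_⟩
  rw [hW]
  ext x
  simp

theorem initSeg_getElem? (X : Set ℕ) (s i : ℕ) :
    (initSeg X s)[i]? = some false ↔ i < s ∧ i ∉ X := by
  simp only [initSeg, List.getElem?_map, Option.map_eq_some_iff]
  constructor
  · rintro ⟨a, h1, h2⟩
    rw [List.getElem?_eq_some_iff] at h1
    obtain ⟨h, rfl⟩ := h1
    simp at h h2 ⊢
    exact ⟨h, h2⟩
  · rintro ⟨h1, h2⟩
    exact ⟨i, by simp [h1], by simpa using h2⟩

/-- Membership in `S` is many-one reducible to `jump X`, so a non-member is recognized by an entry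
`false` in a long enough initial segment of the jump. This is the step from `k` to `k + 1` in Post's
theorem. -/
theorem CEIn.jump {X S : Set ℕ} (hS : CEIn X S) :
    CEIn (jump X) {x | ∃ y, Nat.pair x y ∉ S} := by
  have hu : Computable Nat.unpair := Primrec.unpair.to_comp
  obtain ⟨h, hh, hW⟩ := (hS.comap (Computable.fst.comp hu)).smn
  have hred : ∀ z, h z ∈ ScottAnalysis.jump X ↔ z ∈ S := by
    intro z
    show h z ∈ W X (h z) ↔ _
    rw [hW]
    simp
  refine ⟨fun a => decide (a.2.1[h (Nat.pair a.1 a.2.2)]? = some false), ?_, fun x => ?_⟩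
  · refine Primrec.eq.decide.to_comp.comp
      (Computable.list_getElem?.comp (Computable.fst.comp Computable.snd) (hh.comp
        (Primrec₂.natPair.to_comp.comp Computable.fst (Computable.snd.comp Computable.snd))))
      (Computable.const _)
  · simp only [Set.mem_ofPred_eq, decide_eq_true_eq, initSeg_getElem?, hred]
    constructor
    · rintro ⟨y, hy⟩
      exact ⟨_, y, Nat.lt_succ_self _, hy⟩
    · rintro ⟨s, y, -, hy⟩
      exact ⟨y, hy⟩

/-! ### The arithmetical hierarchy -/

/-- `p` is an arithmetical `Σ_k` predicate. -/
def ASig : ℕ → ∀ {α : Type} [Primcodable α], (α → Prop) → Prop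
  | 0, α, _, p => ∃ c : α → Bool, Computable c ∧ ∀ x, p x ↔ c x = true
  | k + 1, α, _, p => ∃ q : α × ℕ → Prop, ASig k q ∧ ∀ x, p x ↔ ∃ y, ¬ q (x, y)

/-- `p` is an arithmetical `Π_k` predicate. -/
def APi (k : ℕ) {α : Type} [Primcodable α] (p : α → Prop) : Prop := ASig k fun x => ¬ p x

section

variable {α β : Type} [Primcodable α] [Primcodable β] {k l : ℕ}

theorem ASig.of_iff {p q : α → Prop} (hp : ASig k p) (h : ∀ x, p x ↔ q x) : ASig k q := by
  have : p = q := funext fun x => propext (h x)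
  exact this ▸ hp

theorem ASig.comap {p : α → Prop} (hp : ASig k p) {f : β → α} (hf : Computable f) :
    ASig k fun x => p (f x) := by
  induction k generalizing α β with
  | zero =>
    obtain ⟨c, hc, h⟩ := hp
    exact ⟨fun x => c (f x), hc.comp hf, fun x => h _⟩
  | succ k ih =>
    obtain ⟨q, hq, h⟩ := hp
    exact ⟨fun z => q (f z.1, z.2), ih hq ((hf.comp Computable.fst).pair Computable.snd),
      fun x => h _⟩

theorem APi.comap {p : α → Prop} (hp : APi k p) {f : β → α} (hf : Computable f) :
    APi k fun x => p (f x) := ASig.comap hp hf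

theorem APi.of_iff {p q : α → Prop} (hp : APi k p) (h : ∀ x, p x ↔ q x) : APi k q :=
  ASig.of_iff hp fun x => not_congr (h x)

theorem ASig.not {p : α → Prop} (hp : ASig k p) : APi k fun x => ¬ p x :=
  ASig.of_iff hp fun _ => not_not.symm

theorem APi.not {p : α → Prop} (hp : APi k p) : ASig k fun x => ¬ p x := hp

/-- The two closure properties go up together: the matrix of a `Σ_{k+1}` predicate is negated, so
each property at level `k + 1` needs the other one at level `k`. -/
theorem ASig.and_or {p q : α → Prop} (hp : ASig k p) (hq : ASig k q) :
    ASig k (fun x => p x ∧ q x) ∧ ASig k (fun x => p x ∨ q x) := by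
  induction k generalizing α with
  | zero =>
    obtain ⟨c, hc, h⟩ := hp
    obtain ⟨d, hd, h'⟩ := hq
    exact ⟨⟨fun x => c x && d x, Primrec.and.to_comp.comp hc hd, fun x => by simp [h, h']⟩,
      ⟨fun x => c x || d x, Primrec.or.to_comp.comp hc hd, fun x => by simp [h, h']⟩⟩
  | succ k ih =>
    obtain ⟨p', hp', h⟩ := hp
    obtain ⟨q', hq', h'⟩ := hq
    refine ⟨⟨fun z => p' (z.1, z.2.unpair.1) ∨ q' (z.1, z.2.unpair.2), ?_, fun x => ?_⟩,
      ⟨fun z => p' z ∧ q' z, (ih hp' hq').1, fun x => ?_⟩⟩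
    · have hu : Computable (fun z : α × ℕ => z.2.unpair) :=
        Primrec.unpair.to_comp.comp Computable.snd
      exact (ih (hp'.comap (Computable.fst.pair (Computable.fst.comp hu)))
        (hq'.comap (Computable.fst.pair (Computable.snd.comp hu)))).2
    · beta_reduce
      rw [h, h']
      constructor
      · rintro ⟨⟨y, hy⟩, z, hz⟩
        exact ⟨Nat.pair y z, by simpa using ⟨hy, hz⟩⟩
      · rintro ⟨w, hw⟩
        rw [not_or] at hw
        exact ⟨⟨_, hw.1⟩, _, hw.2⟩
    · beta_reduce
      rw [h, h', ← exists_or]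
      exact exists_congr fun y => by tauto

theorem ASig.and {p q : α → Prop} (hp : ASig k p) (hq : ASig k q) :
    ASig k fun x => p x ∧ q x := (hp.and_or hq).1

theorem ASig.or {p q : α → Prop} (hp : ASig k p) (hq : ASig k q) :
    ASig k fun x => p x ∨ q x := (hp.and_or hq).2

theorem APi.and {p q : α → Prop} (hp : APi k p) (hq : APi k q) :
    APi k fun x => p x ∧ q x :=
  ASig.of_iff (ASig.or hp hq) fun _ => by tauto

theorem APi.or {p q : α → Prop} (hp : APi k p) (hq : APi k q) :
    APi k fun x => p x ∨ q x :=
  ASig.of_iff (ASig.and hp hq) fun _ => by tauto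

theorem APi.imp {p q : α → Prop} (hp : ASig k p) (hq : APi k q) :
    APi k fun x => p x → q x :=
  (hp.not.or hq).of_iff fun _ => by tauto

theorem APi.sig_succ {p : α → Prop} (hp : APi k p) : ASig (k + 1) p :=
  ⟨fun z => ¬ p z.1, ASig.comap hp Computable.fst, fun x => by simp⟩

theorem ASig.pi_succ {p : α → Prop} (hp : ASig k p) : APi (k + 1) p :=
  hp.not.sig_succ

theorem ASig.succ {p : α → Prop} (hp : ASig k p) : ASig (k + 1) p := by
  induction k generalizing α with
  | zero =>
    obtain ⟨c, hc, h⟩ := hp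
    refine ⟨fun z => ¬ p z.1, ⟨fun z => !(c z.1), ?_, fun x => ?_⟩, fun x => by simp⟩
    · exact Primrec.not.to_comp.comp (hc.comp Computable.fst)
    · simp [h]
  | succ k ih =>
    obtain ⟨p', hp', h⟩ := hp
    exact ⟨p', ih hp', h⟩

theorem ASig.mono {p : α → Prop} (hp : ASig k p) (hkl : k ≤ l) : ASig l p := by
  induction hkl with
  | refl => exact hp
  | step _ ih => exact ih.succ

theorem APi.mono {p : α → Prop} (hp : APi k p) (hkl : k ≤ l) : APi l p := ASig.mono hp hkl

theorem ASig.of_pi_lt {p : α → Prop} (hp : APi k p) (hkl : k < l) : ASig l p :=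
  hp.sig_succ.mono hkl

theorem APi.ex_sig {p : α × ℕ → Prop} (hp : APi k p) : ASig (k + 1) fun x => ∃ y, p (x, y) :=
  ⟨fun z => ¬ p z, hp, fun x => by simp⟩

theorem ASig.ex {p : α × ℕ → Prop} (hp : ASig (k + 1) p) :
    ASig (k + 1) fun x => ∃ y, p (x, y) := by
  obtain ⟨q, hq, h⟩ := hp
  have hu : Computable (fun z : α × ℕ => z.2.unpair) :=
    Primrec.unpair.to_comp.comp Computable.snd
  refine ⟨fun z => q ((z.1, z.2.unpair.1), z.2.unpair.2),
    hq.comap ((Computable.fst.pair (Computable.fst.comp hu)).pair (Computable.snd.comp hu)),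
    fun x => ?_⟩
  constructor
  · rintro ⟨y, hy⟩
    obtain ⟨z, hz⟩ := (h _).1 hy
    exact ⟨Nat.pair y z, by simpa using hz⟩
  · rintro ⟨w, hw⟩
    exact ⟨_, (h _).2 ⟨_, hw⟩⟩

theorem APi.all {p : α × ℕ → Prop} (hp : APi (k + 1) p) :
    APi (k + 1) fun x => ∀ y, p (x, y) :=
  ASig.of_iff (ASig.ex hp) fun x => by simp

theorem asig_zero_of_computable {c : α → Bool} (hc : Computable c) :
    ASig 0 fun x => c x = true := ⟨c, hc, fun _ => Iff.rfl⟩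

theorem ASig.zero_pi {p : α → Prop} (hp : ASig 0 p) : APi 0 p := by
  obtain ⟨c, hc, h⟩ := hp
  exact ⟨fun x => !(c x), Primrec.not.to_comp.comp hc, fun x => by simp [h]⟩

end

/-- Post's theorem: `Σ_{k+1}` predicates are computably enumerable in the `k`-th jump. -/
theorem ASig.ceIn {k : ℕ} {p : ℕ → Prop} (hp : ASig (k + 1) p) :
    CEIn (zeroJump k) {x | p x} := by
  have hu : Computable Nat.unpair := Primrec.unpair.to_comp
  induction k generalizing p with
  | zero =>
    obtain ⟨q, ⟨c, hc, hq⟩, h⟩ := hp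
    have := (ceIn_of_computable (zeroJump 0) (p := fun z => !(c z.unpair))
      (Primrec.not.to_comp.comp (hc.comp hu))).exists_pair
    simpa [h, hq] using this
  | succ k ih =>
    obtain ⟨q, hq, h⟩ := hp
    have := (ih (hq.comap hu)).jump
    simpa [h, zeroJump] using this

/-! ### Basic properties of infinitary formulas -/

theorem realize_congr_freeVarFinset {M : Type} [L.Structure M] {m : ℕ}
    (θ : L.BoundedFormula ℕ m) {v w : ℕ → M} (xs : Fin m → M)
    (h : ∀ i ∈ θ.freeVarFinset, v i = w i) : θ.Realize v xs ↔ θ.Realize w xs := by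
  have aux : ∀ {m : ℕ} (t : L.Term (ℕ ⊕ Fin m)) (xs : Fin m → M),
      (∀ i ∈ t.varFinsetLeft, v i = w i) →
      t.realize (Sum.elim v xs) = t.realize (Sum.elim w xs) := by
    intro m t xs h
    induction t with
    | var i => cases i <;> simp_all [Term.varFinsetLeft]
    | func f ts ih =>
      simp only [Term.realize]
      congr 1
      funext i
      exact ih i fun j hj => h j (by
        simp only [Term.varFinsetLeft, Finset.mem_biUnion]
        exact ⟨i, Finset.mem_univ _, hj⟩)
  induction θ with
  | falsum => rfl
  | equal t₁ t₂ =>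
    simp only [BoundedFormula.freeVarFinset, Finset.mem_union] at h
    simp only [BoundedFormula.Realize, aux t₁ xs fun i hi => h i (.inl hi),
      aux t₂ xs fun i hi => h i (.inr hi)]
  | rel R ts =>
    simp only [BoundedFormula.freeVarFinset, Finset.mem_biUnion] at h
    simp only [BoundedFormula.Realize]
    have : (fun i => (ts i).realize (Sum.elim v xs)) = fun i => (ts i).realize (Sum.elim w xs) :=
      funext fun i => aux _ _ fun j hj => h j ⟨i, Finset.mem_univ _, hj⟩
    rw [this]
  | imp φ ψ ih₁ ih₂ =>
    simp only [BoundedFormula.freeVarFinset, Finset.mem_union] at h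
    simp only [BoundedFormula.Realize, ih₁ xs fun i hi => h i (.inl hi),
      ih₂ xs fun i hi => h i (.inr hi)]
  | all φ ih =>
    simp only [BoundedFormula.Realize]
    exact forall_congr' fun a => ih _ h

namespace InfFormula

section Realize

variable {M : Type} [L.Structure M]

@[simp] theorem realize_qf (θ : L.Formula ℕ) (hθ : θ.IsQF) (v : ℕ → M) :
    (qf θ hθ).Realize v ↔ θ.Realize v := Iff.rfl

@[simp] theorem realize_iSup (I : Set ℕ) (ψ : I → InfFormula L) (v : ℕ → M) :
    (iSup I ψ).Realize v ↔ ∃ i, (ψ i).Realize v := Iff.rfl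

@[simp] theorem realize_iInf (I : Set ℕ) (ψ : I → InfFormula L) (v : ℕ → M) :
    (iInf I ψ).Realize v ↔ ∀ i, (ψ i).Realize v := Iff.rfl

theorem realize_exs (xs : List ℕ) (ψ : InfFormula L) (v : ℕ → M) :
    (ψ.exs xs).Realize v ↔ ∃ w : ℕ → M, (∀ i ∉ xs, w i = v i) ∧ ψ.Realize w := by
  induction xs generalizing v with
  | nil =>
    constructor
    · exact fun h => ⟨v, fun _ _ => rfl, h⟩
    · rintro ⟨w, hw, h⟩
      obtain rfl : w = v := funext fun i => hw i (by simp)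
      exact h
  | cons x xs ih =>
    change (∃ a : M, (ψ.exs xs).Realize (Function.update v x a)) ↔ _
    simp only [ih]
    constructor
    · rintro ⟨a, w, hw, h⟩
      refine ⟨w, fun i hi => ?_, h⟩
      simp only [List.mem_cons, not_or] at hi
      rw [hw i hi.2, Function.update_of_ne hi.1]
    · rintro ⟨w, hw, h⟩
      refine ⟨w x, w, fun i hi => ?_, h⟩
      by_cases hx : i = x
      · subst hx; simp
      · rw [Function.update_of_ne hx]
        exact hw i (by simp [hx, hi])

theorem realize_alls (xs : List ℕ) (ψ : InfFormula L) (v : ℕ → M) :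
    (ψ.alls xs).Realize v ↔ ∀ w : ℕ → M, (∀ i ∉ xs, w i = v i) → ψ.Realize w := by
  induction xs generalizing v with
  | nil =>
    constructor
    · intro h w hw
      obtain rfl : w = v := funext fun i => hw i (by simp)
      exact h
    · exact fun h => h v fun _ _ => rfl
  | cons x xs ih =>
    change (∀ a : M, (ψ.alls xs).Realize (Function.update v x a)) ↔ _
    simp only [ih]
    constructor
    · intro h w hw
      refine h (w x) w fun i hi => ?_
      by_cases hx : i = x
      · subst hx; simp
      · rw [Function.update_of_ne hx]
        exact hw i (by simp [hx, hi])
    · intro h a w hw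
      refine h w fun i hi => ?_
      simp only [List.mem_cons, not_or] at hi
      rw [hw i hi.2, Function.update_of_ne hi.1]

theorem realize_congr (φ : InfFormula L) {v w : ℕ → M} (h : ∀ i ∈ φ.freeVars, v i = w i) :
    φ.Realize v ↔ φ.Realize w := by
  induction φ generalizing v w with
  | qf θ hθ => exact realize_congr_freeVarFinset θ _ h
  | iSup I ψ ih =>
    exact exists_congr fun i => ih i fun j hj => h j (Set.mem_iUnion.2 ⟨i, hj⟩)
  | iInf I ψ ih =>
    exact forall_congr' fun i => ih i fun j hj => h j (Set.mem_iUnion.2 ⟨i, hj⟩)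
  | ex x ψ ih =>
    refine exists_congr fun a => ih fun j hj => ?_
    by_cases hx : j = x
    · subst hx; simp
    · simp only [Function.update_of_ne hx]
      exact h j ⟨hj, hx⟩
  | all x ψ ih =>
    refine forall_congr' fun a => ih fun j hj => ?_
    by_cases hx : j = x
    · subst hx; simp
    · simp only [Function.update_of_ne hx]
      exact h j ⟨hj, hx⟩

theorem IsSentence.models_iff {φ : InfFormula L} (hφ : φ.IsSentence) (v : ℕ → M) :
    φ.Models M ↔ φ.Realize v := by
  refine ⟨fun h => h v, fun h w => (φ.realize_congr fun i hi => ?_).1 h⟩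
  rw [hφ] at hi
  exact hi.elim

theorem realize_equiv {N : Type} [L.Structure N] (e : M ≃[L] N) (φ : InfFormula L) (v : ℕ → M) :
    φ.Realize (e ∘ v) ↔ φ.Realize v := by
  induction φ generalizing v with
  | qf θ hθ => exact StrongHomClass.realize_formula e θ
  | iSup I ψ ih => exact exists_congr fun i => ih i v
  | iInf I ψ ih => exact forall_congr' fun i => ih i v
  | ex x ψ ih =>
    have key : ∀ a, e ∘ Function.update v x a = Function.update (e ∘ v) x (e a) :=
      fun a => Function.comp_update e v x a
    simp only [Realize, ← ih, key]
    exact e.surjective.exists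
  | all x ψ ih =>
    have key : ∀ a, e ∘ Function.update v x a = Function.update (e ∘ v) x (e a) :=
      fun a => Function.comp_update e v x a
    simp only [Realize, ← ih, key]
    exact e.surjective.forall

end Realize

theorem freeVars_exs (xs : List ℕ) (ψ : InfFormula L) :
    (ψ.exs xs).freeVars = ψ.freeVars \ {i | i ∈ xs} := by
  induction xs with
  | nil => simp [exs]
  | cons x xs ih =>
    change (ψ.exs xs).freeVars \ {x} = _
    rw [ih]
    ext i
    simp
    tauto

theorem freeVars_alls (xs : List ℕ) (ψ : InfFormula L) :
    (ψ.alls xs).freeVars = ψ.freeVars \ {i | i ∈ xs} := by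
  induction xs with
  | nil => simp [alls]
  | cons x xs ih =>
    change (ψ.alls xs).freeVars \ {x} = _
    rw [ih]
    ext i
    simp
    tauto

/-- Negation, in negation normal form. -/
def neg : InfFormula L → InfFormula L
  | qf θ hθ => qf θ.not hθ.not
  | iSup I ψ => iInf I fun i => (ψ i).neg
  | iInf I ψ => iSup I fun i => (ψ i).neg
  | ex x ψ => all x ψ.neg
  | all x ψ => ex x ψ.neg

@[simp] theorem realize_neg {M : Type} [L.Structure M] (φ : InfFormula L) (v : ℕ → M) :
    φ.neg.Realize v ↔ ¬ φ.Realize v := by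
  induction φ generalizing v with
  | qf θ hθ => exact Formula.realize_not
  | iSup I ψ ih => simp only [neg, Realize, ih, not_exists]
  | iInf I ψ ih => simp only [neg, Realize, ih, not_forall]
  | ex x ψ ih => simp only [neg, Realize, ih, not_exists]
  | all x ψ ih => simp only [neg, Realize, ih, not_forall]

@[simp] theorem freeVars_neg (φ : InfFormula L) : φ.neg.freeVars = φ.freeVars := by
  induction φ with
  | qf θ hθ => simp [neg, freeVars, Formula.not, BoundedFormula.not, BoundedFormula.freeVarFinset]
  | iSup I ψ ih => simp [neg, freeVars, ih]
  | iInf I ψ ih => simp [neg, freeVars, ih]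
  | ex x ψ ih => simp [neg, freeVars, ih]
  | all x ψ ih => simp [neg, freeVars, ih]

theorem neg_exs (xs : List ℕ) (ψ : InfFormula L) : (ψ.exs xs).neg = ψ.neg.alls xs := by
  induction xs with
  | nil => rfl
  | cons x xs ih => exact congrArg (all x) ih

theorem neg_alls (xs : List ℕ) (ψ : InfFormula L) : (ψ.alls xs).neg = ψ.neg.exs xs := by
  induction xs with
  | nil => rfl
  | cons x xs ih => exact congrArg (ex x) ih

theorem neg_isSigma_isPi (k : ℕ) (φ : InfFormula L) :
    (φ.IsSigma k → φ.neg.IsPi k) ∧ (φ.IsPi k → φ.neg.IsSigma k) := by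
  induction k generalizing φ with
  | zero =>
    simp only [IsSigma, IsPi]
    constructor <;> (rintro ⟨θ, hθ, rfl⟩; exact ⟨_, hθ.not, rfl⟩)
  | succ k ih =>
    simp only [IsSigma, IsPi]
    constructor
    · rintro ⟨I, xs, ψ, rfl, h⟩
      exact ⟨I, xs, fun i => (ψ i).neg, by simp only [neg, neg_exs], fun i => (ih _).2 (h i)⟩
    · rintro ⟨I, xs, ψ, rfl, h⟩
      exact ⟨I, xs, fun i => (ψ i).neg, by simp only [neg, neg_alls], fun i => (ih _).1 (h i)⟩

theorem IsSigma.neg {k : ℕ} {φ : InfFormula L} (h : φ.IsSigma k) : φ.neg.IsPi k :=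
  (neg_isSigma_isPi k φ).1 h

theorem IsPi.neg {k : ℕ} {φ : InfFormula L} (h : φ.IsPi k) : φ.neg.IsSigma k :=
  (neg_isSigma_isPi k φ).2 h

/-- `φ` is equivalent to `ψ` in all non-empty structures, and has no further free variables. -/
def Refines (φ ψ : InfFormula L) : Prop :=
  φ.freeVars ⊆ ψ.freeVars ∧
    ∀ (M : Type) [L.Structure M] [Nonempty M] (v : ℕ → M), φ.Realize v ↔ ψ.Realize v

theorem Refines.refl (φ : InfFormula L) : φ.Refines φ := ⟨subset_rfl, fun _ _ _ _ => Iff.rfl⟩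

theorem Refines.trans {φ ψ χ : InfFormula L} (h : φ.Refines ψ) (h' : ψ.Refines χ) :
    φ.Refines χ :=
  ⟨h.1.trans h'.1, fun M _ _ v => (h.2 M v).trans (h'.2 M v)⟩

theorem Refines.neg {φ ψ : InfFormula L} (h : φ.Refines ψ) : φ.neg.Refines ψ.neg :=
  ⟨by simpa using h.1, fun M _ _ v => by simp [h.2 M v]⟩

theorem Refines.exs {φ ψ : InfFormula L} (h : φ.Refines ψ) (xs : List ℕ) :
    (φ.exs xs).Refines (ψ.exs xs) := by
  refine ⟨?_, fun M _ _ v => by simp only [realize_exs, h.2 M]⟩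
  rw [freeVars_exs, freeVars_exs]
  exact Set.sdiff_subset_sdiff_left h.1

theorem Refines.alls {φ ψ : InfFormula L} (h : φ.Refines ψ) (xs : List ℕ) :
    (φ.alls xs).Refines (ψ.alls xs) := by
  refine ⟨?_, fun M _ _ v => by simp only [realize_alls, h.2 M]⟩
  rw [freeVars_alls, freeVars_alls]
  exact Set.sdiff_subset_sdiff_left h.1

theorem IsScottSentence.of_refines {M : Type} [L.Structure M] {φ ψ : InfFormula L}
    (h : φ.Refines ψ) (hψ : IsScottSentence M ψ) : IsScottSentence M φ := by
  refine ⟨Set.subset_empty_iff.1 (h.1.trans hψ.1.subset), fun N _ _ _ => ?_⟩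
  rw [← hψ.2 N]
  exact forall_congr' fun v => h.2 N v

end InfFormula

-- Guarded conjunctions and disjunctions

namespace InfFormula

/-- The disjunction of two formulas. -/
noncomputable def or (φ ψ : InfFormula L) : InfFormula L :=
  iSup {i | i < 2} fun i => if i.1 = 0 then φ else ψ

@[simp] theorem realize_or {M : Type} [L.Structure M] (φ ψ : InfFormula L) (v : ℕ → M) :
    (φ.or ψ).Realize v ↔ φ.Realize v ∨ ψ.Realize v := by
  simp only [InfFormula.or, realize_iSup]
  constructor
  · rintro ⟨i, hi⟩
    split_ifs at hi
    exacts [.inl hi, .inr hi]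
  · rintro (h | h)
    exacts [⟨⟨0, by simp⟩, by simpa using h⟩, ⟨⟨1, by simp⟩, by simpa using h⟩]

@[simp] theorem freeVars_or (φ ψ : InfFormula L) :
    (φ.or ψ).freeVars = φ.freeVars ∪ ψ.freeVars := by
  ext x
  simp only [InfFormula.or, freeVars, Set.mem_iUnion, Set.mem_union]
  constructor
  · rintro ⟨i, hi⟩
    split_ifs at hi
    exacts [.inl hi, .inr hi]
  · rintro (h | h)
    exacts [⟨⟨0, by simp⟩, by simpa using h⟩, ⟨⟨1, by simp⟩, by simpa using h⟩]

theorem Refines.or {φ φ' ψ ψ' : InfFormula L} (h : φ.Refines φ') (h' : ψ.Refines ψ') :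
    (φ.or ψ).Refines (φ'.or ψ') :=
  ⟨by simpa using ⟨h.1.trans Set.subset_union_left, h'.1.trans Set.subset_union_right⟩,
    fun M _ _ v => by simp [h.2 M v, h'.2 M v]⟩

/-- A sentence expressing a fixed proposition. -/
def truth (L : FirstOrder.Language.{0, 0}) (P : Prop) : InfFormula L :=
  iSup {j | j = 0 ∧ P} fun _ => (qf ⊤ BoundedFormula.IsQF.top).exs []

@[simp] theorem realize_truth {M : Type} [L.Structure M] (P : Prop) (v : ℕ → M) :
    (truth L P).Realize v ↔ P := by
  simp [truth, exs]

@[simp] theorem freeVars_truth (P : Prop) : (truth L P).freeVars = ∅ := by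
  simp [truth, freeVars, exs]

/-- The conjunction of the formulas `∀ x̄_j σ_j`, over all `j` satisfying `S`. -/
noncomputable def guardedInf (S : ℕ → Prop) (xs : ℕ → List ℕ) (σ : ℕ → InfFormula L) :
    InfFormula L :=
  iInf Set.univ fun j => ((truth L (¬ S j)).or (σ j)).alls (xs j)

/-- The disjunction of the formulas `∃ x̄_j σ_j`, over all `j` satisfying `S`. -/
noncomputable def guardedSup (S : ℕ → Prop) (xs : ℕ → List ℕ) (σ : ℕ → InfFormula L) :
    InfFormula L :=
  (guardedInf S xs fun j => (σ j).neg).neg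

section Guarded

variable (S : ℕ → Prop) (xs : ℕ → List ℕ) (σ : ℕ → InfFormula L)

theorem realize_guardedInf {M : Type} [L.Structure M] (v : ℕ → M) :
    (guardedInf S xs σ).Realize v ↔
      ∀ j, S j → ∀ w : ℕ → M, (∀ i ∉ xs j, w i = v i) → (σ j).Realize w := by
  simp only [guardedInf, realize_iInf, realize_alls, realize_or, realize_truth, Subtype.forall,
    Set.mem_univ, true_imp_iff]
  refine forall_congr' fun j => ⟨fun h hj w hw => ?_, fun h w hw => ?_⟩
  · exact (h w hw).resolve_left (not_not.2 hj)
  · exact Classical.or_iff_not_imp_left.2 fun hj => h (not_not.1 hj) w hw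

theorem realize_guardedSup {M : Type} [L.Structure M] (v : ℕ → M) :
    (guardedSup S xs σ).Realize v ↔
      ∃ j, S j ∧ ∃ w : ℕ → M, (∀ i ∉ xs j, w i = v i) ∧ (σ j).Realize w := by
  rw [guardedSup, realize_neg, realize_guardedInf]
  simp only [realize_neg]
  push Not
  rfl

theorem freeVars_guardedInf :
    (guardedInf S xs σ).freeVars = ⋃ j, (σ j).freeVars \ {i | i ∈ xs j} := by
  simp [guardedInf, freeVars, freeVars_alls]

theorem freeVars_guardedSup :
    (guardedSup S xs σ).freeVars = ⋃ j, (σ j).freeVars \ {i | i ∈ xs j} := by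
  simp [guardedSup, freeVars_guardedInf]

/-- When effectiveness does not matter, the guard can simply be moved into the index set of the
conjunction, so it costs no complexity. -/
theorem exists_isPi_refines_guardedInf {k : ℕ}
    (hσ : ∀ j, ∃ τ : InfFormula L, τ.IsSigma k ∧ τ.Refines (σ j)) :
    ∃ τ : InfFormula L, τ.IsPi (k + 1) ∧ τ.Refines (guardedInf S xs σ) := by
  choose τ h1 h2 using hσ
  refine ⟨iInf {j | S j} fun j => (τ j).alls (xs j), ⟨_, _, _, rfl, fun j => h1 j⟩, ?_,
    fun M _ _ v => ?_⟩
  · rw [freeVars_guardedInf]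
    refine Set.iUnion_subset fun j => Set.subset_iUnion_of_subset j.1 ?_
    rw [freeVars_alls]
    exact Set.sdiff_subset_sdiff_left (h2 _).1
  · simp only [realize_guardedInf, realize_iInf, realize_alls, Subtype.forall, Set.mem_ofPred_eq,
      (h2 _).2 M]

end Guarded

end InfFormula

-- Operations on indices of computable formulas

section Index

variable [Primcodable (Σ k, L.Functions k)]

theorem termCode_injective {α : Type} [Encodable α] :
    Function.Injective (termCode : L.Term α → ℕ) := by
  intro t
  induction t with
  | var a =>
    rintro (b | ⟨f, ts⟩) h
    · simp only [termCode] at h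
      rw [encode_injective (by omega : encode a = encode b)]
    · simp only [termCode] at h
      omega
  | @func l f ts ih =>
    rintro (b | ⟨g, us⟩) h
    · simp only [termCode] at h
      omega
    · simp only [termCode] at h
      obtain ⟨h1, h2⟩ := Nat.pair_eq_pair.1 (by omega :
        Nat.pair (encode (⟨l, f⟩ : Σ k, L.Functions k)) (encode (List.ofFn fun i => termCode (ts i)))
        = Nat.pair (encode (⟨_, g⟩ : Σ k, L.Functions k))
          (encode (List.ofFn fun i => termCode (us i))))
      cases encode_injective h1
      have h3 := List.ofFn_injective (encode_injective h2)
      congr 1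
      exact funext fun i => ih i (congrFun h3 i)

variable [Primcodable (Σ k, L.Relations k)]

theorem formulaCode_injective {m : ℕ} :
    Function.Injective (formulaCode : L.BoundedFormula ℕ m → ℕ) := by
  intro φ
  induction φ with
  | falsum =>
    rintro (_ | _ | _ | _ | _) h <;> simp only [formulaCode] at h <;> first | rfl | omega
  | equal t₁ t₂ =>
    rintro (_ | ⟨u₁, u₂⟩ | _ | _ | _) h <;> simp only [formulaCode] at h <;> try omega
    obtain ⟨h1, h2⟩ := Nat.pair_eq_pair.1 (by omega :
      Nat.pair (termCode t₁) (termCode t₂) = Nat.pair (termCode u₁) (termCode u₂))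
    rw [termCode_injective h1, termCode_injective h2]
  | @rel m l R ts =>
    rintro (_ | _ | ⟨S, us⟩ | _ | _) h <;> simp only [formulaCode] at h <;> try omega
    obtain ⟨h1, h2⟩ := Nat.pair_eq_pair.1 (by omega :
      Nat.pair (encode (⟨l, R⟩ : Σ k, L.Relations k)) (encode (List.ofFn fun i => termCode (ts i)))
      = Nat.pair (encode (⟨_, S⟩ : Σ k, L.Relations k))
        (encode (List.ofFn fun i => termCode (us i))))
    cases encode_injective h1
    have h3 := List.ofFn_injective (encode_injective h2)
    congr 1
    exact funext fun i => termCode_injective (congrFun h3 i)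
  | imp φ ψ ih₁ ih₂ =>
    rintro (_ | _ | _ | ⟨φ', ψ'⟩ | _) h <;> simp only [formulaCode] at h <;> try omega
    obtain ⟨h1, h2⟩ := Nat.pair_eq_pair.1 (by omega :
      Nat.pair (formulaCode φ) (formulaCode ψ) = Nat.pair (formulaCode φ') (formulaCode ψ'))
    rw [ih₁ h1, ih₂ h2]
  | all φ ih =>
    rintro (_ | _ | _ | _ | φ') h <;> simp only [formulaCode] at h <;> try omega
    rw [ih (by omega : formulaCode φ = formulaCode φ')]

variable {X : Set ℕ}

/-- Needed because a c.e. set of pairs may list the same pair for several members of a family: equal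
indices then carry equal formulas. -/
theorem index_unique (k : ℕ) : ∀ (e : ℕ) (φ ψ : InfFormula L),
    (IsSigmaIndex X k e φ → IsSigmaIndex X k e ψ → φ = ψ) ∧
    (IsPiIndex X k e φ → IsPiIndex X k e ψ → φ = ψ) := by
  induction k with
  | zero =>
    intro e φ ψ
    simp only [IsSigmaIndex, IsPiIndex]
    constructor <;>
    · rintro ⟨θ, hθ, rfl, he⟩ ⟨θ', hθ', rfl, he'⟩
      cases formulaCode_injective (he.symm.trans he')
      rfl
  | succ k ih =>
    intro e φ ψ
    simp only [IsSigmaIndex, IsPiIndex]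
    constructor
    · rintro ⟨φ', rfl, h⟩ ⟨ψ', rfl, h'⟩
      rw [show φ' = ψ' from funext fun i => (ih _ _ _).2 (h i) (h' i)]
    · rintro ⟨φ', rfl, h⟩ ⟨ψ', rfl, h'⟩
      rw [show φ' = ψ' from funext fun i => (ih _ _ _).1 (h i) (h' i)]

/-- Passes from a family over an arbitrary type `ι` to the conjunction over `W X e` which the
definition of an index requires. The map from `ι` to pairs need not be injective; a preimage is
chosen for each pair, and by `index_unique` the choice does not matter. -/
theorem exists_piIndex {k e : ℕ} {ι : Type} {xs : ι → List ℕ} {g : ι → ℕ}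
    {σ : ι → InfFormula L} (hW : ∀ z, z ∈ W X e ↔ ∃ j, z = Nat.pair (encode (xs j)) (g j))
    (hσ : ∀ j, IsSigmaIndex X k (g j) (σ j)) :
    ∃ φ : InfFormula L, IsPiIndex X (k + 1) e φ ∧ φ.freeVars = ⋃ j, ((σ j).alls (xs j)).freeVars ∧
      ∀ (M : Type) [L.Structure M] (v : ℕ → M), φ.Realize v ↔ ∀ j, ((σ j).alls (xs j)).Realize v := by
  choose c hc using fun z : W X e => (hW z).1 z.2
  have key : ∀ j, ∃ z : W X e, (σ (c z)).alls (Denumerable.ofNat (List ℕ) (Nat.unpair z).1) =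
      (σ j).alls (xs j) := by
    intro j
    let z : W X e := ⟨_, (hW _).2 ⟨j, rfl⟩⟩
    have h := hc z
    obtain ⟨h1, h2⟩ := Nat.pair_eq_pair.1 h
    refine ⟨z, ?_⟩
    have h3 := hσ (c z)
    rw [← h2] at h3
    rw [(index_unique k _ _ _).1 h3 (hσ j)]
    simp [z]
  have key' : ∀ z : W X e, (σ (c z)).alls (Denumerable.ofNat (List ℕ) (Nat.unpair z).1) =
      (σ (c z)).alls (xs (c z)) := by
    intro z
    rw [hc z]
    simp
  refine ⟨_, ⟨fun z => σ (c z), rfl, fun z => ?_⟩, ?_, fun M _ v => ?_⟩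
  · have := hσ (c z)
    rw [hc z]
    simpa using this
  · ext x
    simp only [freeVars, Set.mem_iUnion]
    constructor
    · rintro ⟨z, hz⟩
      exact ⟨c z, key' z ▸ hz⟩
    · rintro ⟨j, hj⟩
      obtain ⟨z, hz⟩ := key j
      exact ⟨z, hz ▸ hj⟩
  · simp only [realize_iInf]
    constructor
    · intro h j
      obtain ⟨z, hz⟩ := key j
      exact hz ▸ h z
    · intro h z
      rw [key']
      exact h _

theorem exists_sigmaIndex {k e : ℕ} {ι : Type} {xs : ι → List ℕ} {g : ι → ℕ}
    {σ : ι → InfFormula L} (hW : ∀ z, z ∈ W X e ↔ ∃ j, z = Nat.pair (encode (xs j)) (g j))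
    (hσ : ∀ j, IsPiIndex X k (g j) (σ j)) :
    ∃ φ : InfFormula L, IsSigmaIndex X (k + 1) e φ ∧
      φ.freeVars = ⋃ j, ((σ j).exs (xs j)).freeVars ∧
      ∀ (M : Type) [L.Structure M] (v : ℕ → M), φ.Realize v ↔ ∃ j, ((σ j).exs (xs j)).Realize v := by
  choose c hc using fun z : W X e => (hW z).1 z.2
  have key : ∀ j, ∃ z : W X e, (σ (c z)).exs (Denumerable.ofNat (List ℕ) (Nat.unpair z).1) =
      (σ j).exs (xs j) := by
    intro j
    let z : W X e := ⟨_, (hW _).2 ⟨j, rfl⟩⟩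
    have h := hc z
    obtain ⟨h1, h2⟩ := Nat.pair_eq_pair.1 h
    refine ⟨z, ?_⟩
    have h3 := hσ (c z)
    rw [← h2] at h3
    rw [(index_unique k _ _ _).2 h3 (hσ j)]
    simp [z]
  have key' : ∀ z : W X e, (σ (c z)).exs (Denumerable.ofNat (List ℕ) (Nat.unpair z).1) =
      (σ (c z)).exs (xs (c z)) := by
    intro z
    rw [hc z]
    simp
  refine ⟨_, ⟨fun z => σ (c z), rfl, fun z => ?_⟩, ?_, fun M _ v => ?_⟩
  · have := hσ (c z)
    rw [hc z]
    simpa using this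
  · ext x
    simp only [freeVars, Set.mem_iUnion]
    constructor
    · rintro ⟨z, hz⟩
      exact ⟨c z, key' z ▸ hz⟩
    · rintro ⟨j, hj⟩
      obtain ⟨z, hz⟩ := key j
      exact ⟨z, hz ▸ hj⟩
  · simp only [realize_iSup]
    constructor
    · rintro ⟨z, hz⟩
      exact ⟨c z, key' z ▸ hz⟩
    · rintro ⟨j, hj⟩
      obtain ⟨z, hz⟩ := key j
      exact ⟨z, hz ▸ hj⟩

/-- An operation on the matrices of the members of a c.e. family, on the level of indices. -/
theorem exists_map_index (X : Set ℕ) {g : ℕ → ℕ} (hg : Computable g) :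
    ∃ h : ℕ → ℕ, Computable h ∧
      ∀ e z, z ∈ W X (h e) ↔ ∃ y : W X e, z =
        Nat.pair (encode (Denumerable.ofNat (List ℕ) (Nat.unpair y).1)) (g (Nat.unpair y).2) := by
  have hu : Computable Nat.unpair := Primrec.unpair.to_comp
  obtain ⟨h, hh, hW⟩ := exists_image_index X
    (f := fun _ y => Nat.pair y.unpair.1 (g y.unpair.2))
    ((Primrec₂.natPair.to_comp.comp (Computable.fst.comp hu)
      (hg.comp (Computable.snd.comp hu))).comp Computable.snd).to₂ (ceIn_univ X)
  refine ⟨h, hh, fun e z => ?_⟩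
  simp [hW]

/-- The negation lists the same tuples of variables with negated matrices, so the index map at level
`k + 1` is the one of level `k` applied to the members of a c.e. set. -/
theorem exists_neg_index (L : FirstOrder.Language.{0, 0}) [Primcodable (Σ k, L.Functions k)]
    [Primcodable (Σ k, L.Relations k)] (X : Set ℕ) (k : ℕ) :
    ∃ g : ℕ → ℕ, Computable g ∧ ∀ (e : ℕ) (φ : InfFormula L),
      (IsSigmaIndex X k e φ → ∃ ψ, IsPiIndex X k (g e) ψ ∧ ψ.Refines φ.neg) ∧
      (IsPiIndex X k e φ → ∃ ψ, IsSigmaIndex X k (g e) ψ ∧ ψ.Refines φ.neg) := by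
  induction k with
  | zero =>
    -- `θ.not` is `θ` implies `⊥`, and `⊥` has Gödel number `0`.
    refine ⟨fun e => 4 * Nat.pair e 0 + 3, ?_, fun e φ => ?_⟩
    · exact (Primrec.nat_add.comp (Primrec.nat_mul.comp (Primrec.const 4)
        (Primrec₂.natPair.comp Primrec.id (Primrec.const 0))) (Primrec.const 3)).to_comp
    · simp only [IsSigmaIndex, IsPiIndex]
      constructor <;>
      · rintro ⟨θ, hθ, rfl, rfl⟩
        exact ⟨_, ⟨θ.not, hθ.not, rfl, rfl⟩, Refines.refl _⟩
  | succ k ih =>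
    obtain ⟨g, hg, hgi⟩ := ih
    obtain ⟨h, hh, hW⟩ := exists_map_index X hg
    refine ⟨h, hh, fun e φ => ⟨?_, ?_⟩⟩
    · rintro ⟨σ, rfl, hσ⟩
      choose τ hτ hτσ using fun j => (hgi _ _).2 (hσ j)
      obtain ⟨φ, h1, h2, h3⟩ := exists_piIndex (hW e) hτ
      refine ⟨φ, h1, ?_, fun M _ _ v => ?_⟩
      · rw [h2, freeVars_neg]
        refine Set.iUnion_mono fun j => ?_
        have := ((hτσ j).alls (Denumerable.ofNat (List ℕ) (Nat.unpair j).1)).1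
        rwa [← neg_exs, freeVars_neg] at this
      · rw [h3]
        simp only [neg, realize_iInf]
        refine forall_congr' fun j => ?_
        rw [neg_exs]
        exact ((hτσ j).alls _).2 M v
    · rintro ⟨σ, rfl, hσ⟩
      choose τ hτ hτσ using fun j => (hgi _ _).1 (hσ j)
      obtain ⟨φ, h1, h2, h3⟩ := exists_sigmaIndex (hW e) hτ
      refine ⟨φ, h1, ?_, fun M _ _ v => ?_⟩
      · rw [h2, freeVars_neg]
        refine Set.iUnion_mono fun j => ?_
        have := ((hτσ j).exs (Denumerable.ofNat (List ℕ) (Nat.unpair j).1)).1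
        rwa [← neg_alls, freeVars_neg] at this
      · rw [h3]
        simp only [neg, realize_iSup]
        refine exists_congr fun j => ?_
        rw [neg_alls]
        exact ((hτσ j).exs _).2 M v

/-- Only the innermost level changes: a quantifier-free matrix becomes a one-member disjunction or
conjunction with the empty tuple of variables, and the outer connectives are kept. -/
theorem exists_succ_index (L : FirstOrder.Language.{0, 0}) [Primcodable (Σ k, L.Functions k)]
    [Primcodable (Σ k, L.Relations k)] (X : Set ℕ) (k : ℕ) :
    ∃ g : ℕ → ℕ, Computable g ∧ ∀ (e : ℕ) (φ : InfFormula L),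
      (IsSigmaIndex X k e φ → ∃ ψ, IsSigmaIndex X (k + 1) (g e) ψ ∧ ψ.Refines φ) ∧
      (IsPiIndex X k e φ → ∃ ψ, IsPiIndex X (k + 1) (g e) ψ ∧ ψ.Refines φ) := by
  induction k with
  | zero =>
    obtain ⟨h, hh, hW⟩ := exists_image_index X
      (f := fun e _ => Nat.pair (encode ([] : List ℕ)) e)
      ((Primrec₂.natPair.comp (Primrec.const _) Primrec.fst).to_comp.to₂)
      (ceIn_of_computable X (p := fun _ => true) (Computable.const _))
    have hW' : ∀ e z, z ∈ W X (h e) ↔ ∃ _ : Unit, z = Nat.pair (encode ([] : List ℕ)) e := by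
      intro e z
      simp [hW]
    refine ⟨h, hh, fun e φ => ⟨?_, ?_⟩⟩
    · rintro ⟨θ, hθ, rfl, rfl⟩
      obtain ⟨φ, h1, h2, h3⟩ := exists_sigmaIndex (L := L) (k := 0) (hW' (formulaCode θ))
        (σ := fun _ => qf θ hθ) fun _ => ⟨θ, hθ, rfl, rfl⟩
      refine ⟨φ, h1, by rw [h2]; simp [exs], fun M _ _ v => by rw [h3]; simp [exs]⟩
    · rintro ⟨θ, hθ, rfl, rfl⟩
      obtain ⟨φ, h1, h2, h3⟩ := exists_piIndex (L := L) (k := 0) (hW' (formulaCode θ))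
        (σ := fun _ => qf θ hθ) fun _ => ⟨θ, hθ, rfl, rfl⟩
      refine ⟨φ, h1, by rw [h2]; simp [alls], fun M _ _ v => by rw [h3]; simp [alls]⟩
  | succ k ih =>
    obtain ⟨g, hg, hgi⟩ := ih
    obtain ⟨h, hh, hW⟩ := exists_map_index X hg
    refine ⟨h, hh, fun e φ => ⟨?_, ?_⟩⟩
    · rintro ⟨σ, rfl, hσ⟩
      choose τ hτ hτσ using fun j => (hgi _ _).2 (hσ j)
      obtain ⟨φ, h1, h2, h3⟩ := exists_sigmaIndex (hW e) hτ
      refine ⟨φ, h1, ?_, fun M _ _ v => ?_⟩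
      · rw [h2]
        exact Set.iUnion_mono fun j => ((hτσ j).exs _).1
      · rw [h3]
        exact exists_congr fun j => ((hτσ j).exs _).2 M v
    · rintro ⟨σ, rfl, hσ⟩
      choose τ hτ hτσ using fun j => (hgi _ _).1 (hσ j)
      obtain ⟨φ, h1, h2, h3⟩ := exists_piIndex (hW e) hτ
      refine ⟨φ, h1, ?_, fun M _ _ v => ?_⟩
      · rw [h2]
        exact Set.iUnion_mono fun j => ((hτσ j).alls _).1
      · rw [h3]
        exact forall_congr' fun j => ((hτσ j).alls _).2 M v

end Index

/-! ### Uniformly computable families of formulas -/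

section Eff

variable [Primcodable (Σ k, L.Functions k)] [Primcodable (Σ k, L.Relations k)]
variable {α β : Type} [Primcodable α] [Primcodable β]

/-- Up to equivalence, `ψ` is a uniformly `X`-computable family of `X`-computable `Σ_k` formulas. -/
def EffSigma (X : Set ℕ) (k : ℕ) (ψ : α → InfFormula L) : Prop :=
  ∃ h : α → ℕ, Computable h ∧ ∀ a, ∃ φ, IsSigmaIndex X k (h a) φ ∧ φ.Refines (ψ a)

/-- Up to equivalence, `ψ` is a uniformly `X`-computable family of `X`-computable `Π_k` formulas. -/
def EffPi (X : Set ℕ) (k : ℕ) (ψ : α → InfFormula L) : Prop :=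
  ∃ h : α → ℕ, Computable h ∧ ∀ a, ∃ φ, IsPiIndex X k (h a) φ ∧ φ.Refines (ψ a)

variable {X : Set ℕ} {k l n : ℕ} {ψ χ : α → InfFormula L}

theorem EffSigma.of_refines (h : EffSigma X k ψ) (hr : ∀ a, (ψ a).Refines (χ a)) :
    EffSigma X k χ := by
  obtain ⟨g, hg, h⟩ := h
  refine ⟨g, hg, fun a => ?_⟩
  obtain ⟨φ, h1, h2⟩ := h a
  exact ⟨φ, h1, h2.trans (hr a)⟩

theorem EffPi.of_refines (h : EffPi X k ψ) (hr : ∀ a, (ψ a).Refines (χ a)) :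
    EffPi X k χ := by
  obtain ⟨g, hg, h⟩ := h
  refine ⟨g, hg, fun a => ?_⟩
  obtain ⟨φ, h1, h2⟩ := h a
  exact ⟨φ, h1, h2.trans (hr a)⟩

theorem EffSigma.comap (h : EffSigma X k ψ) {f : β → α} (hf : Computable f) :
    EffSigma X k fun b => ψ (f b) := by
  obtain ⟨g, hg, h⟩ := h
  exact ⟨fun b => g (f b), hg.comp hf, fun b => h _⟩

theorem EffPi.comap (h : EffPi X k ψ) {f : β → α} (hf : Computable f) :
    EffPi X k fun b => ψ (f b) := by
  obtain ⟨g, hg, h⟩ := h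
  exact ⟨fun b => g (f b), hg.comp hf, fun b => h _⟩

theorem EffSigma.neg (h : EffSigma X k ψ) : EffPi X k fun a => (ψ a).neg := by
  obtain ⟨g, hg, h⟩ := h
  obtain ⟨f, hf, hfi⟩ := exists_neg_index L X k
  refine ⟨fun a => f (g a), hf.comp hg, fun a => ?_⟩
  obtain ⟨φ, h1, h2⟩ := h a
  obtain ⟨φ', h3, h4⟩ := (hfi _ _).1 h1
  exact ⟨φ', h3, h4.trans h2.neg⟩

theorem EffPi.neg (h : EffPi X k ψ) : EffSigma X k fun a => (ψ a).neg := by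
  obtain ⟨g, hg, h⟩ := h
  obtain ⟨f, hf, hfi⟩ := exists_neg_index L X k
  refine ⟨fun a => f (g a), hf.comp hg, fun a => ?_⟩
  obtain ⟨φ, h1, h2⟩ := h a
  obtain ⟨φ', h3, h4⟩ := (hfi _ _).2 h1
  exact ⟨φ', h3, h4.trans h2.neg⟩

theorem EffSigma.mono (h : EffSigma X k ψ) (hkl : k ≤ l) : EffSigma X l ψ := by
  induction hkl with
  | refl => exact h
  | @step l _ ih =>
    obtain ⟨g, hg, h⟩ := ih
    obtain ⟨f, hf, hfi⟩ := exists_succ_index L X l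
    refine ⟨fun a => f (g a), hf.comp hg, fun a => ?_⟩
    obtain ⟨φ, h1, h2⟩ := h a
    obtain ⟨φ', h3, h4⟩ := (hfi _ _).1 h1
    exact ⟨φ', h3, h4.trans h2⟩

theorem EffSigma.or (h : EffSigma X (k + 1) ψ) (h' : EffSigma X (k + 1) χ) :
    EffSigma X (k + 1) fun a => (ψ a).or (χ a) := by
  obtain ⟨f, hf, h⟩ := h
  obtain ⟨g, hg, h'⟩ := h'
  obtain ⟨u, hu, hW⟩ := exists_index_union X (f := fun z => z.unpair.1) (g := fun z => z.unpair.2)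
    (Computable.fst.comp Primrec.unpair.to_comp) (Computable.snd.comp Primrec.unpair.to_comp)
  refine ⟨fun a => u (Nat.pair (f a) (g a)), hu.comp (Primrec₂.natPair.to_comp.comp hf hg),
    fun a => ?_⟩
  obtain ⟨_, ⟨σ, rfl, hσ⟩, h2⟩ := h a
  obtain ⟨_, ⟨τ, rfl, hτ⟩, h4⟩ := h' a
  have := exists_sigmaIndex (X := X) (k := k) (e := u (Nat.pair (f a) (g a)))
    (ι := W X (f a) ⊕ W X (g a))
    (xs := Sum.elim (fun i => Denumerable.ofNat (List ℕ) (Nat.unpair i).1)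
      (fun i => Denumerable.ofNat (List ℕ) (Nat.unpair i).1))
    (g := Sum.elim (fun i => (Nat.unpair i).2) (fun i => (Nat.unpair i).2))
    (σ := Sum.elim σ τ) (fun z => by simp [hW]) (by rintro (j | j); exacts [hσ j, hτ j])
  obtain ⟨φ, h5, h6, h7⟩ := this
  refine ⟨φ, h5, Refines.trans ⟨?_, fun M _ _ v => ?_⟩ (h2.or h4)⟩
  · rw [h6, freeVars_or, Set.iUnion_sum]
    rfl
  · rw [h7, realize_or, Sum.exists]
    rfl

/-- Guarded conjunctions, the guard being computably enumerable in the oracle. -/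
theorem EffSigma.iInf_of_ce [Inhabited α] {σ : α × ℕ → InfFormula L}
    (h : EffSigma (zeroJump n) k σ) {xs : α × ℕ → List ℕ} (hxs : Computable xs)
    {S : α × ℕ → Prop} (hS : ASig (n + 1) S) :
    EffPi (zeroJump n) (k + 1)
      fun a => iInf {j | S (a, j)} fun j => (σ (a, j)).alls (xs (a, j)) := by
  obtain ⟨g, hg, h⟩ := h
  have hu : Computable Nat.unpair := Primrec.unpair.to_comp
  -- The oracle results concern sets of numbers, so the parameter is passed through its code;
  -- numbers that are not codes stand for `default`.
  let d : ℕ → α := fun z => (decode z).getD default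
  have hd : Computable d := Primrec.option_getD.to_comp.comp Computable.decode (Computable.const _)
  have hde : ∀ a, d (encode a) = a := fun a => by simp [d]
  have hS' := (hS.comap (f := fun z : ℕ => (d z.unpair.1, z.unpair.2))
    ((hd.comp (Computable.fst.comp hu)).pair (Computable.snd.comp hu))).ceIn
  have hd' : Computable (fun p : ℕ × ℕ => (d p.1, p.2)) :=
    (hd.comp Computable.fst).pair Computable.snd
  obtain ⟨f, hf, hW⟩ := exists_image_index (zeroJump n)
    (f := fun i j => Nat.pair (encode (xs (d i, j))) (g (d i, j)))
    (Primrec₂.natPair.to_comp.comp (Computable.encode.comp (hxs.comp hd')) (hg.comp hd')).to₂ hS'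
  refine ⟨fun a => f (encode a), hf.comp Computable.encode, fun a => ?_⟩
  choose φ h1 h2 using h
  obtain ⟨φ', h3, h4, h5⟩ := exists_piIndex (X := zeroJump n) (k := k) (e := f (encode a))
    (ι := {j | S (a, j)}) (xs := fun j => xs (a, j)) (g := fun j => g (a, j))
    (σ := fun j => φ (a, j)) (fun z => by simp [hW, hde]) (fun j => h1 _)
  refine ⟨φ', h3, ?_, fun M _ _ v => ?_⟩
  · rw [h4]
    exact Set.iUnion_mono fun j => ((h2 _).alls _).1
  · rw [h5]
    exact forall_congr' fun j => ((h2 _).alls _).2 M v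

/-- Guarded disjunctions, the guard being computably enumerable in the oracle. -/
theorem EffPi.iSup_of_ce [Inhabited α] {σ : α × ℕ → InfFormula L}
    (h : EffPi (zeroJump n) k σ) {xs : α × ℕ → List ℕ} (hxs : Computable xs)
    {S : α × ℕ → Prop} (hS : ASig (n + 1) S) :
    EffSigma (zeroJump n) (k + 1)
      fun a => iSup {j | S (a, j)} fun j => (σ (a, j)).exs (xs (a, j)) := by
  refine (h.neg.iInf_of_ce hxs hS).neg.of_refines fun a => ⟨?_, fun M _ _ v => ?_⟩
  · rw [freeVars_neg]
    refine Set.iUnion_mono fun j => ?_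
    simp only [← neg_exs, freeVars_neg]
    exact subset_rfl
  · simp only [realize_neg, realize_iInf, realize_iSup, ← neg_exs, not_forall, not_not]

/-- Truth values of `Σ_{n+k+1}` predicates are expressed by `0⁽ⁿ⁾`-computable `Σ_{k+1}`
sentences. -/
theorem effSigma_truth [Inhabited α] {p : α → Prop} (hp : ASig (n + k + 1) p) :
    EffSigma (zeroJump n) (k + 1) fun a => truth L (p a) := by
  induction k generalizing α with
  | zero =>
    have h0 : EffPi (zeroJump n) 0 fun _ : α × ℕ => (qf ⊤ BoundedFormula.IsQF.top : InfFormula L) :=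
      ⟨fun _ => formulaCode (⊤ : L.Formula ℕ), Computable.const _,
        fun _ => ⟨_, ⟨_, _, rfl, rfl⟩, Refines.refl _⟩⟩
    -- A `Σ_{n+1}` predicate is c.e. in the oracle, so it can serve as the index set of a
    -- disjunction whose only possible member is `⊤`.
    refine h0.iSup_of_ce (xs := fun _ => []) (Computable.const _)
      (S := fun z => z.2 = 0 ∧ p z.1) (ASig.and ?_ (hp.comap Computable.fst))
    refine ASig.mono (ASig.of_iff (asig_zero_of_computable
      (c := fun z : α × ℕ => decide (z.2 = 0)) ?_) fun x => by simp) (Nat.zero_le _)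
    exact Primrec.eq.decide.to_comp.comp Computable.snd (Computable.const _)
  | succ k ih =>
    -- Since `p a` means `∃ y, ¬ q (a, y)`, the disjunction over all `y` of the negated truth
    -- sentences of `q` expresses it, at the price of one more level.
    obtain ⟨q, hq, h⟩ := hp
    have h1 := (ih hq).neg.iSup_of_ce (xs := fun _ => []) (Computable.const _)
      (S := fun _ => True) (ASig.mono (ASig.of_iff (asig_zero_of_computable
      (c := fun _ : α × ℕ => true) (Computable.const _)) fun x => by simp) (Nat.zero_le _))
    refine h1.of_refines fun a => ⟨?_, fun M _ _ v => ?_⟩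
    · simp [freeVars, exs]
    · simp [exs, h]

/-- Guarded conjunctions of `Σ_k` formulas, the guard being any `Σ_{n+k+1}` predicate. -/
theorem EffSigma.guardedInf [Inhabited α] {σ : α × ℕ → InfFormula L}
    (h : EffSigma (zeroJump n) k σ) {xs : α × ℕ → List ℕ} (hxs : Computable xs)
    {S : α × ℕ → Prop} (hS : ASig (n + k + 1) S) :
    EffPi (zeroJump n) (k + 1)
      fun a => InfFormula.guardedInf (fun j => S (a, j)) (fun j => xs (a, j))
        fun j => σ (a, j) := by
  cases k with
  | zero =>
    refine (h.iInf_of_ce hxs hS).of_refines fun a => ⟨?_, fun M _ _ v => ?_⟩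
    · rw [freeVars_guardedInf]
      refine Set.iUnion_subset fun j => Set.subset_iUnion_of_subset j.1 ?_
      rw [freeVars_alls]
    · simp [realize_guardedInf, realize_iInf, realize_alls]
  | succ k =>
    -- With the guard written as `∃ l, ¬ q`, the guarded conjunction becomes an unguarded one over
    -- pairs `⟨j, l⟩` of the formulas "`q` or `σ`". As `q` has only level `n + k + 1`, its truth
    -- value is a `Σ_{k+1}` sentence, and the disjunction stays `Σ_{k+1}`.
    obtain ⟨q, hq, hSq⟩ := hS
    have hu : Computable (fun z : α × ℕ => z.2.unpair) :=
      Primrec.unpair.to_comp.comp Computable.snd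
    have hf : Computable (fun z : α × ℕ => (z.1, z.2.unpair.1)) :=
      Computable.fst.pair (Computable.fst.comp hu)
    have hf2 : Computable (fun z : α × ℕ => ((z.1, z.2.unpair.1), z.2.unpair.2)) :=
      hf.pair (Computable.snd.comp hu)
    have h1 := (((effSigma_truth (L := L) hq).comap hf2).or (h.comap hf)).iInf_of_ce (hxs.comp hf)
      (S := fun _ => True) (ASig.mono (ASig.of_iff (asig_zero_of_computable
      (c := fun _ : α × ℕ => true) (Computable.const _)) fun x => by simp) (Nat.zero_le _))
    refine h1.of_refines fun a => ⟨?_, fun M _ _ v => ?_⟩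
    · rw [freeVars_guardedInf]
      refine Set.iUnion_subset fun j => Set.subset_iUnion_of_subset j.1.unpair.1 ?_
      simp [freeVars_alls]
    · simp only [realize_guardedInf, realize_iInf, realize_alls, realize_or, realize_truth,
        Subtype.forall, Set.mem_ofPred_eq, true_imp_iff, hSq]
      constructor
      · rintro H j ⟨l, hl⟩ w hw
        have := H (Nat.pair j l) w (by simpa using hw)
        simpa [hl] using this
      · intro H j w hw
        by_cases hl : q ((a, j.unpair.1), j.unpair.2)
        · exact .inl hl
        · exact .inr (H _ ⟨_, hl⟩ w hw)

/-- Guarded disjunctions of `Π_k` formulas, the guard being any `Σ_{n+k+1}` predicate. -/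
theorem EffPi.guardedSup [Inhabited α] {σ : α × ℕ → InfFormula L}
    (h : EffPi (zeroJump n) k σ) {xs : α × ℕ → List ℕ} (hxs : Computable xs)
    {S : α × ℕ → Prop} (hS : ASig (n + k + 1) S) :
    EffSigma (zeroJump n) (k + 1)
      fun a => InfFormula.guardedSup (fun j => S (a, j)) (fun j => xs (a, j))
        fun j => σ (a, j) :=
  (h.neg.guardedInf hxs hS).neg

end Eff

/-! ### Evaluation of quantifier-free formulas -/

section Recursion

/-- Course-of-values recursion. -/
def courseRec {σ : Type} (step : List σ → σ) (n : ℕ) : σ :=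
  step (List.ofFn fun i : Fin n => courseRec step i)
termination_by n
decreasing_by exact i.2

theorem courseRec_eq {σ : Type} (step : List σ → σ) (n : ℕ) :
    courseRec step n = step ((List.range n).map (courseRec step)) := by
  rw [courseRec]
  congr 1
  apply List.ext_getElem <;> simp

variable {α β σ : Type} [Primcodable α] [Primcodable β] [Primcodable σ]

/-- As `f` is only assumed computable, the list of values is built by recursion on the length,
appending one value at a time. -/
theorem computable_list_map {f : α → β → σ} {l : α → List β} (hf : Computable₂ f)
    (hl : Computable l) : Computable fun a => (l a).map (f a) := by
  have h1 : Computable fun p : α × ℕ × List σ => ((l p.1)[p.2.1]?).map (f p.1) :=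
    Computable.option_map (Computable.list_getElem?.comp (hl.comp Computable.fst)
      (Computable.fst.comp Computable.snd)) (hf.comp (Computable.fst.comp Computable.fst)
        Computable.snd).to₂
  have h2 : Computable fun p : α × ℕ × List σ =>
      p.2.2 ++ (((l p.1)[p.2.1]?).map (f p.1)).toList := by
    refine Computable.list_append.comp (Computable.snd.comp Computable.snd) ?_
    refine (Computable.option_casesOn h1 (Computable.const [])
      (Computable.list_cons.comp Computable.snd (Computable.const [])).to₂).of_eq fun p => ?_
    cases (l p.1)[p.2.1]? <;> rfl
  refine (Computable.nat_rec (Computable.list_length.comp hl) (Computable.const [])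
    h2.to₂).of_eq fun a => ?_
  suffices ∀ n, Nat.rec (motive := fun _ => List σ) []
      (fun n r => r ++ (((l a)[n]?).map (f a)).toList) n = ((l a).take n).map (f a) by
    rw [this, List.take_length]
  intro n
  induction n with
  | zero => simp
  | succ n ih =>
    simp only [ih, List.take_add_one, List.map_append]
    cases (l a)[n]? <;> rfl

theorem computable_courseRec {step : α → List σ → σ} (hs : Computable₂ step) :
    Computable₂ fun a => courseRec (step a) :=
  Computable.nat_strong_rec _ (g := fun a l => some (step a l))
    (Computable.option_some.comp hs).to₂ fun a n => by rw [courseRec_eq (step a) n]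

end Recursion

theorem mem_lt_encode {l : List ℕ} {i : ℕ} (hi : i ∈ l) : i < encode l := by
  induction l with
  | nil => simp at hi
  | cons a l ih =>
    rw [encode_list_cons, Nat.lt_succ_iff]
    rcases List.mem_cons.1 hi with rfl | h
    · exact Nat.left_le_pair _ _
    · exact (ih h).le.trans (Nat.right_le_pair _ _)

theorem range_map_getD {σ : Type} (f : ℕ → σ) {n i : ℕ} (d : σ) (h : i < n) :
    ((List.range n).map f).getD i d = f i := by
  simp [List.getD, h]

section Eval

variable {Φ : Type} [Primcodable Φ]

/-- One step of the evaluation of a term, given the values of the terms with smaller code. -/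
def termStep (a : ℕ → ℕ) (F : Φ × List ℕ → ℕ) (prev : List ℕ) : ℕ :=
  -- The code being evaluated is `prev.length`. A free variable `x_i` is `Sum.inl i`, encoded by `2
  -- * i`, so its term code is `4 * i`.
  bif decide (prev.length % 2 = 0) then a (prev.length / 4) else
    ((decode₂ Φ (prev.length / 2).unpair.1).map fun f =>
      F (f, (Denumerable.ofNat (List ℕ) (prev.length / 2).unpair.2).map
        fun i => prev.getD i 0)).getD 0

/-- Evaluation of terms on the level of codes. -/
def termEval (a : ℕ → ℕ) (F : Φ × List ℕ → ℕ) : ℕ → ℕ := courseRec (termStep a F)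

theorem termEval_var (a : ℕ → ℕ) (F : Φ × List ℕ → ℕ) (i : ℕ) :
    termEval a F (2 * (2 * i)) = a i := by
  rw [termEval, courseRec_eq, termStep]
  have h1 : 2 * (2 * i) % 2 = 0 := by omega
  have h2 : 2 * (2 * i) / 4 = i := by omega
  simp [h1, h2]

theorem termEval_func (a : ℕ → ℕ) (F : Φ × List ℕ → ℕ) (f : Φ) (l : List ℕ) :
    termEval a F (2 * Nat.pair (encode f) (encode l) + 1) = F (f, l.map (termEval a F)) := by
  rw [termEval, courseRec_eq, termStep]
  have h1 : (2 * Nat.pair (encode f) (encode l) + 1) / 2 = Nat.pair (encode f) (encode l) := by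
    omega
  have h2 : (2 * Nat.pair (encode f) (encode l) + 1) % 2 ≠ 0 := by omega
  simp only [List.length_map, List.length_range, h1, h2, decide_false, cond_false,
    Nat.unpair_pair, decode₂_encode, Option.map_some, Option.getD_some, Denumerable.ofNat_encode]
  congr 2
  refine List.map_congr_left fun i hi => range_map_getD _ _ ?_
  have := mem_lt_encode hi
  have := Nat.right_le_pair (encode f) (encode l)
  omega

theorem computable_termEval {α : Type} [Primcodable α] {a : α → ℕ → ℕ} (ha : Computable₂ a)
    {F : Φ × List ℕ → ℕ} (hF : Computable F) : Computable₂ fun x => termEval (a x) F := by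
  refine computable_courseRec (step := fun x => termStep (a x) F) ?_
  have hl : Computable fun p : α × List ℕ => p.2.length := Computable.list_length.comp Computable.snd
  have hdiv : ∀ k : ℕ, Computable fun p : α × List ℕ => p.2.length / k := fun k =>
    Primrec.nat_div.to_comp.comp hl (Computable.const k)
  have hu : Computable fun p : α × List ℕ => (p.2.length / 2).unpair :=
    Primrec.unpair.to_comp.comp (hdiv 2)
  refine Computable.cond (Primrec.eq.decide.to_comp.comp
    (Primrec.nat_mod.to_comp.comp hl (Computable.const 2)) (Computable.const 0))
    (ha.comp Computable.fst (hdiv 4)) ?_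
  have hm : Computable fun p : α × List ℕ =>
      (Denumerable.ofNat (List ℕ) (p.2.length / 2).unpair.2).map fun i => p.2.getD i 0 :=
    computable_list_map ((Primrec.list_getD 0).to_comp.comp (Computable.snd.comp Computable.fst)
      Computable.snd).to₂ ((Primrec.ofNat (List ℕ)).to_comp.comp (Computable.snd.comp hu))
  have hs : Computable₂ fun (p : α × List ℕ) (f : Φ) =>
      F (f, (Denumerable.ofNat (List ℕ) (p.2.length / 2).unpair.2).map fun i => p.2.getD i 0) :=
    hF.comp (Computable.snd.pair (hm.comp Computable.fst))
  exact Computable.option_getD (Computable.option_map (Primrec.decode₂.to_comp.comp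
    (Computable.fst.comp hu)) hs) (Computable.const 0)

/-- One step in the recognition of the codes of terms. -/
def termCheckStep (ar : Φ → ℕ) (prev : List Bool) : Bool :=
  bif decide (prev.length % 2 = 0) then decide (prev.length % 4 = 0) else
    decide ((decode₂ Φ (prev.length / 2).unpair.1).map ar =
      some (Denumerable.ofNat (List ℕ) (prev.length / 2).unpair.2).length) &&
    (Denumerable.ofNat (List ℕ) (prev.length / 2).unpair.2).foldr
      (fun i b => prev.getD i false && b) true

/-- Recognition of the codes of terms. -/
def termCheck (ar : Φ → ℕ) : ℕ → Bool := courseRec (termCheckStep ar)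

theorem foldr_and_eq_true {l : List ℕ} {p : ℕ → Bool} :
    l.foldr (fun i b => p i && b) true = true ↔ ∀ i ∈ l, p i = true := by
  induction l <;> simp_all

/-- An odd `i` would encode a bound variable from `Fin 0`, and there are none. -/
theorem termCheck_even (ar : Φ → ℕ) (i : ℕ) :
    termCheck ar (2 * i) = true ↔ ∃ j, i = 2 * j := by
  rw [termCheck, courseRec_eq, termCheckStep]
  have h1 : 2 * i % 2 = 0 := by omega
  simp only [List.length_map, List.length_range, h1, decide_true, cond_true, decide_eq_true_eq]
  constructor
  · exact fun h => ⟨i / 2, by omega⟩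
  · rintro ⟨j, rfl⟩
    omega

theorem termCheck_odd (ar : Φ → ℕ) (i : ℕ) :
    termCheck ar (2 * i + 1) = true ↔ ∃ (f : Φ) (l : List ℕ), i = Nat.pair (encode f) (encode l) ∧
      l.length = ar f ∧ ∀ j ∈ l, termCheck ar j = true := by
  rw [termCheck, courseRec_eq, termCheckStep]
  have h1 : (2 * i + 1) / 2 = i := by omega
  have h2 : (2 * i + 1) % 2 ≠ 0 := by omega
  simp only [List.length_map, List.length_range, h1, h2, decide_false, cond_false,
    Bool.and_eq_true, decide_eq_true_eq, foldr_and_eq_true, Option.map_eq_some_iff]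
  have hlt : ∀ j ∈ Denumerable.ofNat (List ℕ) i.unpair.2, j < 2 * i + 1 := fun j hj => by
    have := mem_lt_encode hj
    rw [Denumerable.encode_ofNat] at this
    have := Nat.unpair_right_le i
    omega
  constructor
  · rintro ⟨⟨f, h3, h4⟩, h5⟩
    refine ⟨f, Denumerable.ofNat (List ℕ) i.unpair.2, ?_, h4.symm, fun j hj => ?_⟩
    · rw [Encodable.decode₂_eq_some.1 h3]
      simp
    · rw [← h5 j hj, range_map_getD _ _ (hlt j hj)]
  · rintro ⟨f, l, rfl, h4, h5⟩
    refine ⟨⟨f, by simp, by simpa using h4.symm⟩, fun j hj => ?_⟩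
    rw [range_map_getD _ _ (hlt j hj)]
    exact h5 j (by simpa using hj)

theorem computable_foldr_and {α : Type} [Primcodable α] {l : α → List ℕ} {p : α → List Bool}
    (hl : Primrec l) (hp : Primrec p) :
    Primrec fun a => (l a).foldr (fun i b => (p a).getD i false && b) true := by
  refine Primrec.list_foldr hl (Primrec.const true) (h := fun a x => (p a).getD x.1 false && x.2) ?_
  exact (Primrec.and.comp ((Primrec.list_getD false).comp (hp.comp Primrec.fst)
    (Primrec.fst.comp Primrec.snd)) (Primrec.snd.comp Primrec.snd)).to₂

theorem computable_termCheck {ar : Φ → ℕ} (har : Computable ar) : Computable (termCheck ar) := by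
  suffices h : Computable₂ fun (_ : Unit) => termCheck ar from
    h.comp (Computable.const ()) Computable.id
  refine computable_courseRec (step := fun _ => termCheckStep ar) ?_
  have hl : Primrec fun p : Unit × List Bool => p.2.length := Primrec.list_length.comp Primrec.snd
  have hmod : ∀ k : ℕ, Primrec fun p : Unit × List Bool => decide (p.2.length % k = 0) := fun k =>
    Primrec.eq.decide.comp (Primrec.nat_mod.comp hl (Primrec.const k)) (Primrec.const 0)
  have hu : Primrec fun p : Unit × List Bool => (p.2.length / 2).unpair :=
    Primrec.unpair.comp (Primrec.nat_div.comp hl (Primrec.const 2))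
  have hL : Primrec fun p : Unit × List Bool =>
      Denumerable.ofNat (List ℕ) (p.2.length / 2).unpair.2 :=
    (Primrec.ofNat (List ℕ)).comp (Primrec.snd.comp hu)
  refine Computable.cond (hmod 2).to_comp (hmod 4).to_comp
    (Primrec.and.to_comp.comp (Primrec.eq.decide.to_comp.comp (Computable.option_map
      (Primrec.decode₂.to_comp.comp (Primrec.fst.comp hu).to_comp) (har.comp Computable.snd).to₂)
      (Primrec.option_some.comp (Primrec.list_length.comp hL)).to_comp)
      (computable_foldr_and hL Primrec.snd).to_comp)

variable {Ψ : Type} [Primcodable Ψ]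

/-- One step in the evaluation of a formula, given the truth values of the formulas with
smaller code, and the values `t` of terms. -/
def formulaStep (t : ℕ → ℕ) (P : Ψ × List ℕ → Bool) (prev : List Bool) : Bool :=
  bif decide (prev.length % 4 = 1) then
    decide (t (prev.length / 4).unpair.1 = t (prev.length / 4).unpair.2) else
  bif decide (prev.length % 4 = 2) then
    ((decode₂ Ψ (prev.length / 4).unpair.1).map fun R =>
      P (R, (Denumerable.ofNat (List ℕ) (prev.length / 4).unpair.2).map t)).getD false else
  bif decide (prev.length % 4 = 3) then
    !(prev.getD (prev.length / 4).unpair.1 false) || prev.getD (prev.length / 4).unpair.2 false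
  else false

/-- Evaluation of quantifier-free formulas on the level of codes. -/
def formulaEval (t : ℕ → ℕ) (P : Ψ × List ℕ → Bool) : ℕ → Bool := courseRec (formulaStep t P)

theorem formulaEval_zero (t : ℕ → ℕ) (P : Ψ × List ℕ → Bool) : formulaEval t P 0 = false := by
  rw [formulaEval, courseRec_eq, formulaStep]
  simp

theorem formulaEval_equal (t : ℕ → ℕ) (P : Ψ × List ℕ → Bool) (i j : ℕ) :
    formulaEval t P (4 * Nat.pair i j + 1) = decide (t i = t j) := by
  rw [formulaEval, courseRec_eq, formulaStep]
  have h1 : (4 * Nat.pair i j + 1) / 4 = Nat.pair i j := by omega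
  have h2 : (4 * Nat.pair i j + 1) % 4 = 1 := by omega
  simp [h1, h2]

theorem formulaEval_rel (t : ℕ → ℕ) (P : Ψ × List ℕ → Bool) (R : Ψ) (l : List ℕ) :
    formulaEval t P (4 * Nat.pair (encode R) (encode l) + 2) = P (R, l.map t) := by
  rw [formulaEval, courseRec_eq, formulaStep]
  have h1 : (4 * Nat.pair (encode R) (encode l) + 2) / 4 = Nat.pair (encode R) (encode l) := by
    omega
  have h2 : (4 * Nat.pair (encode R) (encode l) + 2) % 4 = 2 := by omega
  simp [h1, h2]

theorem formulaEval_imp (t : ℕ → ℕ) (P : Ψ × List ℕ → Bool) (i j : ℕ) :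
    formulaEval t P (4 * Nat.pair i j + 3) = (!(formulaEval t P i) || formulaEval t P j) := by
  rw [formulaEval, courseRec_eq, formulaStep]
  have h1 : (4 * Nat.pair i j + 3) / 4 = Nat.pair i j := by omega
  have h2 : (4 * Nat.pair i j + 3) % 4 = 3 := by omega
  have h3 : i < 4 * Nat.pair i j + 3 := by have := Nat.left_le_pair i j; omega
  have h4 : j < 4 * Nat.pair i j + 3 := by have := Nat.right_le_pair i j; omega
  simp only [List.length_map, List.length_range, h1, h2, Nat.unpair_pair,
    range_map_getD _ _ h3, range_map_getD _ _ h4]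
  simp

theorem computable_formulaEval {α : Type} [Primcodable α] {t : α → ℕ → ℕ} (ht : Computable₂ t)
    {P : Ψ × List ℕ → Bool} (hP : Computable P) :
    Computable₂ fun x => formulaEval (t x) P := by
  refine computable_courseRec (step := fun x => formulaStep (t x) P) ?_
  have hl : Primrec fun p : α × List Bool => p.2.length := Primrec.list_length.comp Primrec.snd
  have hmod : ∀ k : ℕ, Computable fun p : α × List Bool => decide (p.2.length % 4 = k) := fun k =>
    (Primrec.eq.decide.comp (Primrec.nat_mod.comp hl (Primrec.const 4)) (Primrec.const k)).to_comp
  have hu : Primrec fun p : α × List Bool => (p.2.length / 4).unpair :=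
    Primrec.unpair.comp (Primrec.nat_div.comp hl (Primrec.const 4))
  have hu1 := (Primrec.fst.comp hu).to_comp
  have hu2 := (Primrec.snd.comp hu).to_comp
  have hm : Computable fun p : α × List Bool =>
      (Denumerable.ofNat (List ℕ) (p.2.length / 4).unpair.2).map (t p.1) :=
    computable_list_map (ht.comp (Computable.fst.comp Computable.fst) Computable.snd).to₂
      ((Primrec.ofNat (List ℕ)).to_comp.comp hu2)
  have hs : Computable₂ fun (p : α × List Bool) (R : Ψ) =>
      P (R, (Denumerable.ofNat (List ℕ) (p.2.length / 4).unpair.2).map (t p.1)) :=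
    hP.comp (Computable.snd.pair (hm.comp Computable.fst))
  have h1 : Computable fun p : α × List Bool =>
      decide (t p.1 (p.2.length / 4).unpair.1 = t p.1 (p.2.length / 4).unpair.2) :=
    Primrec.eq.decide.to_comp.comp (ht.comp Computable.fst hu1) (ht.comp Computable.fst hu2)
  have h2 : Computable fun p : α × List Bool => ((decode₂ Ψ (p.2.length / 4).unpair.1).map fun R =>
      P (R, (Denumerable.ofNat (List ℕ) (p.2.length / 4).unpair.2).map (t p.1))).getD false :=
    Computable.option_getD (Computable.option_map (Primrec.decode₂.to_comp.comp hu1) hs)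
      (Computable.const false)
  have h3 : Computable fun p : α × List Bool => !(p.2.getD (p.2.length / 4).unpair.1 false) ||
      p.2.getD (p.2.length / 4).unpair.2 false :=
    Primrec.or.to_comp.comp (Primrec.not.to_comp.comp ((Primrec.list_getD false).to_comp.comp
      Computable.snd hu1)) ((Primrec.list_getD false).to_comp.comp Computable.snd hu2)
  exact Computable.cond (hmod 1) h1 (Computable.cond (hmod 2) h2 (Computable.cond (hmod 3) h3
    (Computable.const false)))

/-- One step in the recognition of the codes of quantifier-free formulas. -/
def formulaCheckStep (t : ℕ → Bool) (ar : Ψ → ℕ) (prev : List Bool) : Bool :=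
  -- `0` is the code of `⊥`; the other multiples of `4` belong to universal quantifications and fall
  -- through to `false`.
  bif decide (prev.length = 0) then true else
  bif decide (prev.length % 4 = 1) then
    t (prev.length / 4).unpair.1 && t (prev.length / 4).unpair.2 else
  bif decide (prev.length % 4 = 2) then
    decide ((decode₂ Ψ (prev.length / 4).unpair.1).map ar =
      some (Denumerable.ofNat (List ℕ) (prev.length / 4).unpair.2).length) &&
    ((Denumerable.ofNat (List ℕ) (prev.length / 4).unpair.2).map t).foldr (fun i b => i && b) true
    else
  bif decide (prev.length % 4 = 3) then
    prev.getD (prev.length / 4).unpair.1 false && prev.getD (prev.length / 4).unpair.2 false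
  else false

/-- Recognition of the codes of quantifier-free formulas. -/
def formulaCheck (t : ℕ → Bool) (ar : Ψ → ℕ) : ℕ → Bool := courseRec (formulaCheckStep t ar)

theorem formulaCheck_zero (t : ℕ → Bool) (ar : Ψ → ℕ) : formulaCheck t ar 0 = true := by
  rw [formulaCheck, courseRec_eq, formulaCheckStep]
  simp

theorem formulaCheck_equal (t : ℕ → Bool) (ar : Ψ → ℕ) (i j : ℕ) :
    formulaCheck t ar (4 * Nat.pair i j + 1) = true ↔ t i = true ∧ t j = true := by
  rw [formulaCheck, courseRec_eq, formulaCheckStep]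
  have h1 : (4 * Nat.pair i j + 1) / 4 = Nat.pair i j := by omega
  have h2 : (4 * Nat.pair i j + 1) % 4 = 1 := by omega
  simp [h1, h2]

theorem foldr_map_and_eq_true {l : List ℕ} {p : ℕ → Bool} :
    (l.map p).foldr (fun i b => i && b) true = true ↔ ∀ i ∈ l, p i = true := by
  induction l <;> simp_all

theorem formulaCheck_rel (t : ℕ → Bool) (ar : Ψ → ℕ) (i : ℕ) :
    formulaCheck t ar (4 * i + 2) = true ↔
      ∃ (R : Ψ) (l : List ℕ), i = Nat.pair (encode R) (encode l) ∧
      l.length = ar R ∧ ∀ j ∈ l, t j = true := by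
  rw [formulaCheck, courseRec_eq, formulaCheckStep]
  have h1 : (4 * i + 2) / 4 = i := by omega
  have h2 : (4 * i + 2) % 4 = 2 := by omega
  simp only [List.length_map, List.length_range, h1, h2, foldr_map_and_eq_true, decide_true,
    cond_true, Nat.reduceEqDiff, decide_false, cond_false, Bool.and_eq_true, decide_eq_true_eq,
    Option.map_eq_some_iff, show ¬ (4 * i + 2 = 0) by omega]
  constructor
  · rintro ⟨⟨f, h3, h4⟩, h5⟩
    refine ⟨f, Denumerable.ofNat (List ℕ) i.unpair.2, ?_, h4.symm, h5⟩
    rw [Encodable.decode₂_eq_some.1 h3]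
    simp
  · rintro ⟨f, l, rfl, h4, h5⟩
    exact ⟨⟨f, by simp, by simpa using h4.symm⟩, by simpa using h5⟩

theorem formulaCheck_imp (t : ℕ → Bool) (ar : Ψ → ℕ) (i j : ℕ) :
    formulaCheck t ar (4 * Nat.pair i j + 3) = true ↔
      formulaCheck t ar i = true ∧ formulaCheck t ar j = true := by
  rw [formulaCheck, courseRec_eq, formulaCheckStep]
  have h1 : (4 * Nat.pair i j + 3) / 4 = Nat.pair i j := by omega
  have h2 : (4 * Nat.pair i j + 3) % 4 = 3 := by omega
  have h3 : i < 4 * Nat.pair i j + 3 := by have := Nat.left_le_pair i j; omega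
  have h4 : j < 4 * Nat.pair i j + 3 := by have := Nat.right_le_pair i j; omega
  simp only [List.length_map, List.length_range, h1, h2, Nat.unpair_pair,
    range_map_getD _ _ h3, range_map_getD _ _ h4]
  simp

theorem formulaCheck_all (t : ℕ → Bool) (ar : Ψ → ℕ) (i : ℕ) :
    formulaCheck t ar (4 * i + 4) = false := by
  rw [formulaCheck, courseRec_eq, formulaCheckStep]
  have h2 : (4 * i + 4) % 4 = 0 := by omega
  simp [h2]

theorem computable_formulaCheck {t : ℕ → Bool} (ht : Computable t) {ar : Ψ → ℕ}
    (har : Computable ar) : Computable (formulaCheck t ar) := by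
  suffices h : Computable₂ fun (_ : Unit) => formulaCheck t ar from
    h.comp (Computable.const ()) Computable.id
  refine computable_courseRec (step := fun _ => formulaCheckStep t ar) ?_
  have hl : Primrec fun p : Unit × List Bool => p.2.length := Primrec.list_length.comp Primrec.snd
  have hmod : ∀ k : ℕ, Computable fun p : Unit × List Bool => decide (p.2.length % 4 = k) :=
    fun k => (Primrec.eq.decide.comp (Primrec.nat_mod.comp hl (Primrec.const 4))
      (Primrec.const k)).to_comp
  have h0 : Computable fun p : Unit × List Bool => decide (p.2.length = 0) :=
    (Primrec.eq.decide.comp hl (Primrec.const 0)).to_comp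
  have hu : Primrec fun p : Unit × List Bool => (p.2.length / 4).unpair :=
    Primrec.unpair.comp (Primrec.nat_div.comp hl (Primrec.const 4))
  have hu1 := (Primrec.fst.comp hu).to_comp
  have hu2 := (Primrec.snd.comp hu).to_comp
  have hL : Primrec fun p : Unit × List Bool =>
      Denumerable.ofNat (List ℕ) (p.2.length / 4).unpair.2 :=
    (Primrec.ofNat (List ℕ)).comp (Primrec.snd.comp hu)
  refine Computable.cond h0 (Computable.const true) (Computable.cond (hmod 1)
    (Primrec.and.to_comp.comp (ht.comp hu1) (ht.comp hu2)) (Computable.cond (hmod 2)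
    (Primrec.and.to_comp.comp (Primrec.eq.decide.to_comp.comp (Computable.option_map
      (Primrec.decode₂.to_comp.comp hu1) (har.comp Computable.snd).to₂)
      (Primrec.option_some.comp (Primrec.list_length.comp hL)).to_comp) ?_)
    (Computable.cond (hmod 3) (Primrec.and.to_comp.comp ((Primrec.list_getD false).to_comp.comp
      Computable.snd hu1) ((Primrec.list_getD false).to_comp.comp Computable.snd hu2))
    (Computable.const false))))
  have hfold : Primrec fun l : List Bool => l.foldr (fun i b => i && b) true :=
    Primrec.list_foldr (h := fun _ x => x.1 && x.2) Primrec.id (Primrec.const true)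
      (Primrec.and.comp (Primrec.fst.comp Primrec.snd) (Primrec.snd.comp Primrec.snd)).to₂
  exact hfold.to_comp.comp (computable_list_map (ht.comp Computable.snd).to₂ hL.to_comp)

end Eval

section Semantics

variable [Primcodable (Σ k, L.Functions k)]

theorem termCheck_termCode (t : L.Term (ℕ ⊕ Fin 0)) :
    termCheck (fun f : Σ k, L.Functions k => f.1) (termCode t) = true := by
  induction t with
  | var i =>
    rcases i with i | i
    · exact (termCheck_even _ _).2 ⟨i, by simp⟩
    · exact i.elim0
  | @func l f ts ih =>
    rw [termCode]
    exact (termCheck_odd _ _).2 ⟨⟨l, f⟩, _, rfl, by simp, by simpa using ih⟩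

theorem exists_termCode {c : ℕ} (hc : termCheck (fun f : Σ k, L.Functions k => f.1) c = true) :
    ∃ t : L.Term (ℕ ⊕ Fin 0), termCode t = c := by
  induction c using Nat.strong_induction_on with
  | _ c ih =>
    obtain ⟨i, rfl | rfl⟩ := Nat.even_or_odd' c
    · obtain ⟨j, rfl⟩ := (termCheck_even _ _).1 hc
      exact ⟨.var (.inl j), by simp [termCode]⟩
    · obtain ⟨⟨k, f⟩, l, rfl, h1, h2⟩ := (termCheck_odd _ _).1 hc
      have : ∀ j ∈ l, ∃ t : L.Term (ℕ ⊕ Fin 0), termCode t = j := fun j hj => by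
        refine ih j ?_ (h2 j hj)
        have := mem_lt_encode hj
        have := Nat.right_le_pair (encode (⟨k, f⟩ : Σ k, L.Functions k)) (encode l)
        omega
      simp only at h1
      subst h1
      choose u hu using fun i : Fin l.length => this l[i] (List.getElem_mem _)
      refine ⟨.func f u, ?_⟩
      simp [termCode, hu]

theorem var_lt_termCode (t : L.Term (ℕ ⊕ Fin 0)) : ∀ i ∈ t.varFinsetLeft, i ≤ termCode t := by
  induction t with
  | var i =>
    rcases i with i | i
    · simp only [Term.varFinsetLeft, Finset.mem_singleton, termCode, encode_inl, encode_nat]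
      rintro _ rfl
      omega
    · exact i.elim0
  | @func l f ts ih =>
    intro i hi
    simp only [Term.varFinsetLeft, Finset.mem_biUnion, Finset.mem_univ, true_and] at hi
    obtain ⟨j, hj⟩ := hi
    have h1 := ih j i hj
    have h2 : termCode (ts j) < encode (List.ofFn fun i => termCode (ts i)) :=
      mem_lt_encode ((List.mem_ofFn).2 ⟨j, rfl⟩)
    have h3 := Nat.right_le_pair (encode (⟨l, f⟩ : Σ k, L.Functions k))
      (encode (List.ofFn fun i => termCode (ts i)))
    rw [termCode]
    omega

theorem termEval_termCode {D : Set ℕ} [L.Structure D]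
    {F : (Σ k, L.Functions k) × List ℕ → ℕ} (hF : ∀ (k : ℕ) (f : L.Functions k) (v : Fin k → D),
      F (⟨k, f⟩, List.ofFn fun i => (v i : ℕ)) = (Structure.funMap f v : D))
    (a : ℕ → D) (x : Fin 0 → D) (t : L.Term (ℕ ⊕ Fin 0)) :
    termEval (fun i => (a i : ℕ)) F (termCode t) = (t.realize (Sum.elim a x) : D) := by
  induction t with
  | var i =>
    rcases i with i | i
    · rw [termCode, encode_inl, encode_nat, termEval_var]
      rfl
    · exact i.elim0
  | @func l f ts ih =>
    rw [termCode, termEval_func, List.map_ofFn, Term.realize, ← hF]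
    congr 3
    funext i
    exact ih i

variable [Primcodable (Σ k, L.Relations k)]

theorem formulaCheck_formulaCode {m : ℕ} (θ : L.BoundedFormula ℕ m) (hm : m = 0) (hθ : θ.IsQF) :
    formulaCheck (termCheck fun f : Σ k, L.Functions k => f.1)
      (fun R : Σ k, L.Relations k => R.1) (formulaCode θ) = true := by
  subst hm
  induction hθ with
  | falsum => exact formulaCheck_zero _ _
  | of_isAtomic h =>
    cases h with
    | equal t₁ t₂ =>
      exact (formulaCheck_equal _ _ _ _).2 ⟨termCheck_termCode t₁, termCheck_termCode t₂⟩
    | rel R ts =>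
      exact (formulaCheck_rel _ _ _).2 ⟨⟨_, R⟩, _, rfl, by simp,
        by simpa using fun i => termCheck_termCode (ts i)⟩
  | imp _ _ ih₁ ih₂ => exact (formulaCheck_imp _ _ _ _).2 ⟨ih₁, ih₂⟩

theorem exists_formulaCode {c : ℕ} (hc : formulaCheck (termCheck fun f : Σ k, L.Functions k => f.1)
      (fun R : Σ k, L.Relations k => R.1) c = true) :
    ∃ θ : L.Formula ℕ, θ.IsQF ∧ formulaCode θ = c := by
  induction c using Nat.strong_induction_on with
  | _ c ih =>
    obtain rfl | ⟨i, j, rfl | rfl | rfl | rfl⟩ : c = 0 ∨ ∃ i j, c = 4 * Nat.pair i j + 1 ∨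
        c = 4 * Nat.pair i j + 2 ∨ c = 4 * Nat.pair i j + 3 ∨ c = 4 * Nat.pair i j + 4 := by
      by_cases h : c = 0
      · exact .inl h
      · refine .inr ⟨((c - 1) / 4).unpair.1, ((c - 1) / 4).unpair.2, ?_⟩
        rw [Nat.pair_unpair]
        omega
    · exact ⟨⊥, BoundedFormula.isQF_bot, rfl⟩
    · obtain ⟨h1, h2⟩ := (formulaCheck_equal _ _ _ _).1 hc
      obtain ⟨t₁, rfl⟩ := exists_termCode h1
      obtain ⟨t₂, rfl⟩ := exists_termCode h2
      exact ⟨BoundedFormula.equal t₁ t₂, .of_isAtomic (.equal t₁ t₂), rfl⟩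
    · obtain ⟨⟨k, R⟩, l, h0, h1, h2⟩ := (formulaCheck_rel _ _ _).1 hc
      rw [h0]
      simp only at h1
      subst h1
      choose u hu using fun i : Fin l.length => exists_termCode (h2 l[i] (List.getElem_mem _))
      refine ⟨BoundedFormula.rel R u, .of_isAtomic (.rel R u), ?_⟩
      simp [formulaCode, hu]
    · obtain ⟨h1, h2⟩ := (formulaCheck_imp _ _ _ _).1 hc
      obtain ⟨φ, hφ, rfl⟩ := ih i (by have := Nat.left_le_pair i j; omega) h1
      obtain ⟨ψ, hψ, rfl⟩ := ih j (by have := Nat.right_le_pair (formulaCode φ) j; omega) h2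
      exact ⟨BoundedFormula.imp φ ψ, hφ.imp hψ, rfl⟩
    · rw [formulaCheck_all] at hc
      cases hc

/-- The Gödel number itself is a computable bound for the free variables; hence the value `c + 1` of
`familyBound 0 c`. -/
theorem freeVar_le_formulaCode {m : ℕ} (θ : L.BoundedFormula ℕ m) (hm : m = 0) (hθ : θ.IsQF) :
    ∀ i ∈ θ.freeVarFinset, i ≤ formulaCode θ := by
  subst hm
  induction hθ with
  | falsum => simp [BoundedFormula.freeVarFinset]
  | of_isAtomic h =>
    intro i hi
    cases h with
    | equal t₁ t₂ =>
      have h3 := Nat.left_le_pair (termCode t₁) (termCode t₂)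
      have h4 := Nat.right_le_pair (termCode t₁) (termCode t₂)
      simp only [Term.bdEqual, BoundedFormula.freeVarFinset, Finset.mem_union] at hi
      simp only [Term.bdEqual, formulaCode]
      rcases hi with hi | hi
      · have := var_lt_termCode _ _ hi
        omega
      · have := var_lt_termCode _ _ hi
        omega
    | @rel l R ts =>
      simp only [Relations.boundedFormula, BoundedFormula.freeVarFinset, Finset.mem_biUnion,
        Finset.mem_univ, true_and] at hi
      obtain ⟨j, hj⟩ := hi
      have h1 := var_lt_termCode _ _ hj
      have h2 : termCode (ts j) < encode (List.ofFn fun i => termCode (ts i)) :=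
        mem_lt_encode ((List.mem_ofFn).2 ⟨j, rfl⟩)
      have h3 := Nat.right_le_pair (encode (⟨l, R⟩ : Σ k, L.Relations k))
        (encode (List.ofFn fun i => termCode (ts i)))
      simp only [Relations.boundedFormula, formulaCode]
      omega
  | @imp φ ψ _ _ ih₁ ih₂ =>
    intro i hi
    have h3 := Nat.left_le_pair (formulaCode φ) (formulaCode ψ)
    have h4 := Nat.right_le_pair (formulaCode φ) (formulaCode ψ)
    simp only [BoundedFormula.freeVarFinset, Finset.mem_union] at hi
    simp only [formulaCode]
    rcases hi with hi | hi
    · have := ih₁ _ hi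
      omega
    · have := ih₂ _ hi
      omega

theorem formulaEval_formulaCode {D : Set ℕ} [L.Structure D]
    {F : (Σ k, L.Functions k) × List ℕ → ℕ} (hF : ∀ (k : ℕ) (f : L.Functions k) (v : Fin k → D),
      F (⟨k, f⟩, List.ofFn fun i => (v i : ℕ)) = (Structure.funMap f v : D))
    {P : (Σ k, L.Relations k) × List ℕ → Bool}
    (hP : ∀ (k : ℕ) (R : L.Relations k) (v : Fin k → D),
      P (⟨k, R⟩, List.ofFn fun i => (v i : ℕ)) = true ↔ Structure.RelMap R v)
    (a : ℕ → D) {m : ℕ} (θ : L.BoundedFormula ℕ m) (hm : m = 0) (x : Fin m → D) (hθ : θ.IsQF) :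
    formulaEval (termEval (fun i => (a i : ℕ)) F) P (formulaCode θ) = true ↔ θ.Realize a x := by
  subst hm
  induction hθ with
  | falsum => simp [formulaCode, formulaEval_zero, BoundedFormula.Realize]
  | of_isAtomic h =>
    cases h with
    | equal t₁ t₂ =>
      simp only [Term.bdEqual, formulaCode, formulaEval_equal, termEval_termCode hF a x,
        decide_eq_true_eq, BoundedFormula.Realize]
      exact Subtype.ext_iff.symm
    | @rel l R ts =>
      simp only [Relations.boundedFormula, formulaCode, formulaEval_rel, BoundedFormula.Realize,
        ← hP, List.map_ofFn]
      have : (termEval (fun i => (a i : ℕ)) F ∘ fun i => termCode (ts i)) =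
        fun i => (((ts i).realize (Sum.elim a x) : D) : ℕ) :=
        funext fun i => termEval_termCode hF a x (ts i)
      rw [this]
  | imp _ _ ih₁ ih₂ =>
    simp only [formulaCode, formulaEval_imp, BoundedFormula.Realize, ← ih₁, ← ih₂]
    simp [imp_iff_not_or]

end Semantics

-- Formulas equivalent to `Π_k` formulas, and extension of assignments

namespace InfFormula

theorem exists_refines_succ (k : ℕ) (φ : InfFormula L) :
    (φ.IsSigma k → ∃ τ : InfFormula L, τ.IsSigma (k + 1) ∧ τ.Refines φ) ∧
    (φ.IsPi k → ∃ τ : InfFormula L, τ.IsPi (k + 1) ∧ τ.Refines φ) := by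
  induction k generalizing φ with
  | zero =>
    constructor
    · intro h
      refine ⟨iSup {0} fun _ => φ.exs [], ⟨_, fun _ => [], fun _ => φ, rfl, fun _ => h⟩, ?_,
        fun M _ _ v => ?_⟩ <;> simp [freeVars, exs]
    · intro h
      refine ⟨iInf {0} fun _ => φ.alls [], ⟨_, fun _ => [], fun _ => φ, rfl, fun _ => h⟩, ?_,
        fun M _ _ v => ?_⟩ <;> simp [freeVars, alls]
  | succ k ih =>
    constructor
    · rintro ⟨I, xs, ψ, rfl, h⟩
      choose τ h1 h2 using fun i => (ih (ψ i)).2 (h i)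
      refine ⟨iSup I fun i => (τ i).exs (xs i), ⟨_, _, _, rfl, h1⟩, ?_, fun M _ _ v => ?_⟩
      · exact Set.iUnion_mono fun i => ((h2 i).exs _).1
      · exact exists_congr fun i => ((h2 i).exs _).2 M v
    · rintro ⟨I, xs, ψ, rfl, h⟩
      choose τ h1 h2 using fun i => (ih (ψ i)).1 (h i)
      refine ⟨iInf I fun i => (τ i).alls (xs i), ⟨_, _, _, rfl, h1⟩, ?_, fun M _ _ v => ?_⟩
      · exact Set.iUnion_mono fun i => ((h2 i).alls _).1
      · exact forall_congr' fun i => ((h2 i).alls _).2 M v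

/-- `χ` has finitely many free variables, and is equivalent to a `Π_k` formula. -/
def PiLike (k : ℕ) (χ : InfFormula L) : Prop :=
  χ.freeVars.Finite ∧ ∃ τ : InfFormula L, τ.IsPi k ∧ τ.Refines χ

theorem PiLike.mono {k l : ℕ} {χ : InfFormula L} (h : PiLike k χ) (hkl : k ≤ l) :
    PiLike l χ := by
  induction hkl with
  | refl => exact h
  | @step l _ ih =>
    obtain ⟨hf, τ, h1, h2⟩ := ih
    obtain ⟨τ', h3, h4⟩ := (exists_refines_succ l τ).2 h1
    exact ⟨hf, τ', h3, h4.trans h2⟩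

theorem piLike_qf (k : ℕ) (θ : L.Formula ℕ) (hθ : θ.IsQF) : PiLike k (qf θ hθ) :=
  PiLike.mono (k := 0) ⟨Finset.finite_toSet _, _, ⟨θ, hθ, rfl⟩, Refines.refl _⟩ (Nat.zero_le k)

/-- `φ` can be satisfied by changing the values of the variables `x_l, x_{l+1}, …`. -/
def ExtRealize {M : Type} [L.Structure M] (l : ℕ) (φ : InfFormula L) (v : ℕ → M) : Prop :=
  ∃ w : ℕ → M, (∀ i < l, w i = v i) ∧ φ.Realize w

theorem ExtRealize.congr {M : Type} [L.Structure M] {l : ℕ} {φ : InfFormula L} {v v' : ℕ → M}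
    (h : ∀ i < l, v i = v' i) (hv : φ.ExtRealize l v) : φ.ExtRealize l v' := by
  obtain ⟨w, h1, h2⟩ := hv
  exact ⟨w, fun i hi => (h1 i hi).trans (h i hi), h2⟩

theorem ExtRealize.of_realize {M : Type} [L.Structure M] {l : ℕ} {φ : InfFormula L} {v : ℕ → M}
    (h : φ.Realize v) : φ.ExtRealize l v := ⟨v, fun _ _ => rfl, h⟩

theorem ExtRealize.mono {M : Type} [L.Structure M] {l l' : ℕ} {φ : InfFormula L} {v : ℕ → M}
    (h : φ.ExtRealize l v) (hl : l' ≤ l) : φ.ExtRealize l' v := by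
  obtain ⟨w, h1, h2⟩ := h
  exact ⟨w, fun i hi => h1 i (hi.trans_le hl), h2⟩

end InfFormula

/-- The variables `x_a, …, x_{b-1}`. -/
def varsFrom (a b : ℕ) : List ℕ := (List.range b).drop a

theorem mem_varsFrom {a b i : ℕ} : i ∈ varsFrom a b ↔ a ≤ i ∧ i < b := by
  simp only [varsFrom, List.mem_iff_getElem, List.length_drop, List.length_range,
    List.getElem_drop, List.getElem_range]
  constructor
  · rintro ⟨j, hj, rfl⟩
    omega
  · rintro ⟨h1, h2⟩
    exact ⟨i - a, by omega, by omega⟩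

theorem computable_varsFrom : Computable₂ varsFrom :=
  (Primrec.list_drop.comp Primrec.fst (Primrec.list_range.comp Primrec.snd)).to_comp.to₂

/-- A quantifier over a finite tuple changes finitely many variables, `ExtRealize` all of them from
`a` on. The difference lies at `b` and beyond, where `φ` has no variables. -/
theorem exists_agree_off_varsFrom {M : Type} [L.Structure M] {a b : ℕ} {φ : InfFormula L}
    (hφ : φ.freeVars ⊆ Set.Iio b) (v : ℕ → M) :
    (∃ w : ℕ → M, (∀ i ∉ varsFrom a b, w i = v i) ∧ φ.Realize w) ↔ φ.ExtRealize a v := by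
  constructor
  · rintro ⟨w, h1, h2⟩
    exact ⟨w, fun i hi => h1 i (by rw [mem_varsFrom]; omega), h2⟩
  · rintro ⟨w, h1, h2⟩
    refine ⟨fun i => if i < b then w i else v i, fun i hi => ?_, ?_⟩
    · rw [mem_varsFrom] at hi
      by_cases hb : i < b
      · simp only [hb, if_true]
        exact h1 i (by omega)
      · simp [hb]
    · refine (φ.realize_congr fun i hi => ?_).1 h2
      simp [Set.mem_Iio.1 (hφ hi)]

-- Generators of the `Π_k` types realized in a structure

section Families

variable [Primcodable (Σ k, L.Functions k)] [Primcodable (Σ k, L.Relations k)]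

open Classical in
/-- The quantifier-free formula with Gödel number `c`. -/
noncomputable def qfFamily (L : FirstOrder.Language.{0, 0}) [Primcodable (Σ k, L.Functions k)]
    [Primcodable (Σ k, L.Relations k)] (c : ℕ) : InfFormula L :=
  if h : ∃ θ : L.Formula ℕ, θ.IsQF ∧ formulaCode θ = c then qf h.choose h.choose_spec.1
  else qf ⊥ BoundedFormula.isQF_bot

theorem qfFamily_formulaCode (θ : L.Formula ℕ) (hθ : θ.IsQF) :
    qfFamily L (formulaCode θ) = qf θ hθ := by
  have h : ∃ θ' : L.Formula ℕ, θ'.IsQF ∧ formulaCode θ' = formulaCode θ := ⟨θ, hθ, rfl⟩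
  rw [qfFamily, dif_pos h]
  congr 1
  exact formulaCode_injective h.choose_spec.2

theorem qfFamily_of_not {c : ℕ} (h : ¬ ∃ θ : L.Formula ℕ, θ.IsQF ∧ formulaCode θ = c) :
    qfFamily L c = qf ⊥ BoundedFormula.isQF_bot := by
  rw [qfFamily, dif_neg h]

theorem isPi_qfFamily (c : ℕ) : (qfFamily L c).IsPi 0 := by
  rw [qfFamily]
  split_ifs
  exacts [⟨_, _, rfl⟩, ⟨_, _, rfl⟩]

theorem freeVars_qfFamily (c : ℕ) : (qfFamily L c).freeVars ⊆ Set.Iio (c + 1) := by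
  by_cases h : ∃ θ : L.Formula ℕ, θ.IsQF ∧ formulaCode θ = c
  · obtain ⟨θ, hθ, rfl⟩ := h
    rw [qfFamily_formulaCode θ hθ]
    intro i hi
    exact Nat.lt_succ_of_le (freeVar_le_formulaCode θ rfl hθ i hi)
  · rw [qfFamily_of_not h]
    intro i hi
    cases hi

variable {M : Type}

/-- The length of the finite sequence coded by `s`. -/
def codeLength (s : ℕ) : ℕ := (Denumerable.ofNat (List ℕ) s).length

/-- The assignment of elements of the range of `e` coded by `s`. -/
def assignment (e : ℕ → M) (s i : ℕ) : M := e ((Denumerable.ofNat (List ℕ) s).getD i 0)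

theorem exists_assignment {e : ℕ → M} (he : Function.Surjective e) (v : ℕ → M) (N : ℕ) :
    ∃ s, codeLength s = N ∧ ∀ i < N, assignment e s i = v i := by
  choose g hg using he
  refine ⟨encode ((List.range N).map fun i => g (v i)), by simp [codeLength], fun i hi => ?_⟩
  simp only [assignment, Denumerable.ofNat_encode]
  rw [range_map_getD _ _ hi, hg]

/-- Bounds for the free variables of the members of `family`. -/
def familyBound : ℕ → ℕ → ℕ
  | 0, c => c + 1
  | _ + 1, s => codeLength s

variable [L.Structure M]

/-- Families of formulas capturing the `Π_k` types realized in a countable structure: in the given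
structure, the member with index `s` of the `k+1`-st family holds of the tuples satisfying all
`Π_{k+1}` formulas true of the tuple coded by `s`. -/
noncomputable def family (L : FirstOrder.Language.{0, 0}) [Primcodable (Σ k, L.Functions k)]
    [Primcodable (Σ k, L.Relations k)] [L.Structure M] (e : ℕ → M) : ℕ → ℕ → InfFormula L
  | 0, c => qfFamily L c
  | k + 1, s => guardedInf
      (fun j => ¬ (family L e k j).ExtRealize (codeLength s) (assignment e s))
      (fun j => varsFrom (codeLength s) (familyBound k j)) fun j => (family L e k j).neg

theorem freeVars_family (e : ℕ → M) (k j : ℕ) :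
    (family L e k j).freeVars ⊆ Set.Iio (familyBound k j) := by
  induction k generalizing j with
  | zero => exact freeVars_qfFamily j
  | succ k ih =>
    rw [family, freeVars_guardedInf]
    refine Set.iUnion_subset fun i => ?_
    rintro x ⟨h1, h2⟩
    rw [freeVars_neg] at h1
    have := ih i h1
    simp only [Set.mem_ofPred_eq, mem_varsFrom, Set.mem_Iio] at h2 this ⊢
    simp only [familyBound]
    omega

theorem piLike_family (e : ℕ → M) (k j : ℕ) : PiLike k (family L e k j) := by
  refine ⟨(Set.finite_Iio _).subset (freeVars_family e k j), ?_⟩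
  induction k generalizing j with
  | zero => exact ⟨_, isPi_qfFamily j, Refines.refl _⟩
  | succ k ih =>
    rw [family]
    refine exists_isPi_refines_guardedInf _ _ _ fun i => ?_
    obtain ⟨τ, h1, h2⟩ := ih i
    exact ⟨τ.neg, h1.neg, h2.neg⟩

/-- The contrapositive reading of the conjunction: existential facts of level `k` about `v`,
evaluated in `N`, must already hold of the tuple `s`, evaluated in `M`. -/
theorem realize_family_succ {N : Type} [L.Structure N] (e : ℕ → M) (k s : ℕ) (v : ℕ → N) :
    (family L e (k + 1) s).Realize v ↔ ∀ j, (family L e k j).ExtRealize (codeLength s) v →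
      (family L e k j).ExtRealize (codeLength s) (assignment e s) := by
  rw [family, realize_guardedInf]
  refine forall_congr' fun j => ?_
  rw [← exists_agree_off_varsFrom (freeVars_family e k j) v]
  simp only [realize_neg]
  constructor
  · rintro h ⟨w, h1, h2⟩
    by_contra h3
    exact h h3 w h1 h2
  · exact fun h h3 w h1 h2 => h3 (h ⟨w, h1, h2⟩)

/-- `family L e k` generates the `Π_k` types realized in the structure. -/
def Generates (L : FirstOrder.Language.{0, 0}) [Primcodable (Σ k, L.Functions k)]
    [Primcodable (Σ k, L.Relations k)] [L.Structure M] (e : ℕ → M) (k : ℕ) : Prop :=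
  ∀ (χ₁ χ₂ : InfFormula L), PiLike k χ₁ → PiLike k χ₂ → ∀ (r₁ r₂ : ℕ → ℕ) (v : ℕ → M),
    χ₁.Realize (v ∘ r₁) → χ₂.Realize (v ∘ r₂) → ∃ j, (family L e k j).Realize v ∧
      ∀ u : ℕ → M, (family L e k j).Realize u → χ₁.Realize (u ∘ r₁) ∧ χ₂.Realize (u ∘ r₂)

/-- Quantifier-free formulas are closed under renaming and conjunction, so the conjunction is its
own generator. Two formulas are treated at once because extending a forcing condition must keep the
old formula while adding a new one. -/
theorem generates_zero [Nonempty M] (e : ℕ → M) : Generates L e 0 := by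
  rintro χ₁ χ₂ ⟨-, _, ⟨θ₁, hθ₁, rfl⟩, h₁⟩ ⟨-, _, ⟨θ₂, hθ₂, rfl⟩, h₂⟩ r₁ r₂ v hv₁ hv₂
  have hq : (Formula.relabel r₁ θ₁ ⊓ Formula.relabel r₂ θ₂ : L.Formula ℕ).IsQF :=
    (hθ₁.relabel (Sum.inl ∘ r₁)).inf (hθ₂.relabel (Sum.inl ∘ r₂))
  have key : ∀ u : ℕ → M, (Formula.relabel r₁ θ₁ ⊓ Formula.relabel r₂ θ₂ : L.Formula ℕ).Realize u ↔
      χ₁.Realize (u ∘ r₁) ∧ χ₂.Realize (u ∘ r₂) := by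
    intro u
    rw [Formula.realize_inf, Formula.realize_relabel, Formula.realize_relabel, ← h₁.2, ← h₂.2]
    rfl
  refine ⟨formulaCode (Formula.relabel r₁ θ₁ ⊓ Formula.relabel r₂ θ₂ : L.Formula ℕ), ?_⟩
  simp only [family, qfFamily_formulaCode _ hq, realize_qf, key]
  exact ⟨⟨hv₁, hv₂⟩, fun _ h => h⟩

/-- A counterexample to `χ` at `u` satisfies a negated matrix, which is `Π_k` and so follows from
some level-`k` generator `j`. The existential closure of `j` holds of `u`, hence of the tuple `s`,
where it yields a counterexample to `χ` again. -/
theorem Generates.transfer {e : ℕ → M} {k s : ℕ} (hk : Generates L e k) {χ : InfFormula L}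
    (hχ : χ.IsPi (k + 1)) (hfin : χ.freeVars.Finite) {r : ℕ → ℕ}
    (hr : ∀ x ∈ χ.freeVars, r x < codeLength s) {u : ℕ → M}
    (hs : χ.Realize (assignment e s ∘ r)) (hu : (family L e (k + 1) s).Realize u) :
    χ.Realize (u ∘ r) := by
  obtain ⟨I, xs, ψ, rfl, hψ⟩ := hχ
  set N := codeLength s with hN
  have hfv : ∀ i x, x ∈ (ψ i).freeVars → x ∉ xs i → x ∈ freeVars (iInf I fun i => (ψ i).alls (xs i)) :=
    fun i x h1 h2 => Set.mem_iUnion.2 ⟨i, by rw [freeVars_alls]; exact ⟨h1, h2⟩⟩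
  rw [realize_iInf]
  intro i
  rw [realize_alls]
  intro w hw
  by_contra hcon
  -- One assignment holds both the parameters, below `N`, and the counterexample, shifted by `N`;
  -- `r'` sends the quantified variables to the shifted copies.
  let u' : ℕ → M := fun x => if x < N then u x else w (x - N)
  let r' : ℕ → ℕ := fun x => if x ∈ xs i then N + x else r x
  have h1 : (ψ i).neg.Realize (u' ∘ r') := by
    rw [realize_neg]
    refine fun h => hcon (((ψ i).realize_congr fun x hx => ?_).1 h)
    by_cases hxs : x ∈ xs i
    · simp [u', r', hxs]
    · have := hr x (hfv i x hx hxs)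
      simp [u', r', hxs, this, hw x hxs]
  have hpl : PiLike k (ψ i).neg := by
    refine ⟨?_, _, (hψ i).neg, Refines.refl _⟩
    rw [freeVars_neg]
    refine (hfin.union (List.finite_toSet (xs i))).subset fun x hx => ?_
    by_cases hxs : x ∈ xs i
    · exact .inr hxs
    · exact .inl (hfv i x hx hxs)
  obtain ⟨j, hj1, hj2⟩ := hk _ _ hpl hpl r' r' u' h1 h1
  obtain ⟨t, ht1, ht2⟩ := (realize_family_succ e k s u).1 hu j
    ⟨u', fun x hx => by simp [u', hN.symm ▸ hx], hj1⟩
  have h2 := (hj2 t ht2).1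
  rw [realize_neg] at h2
  apply h2
  have h3 := (realize_alls _ _ _).1 (hs i)
    (fun x => if x ∈ xs i then t (N + x) else assignment e s (r x))
    (fun x hx => by simp [hx])
  refine ((ψ i).realize_congr fun x hx => ?_).1 h3
  by_cases hxs : x ∈ xs i
  · simp [r', hxs]
  · simp [r', hxs, ht1 (r x) (hr x (hfv i x hx hxs))]

theorem generates [Nonempty M] {e : ℕ → M} (he : Function.Surjective e) (k : ℕ) : Generates L e k := by
  induction k with
  | zero => exact generates_zero e
  | succ k ih =>
    rintro χ₁ χ₂ ⟨hf₁, τ₁, hτ₁, h₁⟩ ⟨hf₂, τ₂, hτ₂, h₂⟩ r₁ r₂ v hv₁ hv₂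
    obtain ⟨N₁, hN₁⟩ := ((hf₁.subset h₁.1).image r₁).bddAbove
    obtain ⟨N₂, hN₂⟩ := ((hf₂.subset h₂.1).image r₂).bddAbove
    -- The generator is the `Π_{k+1}` type of `v` itself, cut off beyond all renamed variables of
    -- both formulas.
    obtain ⟨s, hs, hsv⟩ := exists_assignment he v (max N₁ N₂ + 1)
    have hb₁ : ∀ x ∈ τ₁.freeVars, r₁ x < codeLength s := fun x hx => by
      have := hN₁ (Set.mem_image_of_mem r₁ hx)
      omega
    have hb₂ : ∀ x ∈ τ₂.freeVars, r₂ x < codeLength s := fun x hx => by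
      have := hN₂ (Set.mem_image_of_mem r₂ hx)
      omega
    have hsv' : ∀ i < codeLength s, assignment e s i = v i := fun i hi => hsv i (hs ▸ hi)
    refine ⟨s, ?_, fun u hu => ⟨?_, ?_⟩⟩
    · rw [realize_family_succ]
      exact fun j hj => hj.congr fun i hi => (hsv' i hi).symm
    · refine (h₁.2 M _).1 (ih.transfer hτ₁ (hf₁.subset h₁.1) hb₁ ?_ hu)
      exact (τ₁.realize_congr fun x hx => hsv' _ (hb₁ x hx)).2 ((h₁.2 M _).2 hv₁)
    · refine (h₂.2 M _).1 (ih.transfer hτ₂ (hf₂.subset h₂.1) hb₂ ?_ hu)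
      exact (τ₂.realize_congr fun x hx => hsv' _ (hb₂ x hx)).2 ((h₂.2 M _).2 hv₂)

end Families

-- Subformulas

namespace InfFormula

/-- The set of subformulas. -/
def subformulas : InfFormula L → Set (InfFormula L)
  | qf θ hθ => {qf θ hθ}
  | iSup I ψ => {iSup I ψ} ∪ ⋃ i, (ψ i).subformulas
  | iInf I ψ => {iInf I ψ} ∪ ⋃ i, (ψ i).subformulas
  | ex x ψ => {ex x ψ} ∪ ψ.subformulas
  | all x ψ => {all x ψ} ∪ ψ.subformulas

theorem self_mem_subformulas (φ : InfFormula L) : φ ∈ φ.subformulas := by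
  cases φ <;> simp [subformulas]

theorem countable_subformulas (φ : InfFormula L) : φ.subformulas.Countable := by
  induction φ with
  | qf θ hθ => exact Set.countable_singleton _
  | iSup I ψ ih => exact (Set.countable_singleton _).union (Set.countable_iUnion ih)
  | iInf I ψ ih => exact (Set.countable_singleton _).union (Set.countable_iUnion ih)
  | ex x ψ ih => exact (Set.countable_singleton _).union ih
  | all x ψ ih => exact (Set.countable_singleton _).union ih

theorem subformulas_subset {φ ψ : InfFormula L} (h : ψ ∈ φ.subformulas) :
    ψ.subformulas ⊆ φ.subformulas := by
  induction φ with
  | qf θ hθ =>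
    rw [subformulas, Set.mem_singleton_iff] at h
    rw [h]
  | iSup I χ ih =>
    rcases h with h | h
    · rw [Set.mem_singleton_iff.1 h]
    · obtain ⟨i, hi⟩ := Set.mem_iUnion.1 h
      exact fun x hx => .inr (Set.mem_iUnion.2 ⟨i, ih i hi hx⟩)
  | iInf I χ ih =>
    rcases h with h | h
    · rw [Set.mem_singleton_iff.1 h]
    · obtain ⟨i, hi⟩ := Set.mem_iUnion.1 h
      exact fun x hx => .inr (Set.mem_iUnion.2 ⟨i, ih i hi hx⟩)
  | ex x χ ih =>
    rcases h with h | h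
    · rw [Set.mem_singleton_iff.1 h]
    · exact (ih h).trans Set.subset_union_right
  | all x χ ih =>
    rcases h with h | h
    · rw [Set.mem_singleton_iff.1 h]
    · exact (ih h).trans Set.subset_union_right

theorem mem_subformulas_exs (xs : List ℕ) (ψ : InfFormula L) : ψ ∈ (ψ.exs xs).subformulas := by
  induction xs with
  | nil => exact self_mem_subformulas ψ
  | cons x xs ih => exact .inr ih

theorem mem_subformulas_alls (xs : List ℕ) (ψ : InfFormula L) : ψ ∈ (ψ.alls xs).subformulas := by
  induction xs with
  | nil => exact self_mem_subformulas ψ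
  | cons x xs ih => exact .inr ih

theorem mem_subformulas_iSup {I : Set ℕ} {xs : I → List ℕ} {χ : I → InfFormula L} (i : I) :
    χ i ∈ (iSup I fun i => (χ i).exs (xs i)).subformulas :=
  .inr (Set.mem_iUnion.2 ⟨i, mem_subformulas_exs _ _⟩)

theorem mem_subformulas_iInf {I : Set ℕ} {xs : I → List ℕ} {χ : I → InfFormula L} (i : I) :
    χ i ∈ (iInf I fun i => (χ i).alls (xs i)).subformulas :=
  .inr (Set.mem_iUnion.2 ⟨i, mem_subformulas_alls _ _⟩)

theorem mem_freeVars_iSup {I : Set ℕ} {xs : I → List ℕ} {χ : I → InfFormula L} {i : I} {x : ℕ}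
    (hx : x ∈ (χ i).freeVars) (h : x ∉ xs i) :
    x ∈ (iSup I fun i => (χ i).exs (xs i)).freeVars :=
  Set.mem_iUnion.2 ⟨i, by rw [freeVars_exs]; exact ⟨hx, h⟩⟩

theorem mem_freeVars_iInf {I : Set ℕ} {xs : I → List ℕ} {χ : I → InfFormula L} {i : I} {x : ℕ}
    (hx : x ∈ (χ i).freeVars) (h : x ∉ xs i) :
    x ∈ (iInf I fun i => (χ i).alls (xs i)).freeVars :=
  Set.mem_iUnion.2 ⟨i, by rw [freeVars_alls]; exact ⟨hx, h⟩⟩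

theorem finite_freeVars_of_iSup {I : Set ℕ} {xs : I → List ℕ} {χ : I → InfFormula L}
    (h : (iSup I fun i => (χ i).exs (xs i)).freeVars.Finite) (i : I) :
    (χ i).freeVars.Finite := by
  refine (h.union (List.finite_toSet (xs i))).subset fun x hx => ?_
  by_cases hxs : x ∈ xs i
  · exact .inr hxs
  · exact .inl (mem_freeVars_iSup hx hxs)

theorem finite_freeVars_of_iInf {I : Set ℕ} {xs : I → List ℕ} {χ : I → InfFormula L}
    (h : (iInf I fun i => (χ i).alls (xs i)).freeVars.Finite) (i : I) :
    (χ i).freeVars.Finite := by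
  refine (h.union (List.finite_toSet (xs i))).subset fun x hx => ?_
  by_cases hxs : x ∈ xs i
  · exact .inr hxs
  · exact .inl (mem_freeVars_iInf hx hxs)

end InfFormula

/-- Serves `Condition.exists_le_omits`: it lets the elements named by `r` be copied to the first
variables, where the types to be omitted live. -/
theorem exists_qf_shift_eq (L : FirstOrder.Language.{0, 0}) (M : Type) [L.Structure M]
    (r : ℕ → ℕ) (l k : ℕ) : ∃ θ : L.Formula ℕ, θ.IsQF ∧ ∀ u : ℕ → M,
      θ.Realize u ↔ ∀ i < k, u i = u (l + r i) := by
  induction k with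
  | zero => exact ⟨⊤, BoundedFormula.IsQF.top, fun u => by simp⟩
  | succ k ih =>
    obtain ⟨θ, hθ, h⟩ := ih
    refine ⟨θ ⊓ Term.equal (Term.var k) (Term.var (l + r k)),
      hθ.inf (.of_isAtomic (.equal _ _)), fun u => ?_⟩
    rw [Formula.realize_inf, h, Formula.realize_equal]
    simp only [Term.realize_var, Nat.lt_succ_iff_lt_or_eq, or_imp, forall_and, forall_eq]

-- Forcing with realized formulas, and omitting types

section Forcing

open Filter

variable [Primcodable (Σ k, L.Functions k)] [Primcodable (Σ k, L.Relations k)]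
variable {M : Type} [L.Structure M]

/-- Forcing conditions: formulas from the `m`-th family, together with an assignment satisfying
them. -/
structure Condition (L : FirstOrder.Language.{0, 0}) [Primcodable (Σ k, L.Functions k)]
    [Primcodable (Σ k, L.Relations k)] [L.Structure M] (e : ℕ → M) (m : ℕ) where
  /-- The index of the formula. -/
  index : ℕ
  /-- The assignment. -/
  val : ℕ → M
  realize : (family L e m index).Realize val

variable {e : ℕ → M} {m : ℕ}

/-- The condition `c` forces the formula `ψ` of the variables renamed by `r`. -/
def Condition.Forces (c : Condition L e m) (ψ : InfFormula L) (r : ℕ → ℕ) : Prop :=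
  ∀ u : ℕ → M, (family L e m c.index).Realize u → ψ.Realize (u ∘ r)

instance : Preorder (Condition L e m) where
  le c d := d.Forces (family L e m c.index) id
  le_refl _ _ h := h
  le_trans _ _ _ h h' u hu := h u (h' u hu)

theorem Condition.Forces.mono {c d : Condition L e m} {ψ : InfFormula L} {r : ℕ → ℕ}
    (h : c.Forces ψ r) (hcd : c ≤ d) : d.Forces ψ r := fun u hu => h u (hcd u hu)

/-- Whatever holds at some assignment `u` satisfying the condition can be forced by an extension, by
generating the old formula and `χ` together; `u` need not be `c.val`. -/
theorem Condition.exists_le [Nonempty M] (he : Function.Surjective e) (c : Condition L e m)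
    {u : ℕ → M} (hu : (family L e m c.index).Realize u) {χ : InfFormula L} (hχ : PiLike m χ)
    {r : ℕ → ℕ} (h : χ.Realize (u ∘ r)) :
    ∃ d, c ≤ d ∧ d.Forces χ r := by
  obtain ⟨j, hj1, hj2⟩ := generates (L := L) he m _ χ (piLike_family e m c.index) hχ id r u hu h
  exact ⟨⟨j, u, hj1⟩, fun t ht => (hj2 t ht).1, fun t ht => (hj2 t ht).2⟩

/-- `c` refutes the `Σ_{k+1}` formula `ψ`, or forces a witness for it. -/
def Condition.Decides (c : Condition L e m) (k : ℕ) (ψ : InfFormula L) (r : ℕ → ℕ) : Prop :=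
  c.Forces ψ.neg r ∨ ∃ (I : Set ℕ) (xs : I → List ℕ) (χ : I → InfFormula L),
    ψ = iSup I (fun i => (χ i).exs (xs i)) ∧ (∀ i, (χ i).IsPi k) ∧
    ∃ (i : I) (r' : ℕ → ℕ), (∀ x ∉ xs i, r' x = r x) ∧ c.Forces (χ i) r'

/-- If `ψ` is not refuted by `c`, it holds at some assignment satisfying `c`, and a disjunct with
its witnesses can be forced after the witnesses are moved to fresh variables. -/
theorem Condition.exists_le_decides [Nonempty M] (he : Function.Surjective e)
    (c : Condition L e m) {k : ℕ} (hk : k ≤ m) {ψ : InfFormula L} (hψ : ψ.IsSigma (k + 1))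
    (hfin : ψ.freeVars.Finite) (r : ℕ → ℕ) : ∃ d, c ≤ d ∧ d.Decides k ψ r := by
  by_cases hc : c.Forces ψ.neg r
  · exact ⟨c, le_refl c, .inl hc⟩
  · obtain ⟨I, xs, χ, rfl, hχ⟩ := hψ
    simp only [Condition.Forces, realize_neg, not_forall, not_not] at hc
    obtain ⟨u, hu, i, hi⟩ := hc
    obtain ⟨w, hw1, hw2⟩ := (realize_exs _ _ _).1 hi
    obtain ⟨N₀, hN₀⟩ := (hfin.image r).bddAbove
    -- From `N` on, the variables are free for witnesses: the condition does not mention them, and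
    -- no free variable of `ψ` is renamed to them.
    let N := max (familyBound m c.index) (N₀ + 1)
    let u' : ℕ → M := fun x => if x < N then u x else w (x - N)
    let r' : ℕ → ℕ := fun x => if x ∈ xs i then N + x else r x
    have h1 : (family L e m c.index).Realize u' := by
      refine (realize_congr _ fun x hx => ?_).1 hu
      have : x < N := lt_of_lt_of_le (freeVars_family e m _ hx) (le_max_left _ _)
      simp [u', this]
    have h2 : (χ i).Realize (u' ∘ r') := by
      refine ((χ i).realize_congr fun x hx => ?_).1 hw2
      by_cases hxs : x ∈ xs i
      · simp [u', r', hxs]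
      · have h3 := hN₀ (Set.mem_image_of_mem r (mem_freeVars_iSup hx hxs))
        have : r x < N := by omega
        simp [u', r', hxs, this, hw1 x hxs]
    have hpl : PiLike m (χ i) :=
      PiLike.mono ⟨finite_freeVars_of_iSup hfin i, _, hχ i, Refines.refl _⟩ hk
    obtain ⟨d, hd1, hd2⟩ := c.exists_le he h1 hpl h2
    exact ⟨d, hd1, .inr ⟨I, xs, χ, rfl, hχ, i, r', fun x hx => by simp [r', hx], hd2⟩⟩

/-- Only countably many renamings, coded by finite sequences, can be handled as requirements; this
extends the result to all renamings when `ψ` has finitely many free variables. -/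
theorem Condition.Decides.congr {c : Condition L e m} {k : ℕ} {ψ : InfFormula L} {r r' : ℕ → ℕ}
    (h : c.Decides k ψ r) (hr : ∀ x ∈ ψ.freeVars, r x = r' x) : c.Decides k ψ r' := by
  rcases h with h | ⟨I, xs, χ, rfl, hχ, i, s, hs, h⟩
  · refine .inl fun u hu => (realize_congr _ fun x hx => ?_).1 (h u hu)
    rw [freeVars_neg] at hx
    simp [hr x hx]
  · refine .inr ⟨I, xs, χ, rfl, hχ, i, fun x => if x ∈ xs i then s x else r' x,
      fun x hx => by simp [hx], fun u hu => (realize_congr _ fun x hx => ?_).1 (h u hu)⟩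
    by_cases hxs : x ∈ xs i
    · simp [hxs]
    · simp [hxs, hs x hxs, hr x (mem_freeVars_iSup hx hxs)]

/-- A fresh variable is given the value of the function; this will close the named elements under
the functions of the language. -/
theorem Condition.exists_le_funMap [Nonempty M] (he : Function.Surjective e)
    (c : Condition L e m) {k : ℕ} (f : L.Functions k) (r : Fin k → ℕ) :
    ∃ d, c ≤ d ∧ ∃ x, ∀ u : ℕ → M, (family L e m d.index).Realize u →
      u x = Structure.funMap f (u ∘ r) := by
  obtain ⟨N₀, hN₀⟩ := (Set.finite_range r).bddAbove
  let N := max (familyBound m c.index) (N₀ + 1)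
  let u : ℕ → M := fun x => if x < N then c.val x else Structure.funMap f (c.val ∘ r)
  have h1 : (family L e m c.index).Realize u := by
    refine (realize_congr _ fun x hx => ?_).1 c.realize
    have : x < N := lt_of_lt_of_le (freeVars_family e m _ hx) (le_max_left _ _)
    simp [u, this]
  have hr : ∀ i, r i < N := fun i => by
    have := hN₀ (Set.mem_range_self i)
    omega
  let θ : L.Formula ℕ := Term.equal (Term.var N) (Term.func f fun i => Term.var (r i))
  have hθ : θ.IsQF := .of_isAtomic (.equal _ _)
  have key : ∀ t : ℕ → M, θ.Realize t ↔ t N = Structure.funMap f (t ∘ r) := fun t => by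
    simp only [θ, Formula.realize_equal]
    rfl
  have h2 : (qf θ hθ).Realize (u ∘ id) := by
    rw [realize_qf, key]
    simp only [Function.comp_id, u, lt_irrefl, if_false]
    congr 1
    funext i
    simp [hr i]
  obtain ⟨d, hd1, hd2⟩ := c.exists_le he h1 (piLike_qf m θ hθ) h2
  exact ⟨d, hd1, N, fun t ht => (key t).1 (hd2 t ht)⟩

/-- If no formula of the `m`-th family supports the type of the first `l` values of `p`, then that
type can be omitted. -/
theorem Condition.exists_le_omits [Nonempty M] (he : Function.Surjective e) {p : ℕ → M} {l : ℕ}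
    (H : ∀ j, (∃ v : ℕ → M, (family L e m j).Realize v) → ∃ b : ℕ → M,
      (family L e m j).ExtRealize l b ∧
        ∃ g, (family L e m g).ExtRealize l b ∧ ¬ (family L e m g).ExtRealize l p)
    (c : Condition L e m) (r : ℕ → ℕ) :
    ∃ d, c ≤ d ∧ ∃ (g : ℕ) (r' : ℕ → ℕ), (∀ i < l, r' i = r i) ∧
      ¬ (family L e m g).ExtRealize l p ∧ d.Forces (family L e m g) r' := by
  obtain ⟨θ, hθ, hθr⟩ := exists_qf_shift_eq L M r l l
  -- All variables of the condition move up by `l`, which frees the first `l` places for copies of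
  -- the elements named by `r`.
  let v : ℕ → M := fun x => if x < l then c.val (r x) else c.val (x - l)
  have hv : v ∘ (fun x => l + x) = c.val := by
    funext x
    simp [v]
  obtain ⟨j, hj1, hj2⟩ := generates (L := L) he m _ (qf θ hθ) (piLike_family e m c.index)
    (piLike_qf m θ hθ) (fun x => l + x) id v (hv ▸ c.realize) (by
      rw [realize_qf, Function.comp_id, hθr]
      intro i hi
      simp [v, hi])
  -- Since `j` does not support the type of `p`, some `b` realizes `j` and an existential formula
  -- `g` false of `p`. Shifting `u₂` back down recovers an assignment for `c` whose elements named
  -- by `r` are the first `l` values of `b`; the witnesses for `g` go to fresh variables.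
  obtain ⟨b, ⟨u₂, hu₂, hju₂⟩, g, ⟨w, hw, hgw⟩, hgp⟩ := H j ⟨v, hj1⟩
  obtain ⟨hu₃, heq⟩ := hj2 u₂ hju₂
  rw [realize_qf, Function.comp_id, hθr] at heq
  obtain ⟨N₀, hN₀⟩ := ((Set.finite_Iio l).image r).bddAbove
  let N := max (familyBound m c.index) (N₀ + 1)
  let u : ℕ → M := fun x => if x < N then u₂ (l + x) else w (x - N)
  let r' : ℕ → ℕ := fun x => if x < l then r x else N + x
  have h1 : (family L e m c.index).Realize u := by
    refine (realize_congr _ fun x hx => ?_).1 hu₃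
    have : x < N := lt_of_lt_of_le (freeVars_family e m _ hx) (le_max_left _ _)
    simp [u, this]
  have h2 : u ∘ r' = w := by
    funext x
    by_cases hx : x < l
    · have := hN₀ (Set.mem_image_of_mem r (Set.mem_Iio.2 hx))
      have hrN : r x < N := by omega
      simp [u, r', hx, hrN, ← heq x hx, hu₂ x hx, hw x hx]
    · simp [u, r', hx]
  obtain ⟨d, hd1, hd2⟩ := c.exists_le he h1 (piLike_family e m g) (r := r') (h2 ▸ hgw)
  exact ⟨d, hd1, g, r', fun i hi => by simp [r', hi], hgp, hd2⟩

/-- The requirements met by a generic sequence of conditions. -/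
structure IsGeneric (𝓕 : Set (InfFormula L)) (c : ℕ → Condition L e m) : Prop where
  monotone : Monotone c
  decides : ∀ ψ ∈ 𝓕, ∀ k ≤ m, ψ.IsSigma (k + 1) → ψ.freeVars.Finite → ∀ r : ℕ → ℕ,
    ∃ s, (c s).Decides k ψ r
  funMap : ∀ {k : ℕ} (f : L.Functions k) (r : Fin k → ℕ), ∃ s x, ∀ u : ℕ → M,
    (family L e m (c s).index).Realize u → u x = Structure.funMap f (u ∘ r)

/-- The Rasiowa–Sikorski argument: the three kinds of requirements define countably many cofinal
sets, renamings being restricted to finite codes, and a monotone sequence meets them all. -/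
theorem exists_isGeneric [Nonempty M] (he : Function.Surjective e) {p : ℕ → M} {l : ℕ}
    (H : ∀ j, (∃ v : ℕ → M, (family L e m j).Realize v) → ∃ b : ℕ → M,
      (family L e m j).ExtRealize l b ∧
        ∃ g, (family L e m g).ExtRealize l b ∧ ¬ (family L e m g).ExtRealize l p)
    {𝓕 : Set (InfFormula L)} (h𝓕 : 𝓕.Countable) :
    ∃ c : ℕ → Condition L e m, IsGeneric 𝓕 c ∧ ∀ r : ℕ → ℕ, ∃ (s g : ℕ) (r' : ℕ → ℕ),
      (∀ i < l, r' i = r i) ∧ ¬ (family L e m g).ExtRealize l p ∧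
        (c s).Forces (family L e m g) r' := by
  have := h𝓕.to_subtype
  let _ : Encodable 𝓕 := Encodable.ofCountable _
  let ren : ℕ → ℕ → ℕ := fun s => assignment id s
  have hren : ∀ (v : ℕ → ℕ) (N : ℕ), ∃ s, ∀ i < N, ren s i = v i := fun v N => by
    obtain ⟨s, -, hs⟩ := exists_assignment Function.surjective_id v N
    exact ⟨s, hs⟩
  let D₁ : 𝓕 × ℕ × ℕ → Order.Cofinal (Condition L e m) := fun a =>
    ⟨{c | a.2.1 ≤ m → a.1.1.IsSigma (a.2.1 + 1) → a.1.1.freeVars.Finite →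
        c.Decides a.2.1 a.1.1 (ren a.2.2)}, fun c => by
      by_cases h : a.2.1 ≤ m ∧ a.1.1.IsSigma (a.2.1 + 1) ∧ a.1.1.freeVars.Finite
      · obtain ⟨d, hd1, hd2⟩ := c.exists_le_decides he h.1 h.2.1 h.2.2 (ren a.2.2)
        exact ⟨d, fun _ _ _ => hd2, hd1⟩
      · exact ⟨c, fun h1 h2 h3 => (h ⟨h1, h2, h3⟩).elim, le_refl c⟩⟩
  let D₂ : (Σ k, L.Functions k) × ℕ → Order.Cofinal (Condition L e m) := fun a =>
    ⟨{c | ∃ x, ∀ u : ℕ → M, (family L e m c.index).Realize u →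
      u x = Structure.funMap a.1.2 (u ∘ fun i : Fin a.1.1 => ren a.2 i)}, fun c => by
      obtain ⟨d, hd1, hd2⟩ := c.exists_le_funMap he a.1.2 fun i => ren a.2 i
      exact ⟨d, hd2, hd1⟩⟩
  let D₃ : ℕ → Order.Cofinal (Condition L e m) := fun a =>
    ⟨{c | ∃ (g : ℕ) (r' : ℕ → ℕ), (∀ i < l, r' i = ren a i) ∧
      ¬ (family L e m g).ExtRealize l p ∧ c.Forces (family L e m g) r'}, fun c => by
      obtain ⟨d, hd1, hd2⟩ := c.exists_le_omits he H (ren a)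
      exact ⟨d, hd2, hd1⟩⟩
  let D : (𝓕 × ℕ × ℕ) ⊕ ((Σ k, L.Functions k) × ℕ) ⊕ ℕ → Order.Cofinal (Condition L e m) :=
    Sum.elim D₁ (Sum.elim D₂ D₃)
  obtain ⟨v⟩ : Nonempty (ℕ → M) := inferInstance
  obtain ⟨j, hj, -⟩ := generates (L := L) he m _ _ (piLike_qf m ⊤ BoundedFormula.IsQF.top)
    (piLike_qf m ⊤ BoundedFormula.IsQF.top) id id v (by simp) (by simp)
  refine ⟨Order.sequenceOfCofinals ⟨j, v, hj⟩ D,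
    ⟨Order.sequenceOfCofinals.monotone _ D, fun ψ hψ k hk h1 h2 r => ?_, fun {k} f r => ?_⟩,
    fun r => ?_⟩
  · obtain ⟨N, hN⟩ := h2.bddAbove
    obtain ⟨a, ha⟩ := hren r (N + 1)
    have := Order.sequenceOfCofinals.encode_mem (⟨j, v, hj⟩ : Condition L e m) D
      (.inl (⟨ψ, hψ⟩, k, a))
    exact ⟨_, (this hk h1 h2).congr fun x hx => ha x (Nat.lt_succ_of_le (hN hx))⟩
  · obtain ⟨a, ha⟩ := hren (fun i => if h : i < k then r ⟨i, h⟩ else 0) k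
    have := Order.sequenceOfCofinals.encode_mem (⟨j, v, hj⟩ : Condition L e m) D
      (.inr (.inl (⟨k, f⟩, a)))
    obtain ⟨x, hx⟩ := this
    have hra : (fun i : Fin k => ren a i) = r := by
      funext i
      simp [ha i i.2]
    exact ⟨_, x, fun u hu => hra ▸ hx u hu⟩
  · obtain ⟨a, ha⟩ := hren r l
    have := Order.sequenceOfCofinals.encode_mem (⟨j, v, hj⟩ : Condition L e m) D
      (.inr (.inr a))
    obtain ⟨g, r', h1, h2, h3⟩ := this
    exact ⟨_, g, r', fun i hi => (h1 i hi).trans (ha i hi), h2, h3⟩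

/-- The element of the ultrapower given by the values of the variable `x_i`. -/
noncomputable def genericPoint (c : ℕ → Condition L e m) (i : ℕ) :
    (hyperfilter ℕ : Filter ℕ).Product (fun _ => M) :=
  Quotient.mk _ (fun s => (c s).val i)

/-- The structure generated by a generic sequence of conditions. -/
def genericModel {𝓕 : Set (InfFormula L)} {c : ℕ → Condition L e m} (hc : IsGeneric 𝓕 c) :
    L.Substructure ((hyperfilter ℕ : Filter ℕ).Product (fun _ => M)) where
  carrier := Set.range (genericPoint c)
  fun_mem := by
    intro k f x hx
    choose r hr using hx
    obtain ⟨s, y, hy⟩ := hc.funMap f r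
    refine ⟨y, ?_⟩
    rw [show x = fun i => genericPoint c (r i) from (funext hr).symm]
    refine Eq.trans ?_ (Ultraproduct.funMap_cast f fun i s => (c s).val (r i)).symm
    -- The equation forced at stage `s` holds in all later conditions, hence for almost all indices
    -- of the non-principal ultrafilter.
    refine Quotient.sound ?_
    refine Filter.Eventually.filter_mono Nat.hyperfilter_le_atTop ?_
    filter_upwards [eventually_ge_atTop s] with t ht
    exact hy _ (hc.monotone ht _ (c t).realize)

variable {𝓕 : Set (InfFormula L)} {c : ℕ → Condition L e m}

/-- The assignment of elements of the generic model given by a renaming of variables. -/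
noncomputable def genericAssignment (hc : IsGeneric 𝓕 c) (r : ℕ → ℕ) (i : ℕ) : genericModel hc :=
  ⟨genericPoint c (r i), r i, rfl⟩

theorem exists_genericAssignment (hc : IsGeneric 𝓕 c) (w : ℕ → genericModel hc) :
    ∃ r, w = genericAssignment hc r := by
  choose r hr using fun i => (w i).2
  exact ⟨r, funext fun i => Subtype.ext (hr i).symm⟩

theorem countable_genericModel (hc : IsGeneric 𝓕 c) : Countable (genericModel hc) :=
  (Set.countable_range (genericPoint c)).to_subtype

/-- Łoś's theorem gives truth in the ultrapower, and quantifier-free truth passes down to the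
substructure. -/
theorem realize_qf_genericModel [Nonempty M] (hc : IsGeneric 𝓕 c) {θ : L.Formula ℕ} (hθ : θ.IsQF)
    {r : ℕ → ℕ} {s : ℕ} (h : (c s).Forces (qf θ hθ) r) :
    (qf θ hθ).Realize (genericAssignment hc r) := by
  rw [realize_qf, Formula.Realize, ← hθ.realize_embedding (genericModel hc).subtype]
  have := (Ultraproduct.realize_formula_cast (u := hyperfilter ℕ) (M := fun _ => M) θ
    fun i s => (c s).val (r i)).2 (by
      refine Filter.Eventually.filter_mono Nat.hyperfilter_le_atTop ?_
      filter_upwards [eventually_ge_atTop s] with t ht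
      exact h _ (hc.monotone ht _ (c t).realize))
  rw [Formula.Realize] at this
  refine Eq.mpr ?_ this
  congr 1
  exact Subsingleton.elim _ _

/-- The truth lemma, in the direction from forced to true. Decisions are available for `Σ_{k+1}`
formulas with `k ≤ m`, so the `Σ` part reaches level `m + 1`; universal quantifiers need no further
decision, so the `Π` part reaches level `m + 2`, that of the Scott sentence. -/
theorem realize_genericModel [Nonempty M] (hc : IsGeneric 𝓕 c)
    (h𝓕 : ∀ ψ ∈ 𝓕, ψ.subformulas ⊆ 𝓕) (k : ℕ) :
    (k ≤ m + 1 → ∀ ψ ∈ 𝓕, ψ.IsSigma k → ψ.freeVars.Finite → ∀ (r : ℕ → ℕ) (s : ℕ),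
      (c s).Forces ψ r → ψ.Realize (genericAssignment hc r)) ∧
    (k ≤ m + 2 → ∀ ψ ∈ 𝓕, ψ.IsPi k → ψ.freeVars.Finite → ∀ (r : ℕ → ℕ) (s : ℕ),
      (c s).Forces ψ r → ψ.Realize (genericAssignment hc r)) := by
  induction k with
  | zero =>
    constructor <;>
    · rintro - ψ - ⟨θ, hθ, rfl⟩ - r s h
      exact realize_qf_genericModel hc hθ h
  | succ k ih =>
    constructor
    · intro hk ψ hψ hσ hfin r s h
      obtain ⟨t, ht⟩ := hc.decides ψ hψ k (by omega) hσ hfin r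
      rcases ht with ht | ⟨I, xs, χ, rfl, hχ, i, r', hr', ht⟩
      -- A forced formula cannot also be refuted: a later condition would satisfy both at its own
      -- assignment.
      · have h1 := h.mono (hc.monotone (le_max_left s t)) _ (c (max s t)).realize
        have h2 := ht.mono (hc.monotone (le_max_right s t)) _ (c (max s t)).realize
        rw [realize_neg] at h2
        exact (h2 h1).elim
      · refine ⟨i, (realize_exs _ _ _).2 ⟨genericAssignment hc r', fun x hx => ?_, ?_⟩⟩
        · simp [genericAssignment, hr' x hx]
        · exact ih.2 (by omega) (χ i) (h𝓕 _ hψ (mem_subformulas_iSup i)) (hχ i)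
            (finite_freeVars_of_iSup hfin i) r' t ht
    · rintro hk ψ hψ ⟨I, xs, χ, rfl, hχ⟩ hfin r s h i
      refine (realize_alls _ _ _).2 fun w hw => ?_
      obtain ⟨r₀, rfl⟩ := exists_genericAssignment hc w
      let r' : ℕ → ℕ := fun x => if x ∈ xs i then r₀ x else r x
      have : genericAssignment hc r₀ = genericAssignment hc r' := by
        funext x
        by_cases hx : x ∈ xs i
        · simp [genericAssignment, r', hx]
        · rw [hw x hx]
          simp [genericAssignment, r', hx]
      rw [this]
      refine ih.1 (by omega) (χ i) (h𝓕 _ hψ (mem_subformulas_iInf i)) (hχ i)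
        (finite_freeVars_of_iInf hfin i) r' s fun u hu => ?_
      exact (realize_alls _ _ _).1 (h u hu i) _ fun x hx => by simp [r', hx]

/-- If a countable structure has a `Π_{m+2}` Scott sentence, then all its types are supported. -/
theorem exists_supporting [Nonempty M] (he : Function.Surjective e) {φ : InfFormula L}
    (hφ : φ.IsPi (m + 2)) (hS : IsScottSentence M φ) (p : ℕ → M) (l : ℕ) :
    ∃ j, (∃ v : ℕ → M, (family L e m j).Realize v) ∧ ∀ b : ℕ → M,
      (family L e m j).ExtRealize l b → ∀ g, (family L e m g).ExtRealize l b →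
        (family L e m g).ExtRealize l p := by
  by_contra hcon
  push Not at hcon
  choose τ hτ1 hτ2 using fun j => (piLike_family (L := L) e m j).2
  -- Besides the Scott sentence, the `Π_m` forms `τ j` of the family are needed, so that a formula
  -- forced in order to omit the type is true in the generic model.
  let 𝓕 : Set (InfFormula L) := φ.subformulas ∪ ⋃ j, (τ j).subformulas
  have h𝓕 : ∀ ψ ∈ 𝓕, ψ.subformulas ⊆ 𝓕 := by
    rintro ψ (hψ | hψ)
    · exact (subformulas_subset hψ).trans Set.subset_union_left
    · obtain ⟨j, hj⟩ := Set.mem_iUnion.1 hψ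
      exact fun x hx => .inr (Set.mem_iUnion.2 ⟨j, subformulas_subset hj hx⟩)
  obtain ⟨c, hc, homit⟩ := exists_isGeneric he hcon (𝓕 := 𝓕)
    (φ.countable_subformulas.union (Set.countable_iUnion fun j => (τ j).countable_subformulas))
  have := countable_genericModel hc
  have : Nonempty (genericModel hc) := ⟨genericAssignment hc id 0⟩
  have : Countable M := he.countable
  have hM : φ.Models M := (hS.2 M).2 ⟨FirstOrder.Language.Equiv.refl L M⟩
  have hB : φ.Models (genericModel hc) := by
    rw [hS.1.models_iff (genericAssignment hc id)]
    exact (realize_genericModel hc h𝓕 (m + 2)).2 le_rfl φ (.inl φ.self_mem_subformulas) hφ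
      (by rw [hS.1]; exact Set.finite_empty) id 0 fun u _ => hM _
  obtain ⟨f⟩ := (hS.2 _).1 hB
  -- The isomorphic image of `p` is named by some `r`, and the omitting requirement for `r` gives it
  -- an existential property which `p` lacks.
  obtain ⟨r, hr⟩ := exists_genericAssignment hc (f ∘ p)
  obtain ⟨s, g, r', hr', hgp, hg⟩ := homit r
  apply hgp
  have h1 : (τ g).Realize (genericAssignment hc r') :=
    (realize_genericModel hc h𝓕 m).2 (by omega) (τ g)
      (.inr (Set.mem_iUnion.2 ⟨g, self_mem_subformulas _⟩)) (hτ1 g)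
      ((Set.finite_Iio _).subset ((hτ2 g).1.trans (freeVars_family e m g))) r' s
      fun u hu => ((hτ2 g).2 M _).2 (hg u hu)
  rw [(hτ2 g).2] at h1
  refine ⟨f.symm ∘ genericAssignment hc r', fun i hi => ?_, (realize_equiv f.symm _ _).2 h1⟩
  have h2 : genericAssignment hc r' i = genericAssignment hc r i := by
    simp [genericAssignment, hr' i hi]
  simp only [Function.comp_apply, h2, ← hr]
  exact f.symm_apply_apply _

end Forcing

/-! ### Isomorphisms from enumerations -/

theorem nonempty_equiv_of_qf {M N : Type} [L.Structure M] [L.Structure N] {a : ℕ → M} {b : ℕ → N}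
    (ha : Function.Surjective a) (hb : Function.Surjective b)
    (h : ∀ θ : L.Formula ℕ, θ.IsQF → (θ.Realize a ↔ θ.Realize b)) : Nonempty (M ≃[L] N) := by
  choose c hc using ha
  have heq : ∀ i j, a i = a j ↔ b i = b j := fun i j => by
    have := h (Term.equal (Term.var i) (Term.var j)) (.of_isAtomic (.equal _ _))
    simpa [Formula.realize_equal] using this
  have hg : ∀ i, b (c (a i)) = b i := fun i => (heq _ _).1 (hc (a i))
  have hbij : Function.Bijective fun x => b (c x) := by
    constructor
    · intro x y hxy
      rw [← hc x, ← hc y]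
      exact (heq _ _).2 hxy
    · intro y
      obtain ⟨i, rfl⟩ := hb y
      exact ⟨a i, hg i⟩
  refine ⟨⟨Equiv.ofBijective _ hbij, fun {n} f x => ?_, fun {n} R x => ?_⟩⟩
  · have := h (Term.equal (Term.var (c (Structure.funMap f x)))
      (Term.func f fun i => Term.var (c (x i)))) (.of_isAtomic (.equal _ _))
    simp only [Formula.realize_equal, Term.realize_var, Term.realize_func, hc] at this
    exact this.1 trivial
  · have := h (Relations.boundedFormula R fun i => Term.var (Sum.inl (c (x i))))
      (.of_isAtomic (.rel _ _))
    simp only [Formula.Realize, BoundedFormula.realize_rel, Term.realize_var, Sum.elim_inl,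
      hc] at this
    exact this.symm

-- Building blocks of the canonical sentence

namespace InfFormula

/-- The conjunction of two formulas. -/
noncomputable def and (φ ψ : InfFormula L) : InfFormula L := (φ.neg.or ψ.neg).neg

@[simp] theorem realize_and {M : Type} [L.Structure M] (φ ψ : InfFormula L) (v : ℕ → M) :
    (φ.and ψ).Realize v ↔ φ.Realize v ∧ ψ.Realize v := by
  simp [InfFormula.and]

@[simp] theorem freeVars_and (φ ψ : InfFormula L) :
    (φ.and ψ).freeVars = φ.freeVars ∪ ψ.freeVars := by
  simp [InfFormula.and]

/-- The formula expressing `ExtRealize`. -/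
noncomputable def ext (l b : ℕ) (φ : InfFormula L) : InfFormula L :=
  guardedSup (fun i => i = 0) (fun _ => varsFrom l b) fun _ => φ

theorem realize_ext {M : Type} [L.Structure M] {l b : ℕ} {φ : InfFormula L}
    (hφ : φ.freeVars ⊆ Set.Iio b) (v : ℕ → M) : (ext l b φ).Realize v ↔ φ.ExtRealize l v := by
  simp [ext, realize_guardedSup, exists_agree_off_varsFrom hφ]

theorem freeVars_ext {l b : ℕ} {φ : InfFormula L} (hφ : φ.freeVars ⊆ Set.Iio b) :
    (ext l b φ).freeVars ⊆ Set.Iio l := by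
  rw [ext, freeVars_guardedSup]
  refine Set.iUnion_subset fun _ x hx => ?_
  have h1 := hφ hx.1
  have h2 := hx.2
  simp only [Set.mem_ofPred_eq, mem_varsFrom, Set.mem_Iio] at h1 h2 ⊢
  omega

/-- The conjunction of the universal closures of the formulas `σ_j`, over all `j` satisfying
`S`. -/
noncomputable def closedInf (S : ℕ → Prop) (b : ℕ → ℕ) (σ : ℕ → InfFormula L) : InfFormula L :=
  guardedInf S (fun j => varsFrom 0 (b j)) σ

theorem freeVars_closedInf {S : ℕ → Prop} {b : ℕ → ℕ} {σ : ℕ → InfFormula L}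
    (h : ∀ j, (σ j).freeVars ⊆ Set.Iio (b j)) : (closedInf S b σ).freeVars = ∅ := by
  rw [closedInf, freeVars_guardedInf]
  refine Set.subset_empty_iff.1 (Set.iUnion_subset fun j x hx => ?_)
  have h1 := h j hx.1
  have h2 := hx.2
  simp only [Set.mem_ofPred_eq, mem_varsFrom, Set.mem_Iio] at h1 h2
  omega

theorem realize_closedInf {M : Type} [L.Structure M] {S : ℕ → Prop} {b : ℕ → ℕ}
    {σ : ℕ → InfFormula L} (h : ∀ j, (σ j).freeVars ⊆ Set.Iio (b j)) (v : ℕ → M) :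
    (closedInf S b σ).Realize v ↔ ∀ j, S j → ∀ w : ℕ → M, (σ j).Realize w := by
  rw [closedInf, realize_guardedInf]
  refine forall_congr' fun j => imp_congr_right fun _ => ⟨fun H w => ?_, fun H w _ => H w⟩
  refine (realize_congr _ fun x hx => ?_).1
    (H (fun i => if i < b j then w i else v i) fun i hi => ?_)
  · simp [Set.mem_Iio.1 (h j hx)]
  · rw [mem_varsFrom] at hi
    simp [show ¬ i < b j by omega]

end InfFormula

/-! ### A canonical Scott sentence -/

section Canonical

variable [Primcodable (Σ k, L.Functions k)] [Primcodable (Σ k, L.Relations k)]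
variable {M : Type} [L.Structure M]

/-- The existential quantification of the formula with index `j` over the variables
`x_l, x_{l+1}, …` is consistent, and decides all formulas of this form. -/
def IsComplete (L : FirstOrder.Language.{0, 0}) [Primcodable (Σ k, L.Functions k)]
    [Primcodable (Σ k, L.Relations k)] [L.Structure M] (e : ℕ → M) (m l j : ℕ) : Prop :=
  (∃ v : ℕ → M, (family L e m j).Realize v) ∧
    ∀ a b : ℕ → M, (family L e m j).Realize a → (family L e m j).Realize b →
      ∀ g, (family L e m g).ExtRealize l a → (family L e m g).ExtRealize l b

variable {e : ℕ → M} {m : ℕ}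

theorem IsComplete.ext {l j : ℕ} (h : IsComplete L e m l j) {a b : ℕ → M}
    (ha : (family L e m j).ExtRealize l a) (hb : (family L e m j).ExtRealize l b) {g : ℕ}
    (hg : (family L e m g).ExtRealize l a) : (family L e m g).ExtRealize l b := by
  obtain ⟨a', ha1, ha2⟩ := ha
  obtain ⟨b', hb1, hb2⟩ := hb
  exact (h.2 a' b' ha2 hb2 g (hg.congr fun i hi => (ha1 i hi).symm)).congr hb1

/-- Support is one-sided: tuples satisfying `j` have only properties of `p`. For such a tuple `b`,
let `i` support its own type. Then `b` satisfies `i`, hence so does `p`, and therefore the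
properties of `p` are properties of `b`. -/
theorem exists_isComplete [Nonempty M] (he : Function.Surjective e) {φ : InfFormula L}
    (hφ : φ.IsPi (m + 2)) (hS : IsScottSentence M φ) (p : ℕ → M) (l : ℕ) :
    ∃ j, IsComplete L e m l j ∧ (family L e m j).ExtRealize l p := by
  obtain ⟨j, ⟨v, hv⟩, hj⟩ := exists_supporting he hφ hS p l
  have h1 : ∀ b : ℕ → M, (family L e m j).ExtRealize l b → ∀ g,
      (family L e m g).ExtRealize l p → (family L e m g).ExtRealize l b := by
    intro b hb g hg
    obtain ⟨i, ⟨w, hw⟩, hi⟩ := exists_supporting he hφ hS b l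
    exact hi p (hj b hb i (hi w (.of_realize hw) i (.of_realize hw))) g hg
  exact ⟨j, ⟨⟨v, hv⟩, fun a b ha hb g hg =>
    h1 b (.of_realize hb) g (hj a (.of_realize ha) g hg)⟩,
    hj v (.of_realize hv) j (.of_realize hv)⟩

/-- Every tuple satisfies a complete formula. -/
noncomputable def coverSentence (L : FirstOrder.Language.{0, 0})
    [Primcodable (Σ k, L.Functions k)] [Primcodable (Σ k, L.Relations k)] [L.Structure M]
    (e : ℕ → M) (m : ℕ) : InfFormula L :=
  closedInf (fun _ => True) (fun l => l) fun l => guardedSup (fun j => IsComplete L e m l j)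
    (fun j => varsFrom l (familyBound m j)) fun j => family L e m j

/-- Complete formulas refute the formulas of the `k`-th family which they refute in the given
structure. -/
noncomputable def refuteSentence (L : FirstOrder.Language.{0, 0})
    [Primcodable (Σ k, L.Functions k)] [Primcodable (Σ k, L.Relations k)] [L.Structure M]
    (e : ℕ → M) (m k : ℕ) : InfFormula L :=
  closedInf (fun z => IsComplete L e m z.unpair.1 z.unpair.2.unpair.1 ∧
      familyBound k z.unpair.2.unpair.2 ≤ z.unpair.1 ∧
      ∃ t : ℕ → M, (family L e m z.unpair.2.unpair.1).Realize t ∧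
        ¬ (family L e k z.unpair.2.unpair.2).Realize t)
    (fun z => max (familyBound k z.unpair.2.unpair.2) (familyBound m z.unpair.2.unpair.1))
    fun z => (family L e m z.unpair.2.unpair.1).neg.or (family L e k z.unpair.2.unpair.2).neg

/-- Complete formulas entail the existential formulas which they entail in the given structure. -/
noncomputable def entailSentence (L : FirstOrder.Language.{0, 0})
    [Primcodable (Σ k, L.Functions k)] [Primcodable (Σ k, L.Relations k)] [L.Structure M]
    (e : ℕ → M) (m : ℕ) : InfFormula L :=
  closedInf (fun z => IsComplete L e m z.unpair.1 z.unpair.2.unpair.1 ∧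
      ∃ t : ℕ → M, (family L e m z.unpair.2.unpair.1).Realize t ∧
        (family L e m z.unpair.2.unpair.2).ExtRealize z.unpair.1 t)
    (fun z => max z.unpair.1 (familyBound m z.unpair.2.unpair.1))
    fun z => (family L e m z.unpair.2.unpair.1).neg.or
      (InfFormula.ext z.unpair.1 (familyBound m z.unpair.2.unpair.2)
        (family L e m z.unpair.2.unpair.2))

/-- The canonical Scott sentence of a structure with a `Π_{m+2}` Scott sentence. -/
noncomputable def canonicalSentence (L : FirstOrder.Language.{0, 0})
    [Primcodable (Σ k, L.Functions k)] [Primcodable (Σ k, L.Relations k)] [L.Structure M]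
    (e : ℕ → M) (m : ℕ) : InfFormula L :=
  (coverSentence L e m).and ((refuteSentence L e m m).and
    ((refuteSentence L e m 0).and (entailSentence L e m)))

section Realize

variable {N : Type} [L.Structure N]

theorem freeVars_coverSentence_matrix (l : ℕ) :
    (guardedSup (fun j => IsComplete L e m l j) (fun j => varsFrom l (familyBound m j))
      fun j => family L e m j).freeVars ⊆ Set.Iio l := by
  rw [freeVars_guardedSup]
  refine Set.iUnion_subset fun j x hx => ?_
  have h1 := freeVars_family e m j hx.1
  have h2 := hx.2
  simp only [Set.mem_ofPred_eq, mem_varsFrom, Set.mem_Iio] at h1 h2 ⊢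
  omega

theorem realize_coverSentence (v : ℕ → N) : (coverSentence L e m).Realize v ↔
    ∀ (l : ℕ) (w : ℕ → N), ∃ j, IsComplete L e m l j ∧ (family L e m j).ExtRealize l w := by
  rw [coverSentence, realize_closedInf freeVars_coverSentence_matrix]
  simp only [true_imp_iff, realize_guardedSup, exists_agree_off_varsFrom (freeVars_family e m _)]

theorem freeVars_refuteSentence_matrix (k z : ℕ) :
    ((family L e m z.unpair.2.unpair.1).neg.or (family L e k z.unpair.2.unpair.2).neg).freeVars ⊆
      Set.Iio (max (familyBound k z.unpair.2.unpair.2) (familyBound m z.unpair.2.unpair.1)) := by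
  rw [freeVars_or, freeVars_neg, freeVars_neg]
  exact Set.union_subset
    ((freeVars_family e m _).trans (Set.Iio_subset_Iio (le_max_right _ _)))
    ((freeVars_family e k _).trans (Set.Iio_subset_Iio (le_max_left _ _)))

theorem realize_refuteSentence (k : ℕ) (v : ℕ → N) : (refuteSentence L e m k).Realize v ↔
    ∀ l g f, IsComplete L e m l g → familyBound k f ≤ l →
      (∃ t : ℕ → M, (family L e m g).Realize t ∧ ¬ (family L e k f).Realize t) →
        ∀ w : ℕ → N, (family L e m g).Realize w → ¬ (family L e k f).Realize w := by
  rw [refuteSentence, realize_closedInf (freeVars_refuteSentence_matrix k)]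
  simp only [realize_or, realize_neg, and_imp, ← imp_iff_not_or]
  constructor
  · intro H l g f h1 h2 h3
    have := H (Nat.pair l (Nat.pair g f))
    simp only [Nat.unpair_pair] at this
    exact this h1 h2 h3
  · intro H z h1 h2 h3
    exact H _ _ _ h1 h2 h3

theorem freeVars_entailSentence_matrix (z : ℕ) :
    ((family L e m z.unpair.2.unpair.1).neg.or
      (InfFormula.ext z.unpair.1 (familyBound m z.unpair.2.unpair.2)
        (family L e m z.unpair.2.unpair.2))).freeVars ⊆
      Set.Iio (max z.unpair.1 (familyBound m z.unpair.2.unpair.1)) := by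
  rw [freeVars_or, freeVars_neg]
  exact Set.union_subset
    ((freeVars_family e m _).trans (Set.Iio_subset_Iio (le_max_right _ _)))
    ((freeVars_ext (freeVars_family e m _)).trans (Set.Iio_subset_Iio (le_max_left _ _)))

theorem realize_entailSentence (v : ℕ → N) : (entailSentence L e m).Realize v ↔
    ∀ l f g, IsComplete L e m l f → (∃ t : ℕ → M, (family L e m f).Realize t ∧
      (family L e m g).ExtRealize l t) →
        ∀ w : ℕ → N, (family L e m f).Realize w → (family L e m g).ExtRealize l w := by
  rw [entailSentence, realize_closedInf freeVars_entailSentence_matrix]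
  simp only [realize_or, realize_neg, realize_ext (freeVars_family e m _), and_imp,
    ← imp_iff_not_or]
  constructor
  · intro H l f g h1 h2
    have := H (Nat.pair l (Nat.pair f g))
    simp only [Nat.unpair_pair] at this
    exact this h1 h2
  · intro H z h1 h2
    exact H _ _ _ h1 h2

theorem isSentence_canonicalSentence : (canonicalSentence L e m).IsSentence := by
  simp [IsSentence, canonicalSentence, coverSentence, refuteSentence, entailSentence,
    freeVars_closedInf freeVars_coverSentence_matrix,
    freeVars_closedInf (freeVars_refuteSentence_matrix _),
    freeVars_closedInf freeVars_entailSentence_matrix]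

/-- The structure satisfies its canonical sentence. -/
theorem realize_canonicalSentence [Nonempty M] (he : Function.Surjective e) {φ : InfFormula L}
    (hφ : φ.IsPi (m + 2)) (hS : IsScottSentence M φ) (v : ℕ → M) :
    (canonicalSentence L e m).Realize v := by
  have key : ∀ k ≤ m, (refuteSentence L e m k).Realize v := by
    intro k hk
    rw [realize_refuteSentence]
    rintro l g f hg hf ⟨t, ht1, ht2⟩ w hw1 hw2
    -- If `w` satisfied both formulas, a generator of the second one at `w` would carry over to `t`
    -- by completeness. As the variables of `f` lie below `l`, `f` would then hold at `t` itself.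
    obtain ⟨g', h1, h2⟩ := generates (L := L) he m _ _ ((piLike_family e k f).mono hk)
      ((piLike_family e k f).mono hk) id id w hw2 hw2
    obtain ⟨u, hu1, hu2⟩ := hg.2 w t hw1 ht1 g' (.of_realize h1)
    exact ht2 ((realize_congr _ fun x hx =>
      hu1 x (lt_of_lt_of_le (freeVars_family e k f hx) hf)).1 (h2 u hu2).1)
  simp only [canonicalSentence, realize_and]
  refine ⟨?_, key m le_rfl, key 0 (Nat.zero_le m), ?_⟩
  · rw [realize_coverSentence]
    exact fun l w => exists_isComplete he hφ hS w l
  · rw [realize_entailSentence]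
    rintro l f g hf ⟨t, ht1, ht2⟩ w hw
    exact hf.2 t w ht1 hw g ht2

end Realize

/-! ### Back and forth -/

section BackAndForth

variable {N : Type} [L.Structure N]

/-- The first `l` values of `a` and `b` satisfy a common complete formula. -/
def Linked (L : FirstOrder.Language.{0, 0}) [Primcodable (Σ k, L.Functions k)]
    [Primcodable (Σ k, L.Relations k)] [L.Structure M] [L.Structure N] (e : ℕ → M) (m l : ℕ)
    (a : ℕ → M) (b : ℕ → N) : Prop :=
  ∃ j, IsComplete L e m l j ∧ (family L e m j).ExtRealize l a ∧ (family L e m j).ExtRealize l b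

variable {v₀ : ℕ → N} {l : ℕ} {a : ℕ → M} {b : ℕ → N}

/-- In `M` the extended tuple satisfies a complete formula `g`. The old complete formula entails its
existential closure in `M`, and by the entailment sentence also in `N`. -/
theorem Linked.forth [Nonempty M] (he : Function.Surjective e) {φ : InfFormula L}
    (hφ : φ.IsPi (m + 2)) (hS : IsScottSentence M φ)
    (hN : (canonicalSentence L e m).Realize v₀) (h : Linked L e m l a b) (c : M) :
    ∃ b' : ℕ → N, (∀ i < l, b' i = b i) ∧ Linked L e m (l + 1) (Function.update a l c) b' := by
  simp only [canonicalSentence, realize_and] at hN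
  obtain ⟨f, hf, ⟨t, ht1, ht2⟩, w, hw1, hw2⟩ := h
  obtain ⟨g, hg1, hg2⟩ := exists_isComplete he hφ hS (Function.update a l c) (l + 1)
  have h1 : (family L e m g).ExtRealize l t := (hg2.mono (Nat.le_succ l)).congr fun i hi => by
    rw [ht1 i hi, Function.update_of_ne hi.ne]
  obtain ⟨u, hu1, hu2⟩ := (realize_entailSentence v₀).1 hN.2.2.2 l f g hf ⟨t, ht2, h1⟩ w hw2
  exact ⟨u, fun i hi => (hu1 i hi).trans (hw1 i hi), g, hg1, hg2, .of_realize hu2⟩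

/-- The cover sentence gives a complete formula `g` of a longer tuple in `N`. By the refutation
sentence `g` implies the old formula `f` in `M`, so a realization of `g` in `M` also satisfies `f`,
and completeness of `f` moves the extension over to `a`. -/
theorem Linked.back (hN : (canonicalSentence L e m).Realize v₀) (h : Linked L e m l a b) (d : N) :
    ∃ (l' : ℕ) (a' : ℕ → M) (b' : ℕ → N), l < l' ∧ (∀ i < l, a' i = a i) ∧ (∀ i < l, b' i = b i) ∧
      Linked L e m l' a' b' ∧ ∃ i < l', b' i = d := by
  simp only [canonicalSentence, realize_and] at hN
  obtain ⟨f, hf, ha, w, hw1, hw2⟩ := h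
  -- The new element `d` is put beyond all variables of `f`, so `f` survives its insertion and the
  -- tuple covered by `g` includes the witnesses for `f`.
  let K := max l (familyBound m f)
  obtain ⟨g, hg, w₂, h1, h2⟩ := (realize_coverSentence v₀).1 hN.1 (K + 1) (Function.update w K d)
  have hw₂ : ∀ i < K, w₂ i = w i := fun i hi => by
    rw [h1 i (by omega), Function.update_of_ne hi.ne]
  have hf₂ : (family L e m f).Realize w₂ := (realize_congr _ fun x hx =>
    hw₂ x (lt_of_lt_of_le (freeVars_family e m f hx) (le_max_right _ _))).2 hw2
  obtain ⟨t, ht⟩ := hg.1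
  have htf : (family L e m f).Realize t := by
    by_contra hcon
    exact (realize_refuteSentence m v₀).1 hN.2.1 (K + 1) g f hg
      ((le_max_right _ _).trans (Nat.le_succ _)) ⟨t, ht, hcon⟩ w₂ h2 hf₂
  obtain ⟨a', ha1, ha2⟩ := hf.ext (.of_realize htf) ha (.of_realize ht)
  refine ⟨K + 1, a', w₂, Nat.lt_succ_of_le (le_max_left _ _), ha1, fun i hi => ?_,
    ⟨g, hg, .of_realize ha2, .of_realize h2⟩, K, Nat.lt_succ_self K, ?_⟩
  · rw [hw₂ i (lt_of_lt_of_le hi (le_max_left _ _)), hw1 i hi]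
  · rw [h1 K (Nat.lt_succ_self K), Function.update_self]

theorem Linked.realize_qf (hN : (canonicalSentence L e m).Realize v₀) (h : Linked L e m l a b)
    {θ : L.Formula ℕ} (hθ : θ.IsQF) (hl : formulaCode θ < l) (hb : θ.Realize b) :
    θ.Realize a := by
  simp only [canonicalSentence, realize_and] at hN
  obtain ⟨f, hf, ⟨t, ht1, ht2⟩, w, hw1, hw2⟩ := h
  have hfam : family L e 0 (formulaCode θ) = qf θ hθ := qfFamily_formulaCode θ hθ
  have hfv : ∀ x ∈ (qf θ hθ : InfFormula L).freeVars, x < l := fun x hx =>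
    (freeVar_le_formulaCode θ rfl hθ x hx).trans_lt hl
  by_contra hcon
  refine (realize_refuteSentence 0 v₀).1 hN.2.2.1 l f (formulaCode θ) hf hl ⟨t, ht2, ?_⟩ w hw2 ?_
  · rw [hfam]
    exact fun hc => hcon ((realize_congr (qf θ hθ) fun x hx => ht1 x (hfv x hx)).1 hc)
  · rw [hfam]
    exact (realize_congr (qf θ hθ) fun x hx => hw1 x (hfv x hx)).2 hb

/-- Every countable model of the canonical sentence is isomorphic to the given structure. -/
theorem nonempty_equiv_of_canonicalSentence [Nonempty M] [Countable N] [Nonempty N]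
    (he : Function.Surjective e) {φ : InfFormula L}
    (hφ : φ.IsPi (m + 2)) (hS : IsScottSentence M φ)
    (hN : (canonicalSentence L e m).Realize v₀) : Nonempty (M ≃[L] N) := by
  obtain ⟨e', he'⟩ := exists_surjective_nat N
  let State := {x : ℕ × (ℕ → M) × (ℕ → N) // Linked L e m x.1 x.2.1 x.2.2}
  have step : ∀ (s : ℕ) (x : State), ∃ y : State, x.1.1 < y.1.1 ∧
      (∀ i < x.1.1, y.1.2.1 i = x.1.2.1 i) ∧ (∀ i < x.1.1, y.1.2.2 i = x.1.2.2 i) ∧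
      (∃ i < y.1.1, y.1.2.1 i = e s) ∧ ∃ i < y.1.1, y.1.2.2 i = e' s := by
    rintro s ⟨⟨l, a, b⟩, h⟩
    obtain ⟨b', hb', h'⟩ := h.forth he hφ hS hN (e s)
    obtain ⟨l'', a'', b'', h1, h2, h3, h4, h5⟩ := h'.back hN (e' s)
    refine ⟨⟨⟨l'', a'', b''⟩, h4⟩, (Nat.lt_succ_self l).trans h1, fun i hi => ?_, fun i hi => ?_,
      ⟨l, (Nat.lt_succ_self l).trans h1, ?_⟩, h5⟩
    · exact (h2 i (hi.trans (Nat.lt_succ_self l))).trans (Function.update_of_ne hi.ne _ _)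
    · exact (h3 i (hi.trans (Nat.lt_succ_self l))).trans (hb' i hi)
    · exact (h2 l (Nat.lt_succ_self l)).trans (Function.update_self _ _ _)
  choose next hlen hnextM hnextN hM hN' using step
  have start : Nonempty State := by
    have hN₁ := hN
    simp only [canonicalSentence, realize_and] at hN₁
    obtain ⟨j, hj, h⟩ := (realize_coverSentence v₀).1 hN₁.1 0 v₀
    obtain ⟨v, hv⟩ := hj.1
    exact ⟨⟨0, v, v₀⟩, j, hj, .of_realize hv, h⟩
  obtain ⟨x₀⟩ := start
  let st : ℕ → State := fun s => Nat.rec x₀ next s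
  have hlt : ∀ s, s ≤ (st s).1.1 := by
    intro s
    induction s with
    | zero => exact Nat.zero_le _
    | succ s ih => exact ih.trans_lt (hlen s (st s))
  have hmono : ∀ s d, (st s).1.1 ≤ (st (s + d)).1.1 ∧
      (∀ i < (st s).1.1, (st (s + d)).1.2.1 i = (st s).1.2.1 i) ∧
      (∀ i < (st s).1.1, (st (s + d)).1.2.2 i = (st s).1.2.2 i) := by
    intro s d
    induction d with
    | zero => exact ⟨le_rfl, fun _ _ => rfl, fun _ _ => rfl⟩
    | succ d ih =>
      refine ⟨ih.1.trans (hlen _ _).le, fun i hi => ?_, fun i hi => ?_⟩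
      · exact (hnextM _ _ i (hi.trans_le ih.1)).trans (ih.2.1 i hi)
      · exact (hnextN _ _ i (hi.trans_le ih.1)).trans (ih.2.2 i hi)
  -- Stage `i + 1` has length at least `i + 1`, so place `i` is settled there for good.
  let a : ℕ → M := fun i => (st (i + 1)).1.2.1 i
  let b : ℕ → N := fun i => (st (i + 1)).1.2.2 i
  have hab : ∀ s, ∀ i < (st s).1.1, (st s).1.2.1 i = a i ∧ (st s).1.2.2 i = b i := by
    intro s i hi
    have hi' : i < (st (i + 1)).1.1 := hlt (i + 1)
    rcases le_total s (i + 1) with h | h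
    · obtain ⟨d, hd⟩ := Nat.exists_eq_add_of_le h
      have := hmono s d
      rw [← hd] at this
      exact ⟨(this.2.1 i hi).symm, (this.2.2 i hi).symm⟩
    · obtain ⟨d, hd⟩ := Nat.exists_eq_add_of_le h
      have := hmono (i + 1) d
      rw [← hd] at this
      exact ⟨this.2.1 i hi', this.2.2 i hi'⟩
  have key : ∀ θ : L.Formula ℕ, θ.IsQF → θ.Realize b → θ.Realize a := by
    intro θ hθ hb
    let s := formulaCode θ + 1
    have hs : formulaCode θ < (st s).1.1 := hlt s
    have hfv : ∀ x ∈ (qf θ hθ : InfFormula L).freeVars, x < (st s).1.1 := fun x hx =>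
      (freeVar_le_formulaCode θ rfl hθ x hx).trans_lt hs
    have h1 := (st s).2.realize_qf hN hθ hs
      ((realize_congr (qf θ hθ) fun x hx => (hab s x (hfv x hx)).2).2 hb)
    exact (realize_congr (qf θ hθ) fun x hx => (hab s x (hfv x hx)).1).1 h1
  refine nonempty_equiv_of_qf (a := a) (b := b) ?_ ?_ fun θ hθ => ⟨fun h => ?_, key θ hθ⟩
  · intro x
    obtain ⟨s, rfl⟩ := he x
    obtain ⟨i, hi, h⟩ := hM s (st s)
    exact ⟨i, ((hab (s + 1) i hi).1).symm.trans h⟩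
  · intro x
    obtain ⟨s, rfl⟩ := he' x
    obtain ⟨i, hi, h⟩ := hN' s (st s)
    exact ⟨i, ((hab (s + 1) i hi).2).symm.trans h⟩
  -- Only transfer from `N` to `M` was shown; the other direction is transfer of the negation.
  · by_contra hcon
    have := key θ.not hθ.not (Formula.realize_not.2 hcon)
    exact Formula.realize_not.1 this h

end BackAndForth

theorem isScottSentence_canonicalSentence [Nonempty M] (he : Function.Surjective e)
    {φ : InfFormula L} (hφ : φ.IsPi (m + 2)) (hS : IsScottSentence M φ) :
    IsScottSentence M (canonicalSentence L e m) := by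
  refine ⟨isSentence_canonicalSentence, fun N _ _ _ => ⟨fun h => ?_, ?_⟩⟩
  · exact nonempty_equiv_of_canonicalSentence he hφ hS (h fun _ => Classical.arbitrary N)
  · rintro ⟨f⟩
    let x : N := Classical.arbitrary N
    rw [isSentence_canonicalSentence.models_iff fun _ => x]
    have := (realize_equiv f (canonicalSentence L e m) (f.symm ∘ fun _ => x)).2
      (realize_canonicalSentence he hφ hS _)
    rwa [← Function.comp_assoc, show (f ∘ f.symm : N → N) = id from
      funext fun y => f.apply_symm_apply y, Function.id_comp] at this

end Canonical

/-! ### Complexity of the canonical sentence of a computable structure -/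

section Complexity

theorem exists_computable_enumeration {D : Set ℕ} (hD : D.Nonempty)
    (h : ComputablePred fun x => x ∈ D) :
    ∃ e : ℕ → D, Function.Surjective e ∧ Computable fun i => (e i : ℕ) := by
  obtain ⟨hdec, hc⟩ := h
  obtain ⟨d, hd⟩ := hD
  refine ⟨fun x => if hx : x ∈ D then ⟨x, hx⟩ else ⟨d, hd⟩, fun x => ⟨x, by simp⟩, ?_⟩
  refine (Computable.cond hc Computable.id (Computable.const d)).of_eq fun x => ?_
  by_cases hx : x ∈ D <;> simp [hx]

theorem computable_codeLength : Computable codeLength :=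
  (Primrec.list_length.comp (Primrec.ofNat (List ℕ))).to_comp

theorem computable_familyBound (k : ℕ) : Computable (familyBound k) := by
  cases k with
  | zero => exact Computable.succ
  | succ k => exact computable_codeLength

theorem computable_assignment {D : Set ℕ} {e : ℕ → D} (he : Computable fun i => (e i : ℕ)) :
    Computable₂ fun s i => ((assignment e s i : D) : ℕ) :=
  he.comp ((Primrec.list_getD 0).comp ((Primrec.ofNat (List ℕ)).comp Primrec.fst)
    Primrec.snd).to_comp

/-- Agreement of the first `l` values of coded assignments is decidable. -/
theorem asig_assignment_agree {D : Set ℕ} {e : ℕ → D} (he : Computable fun i => (e i : ℕ)) :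
    ASig 0 fun x : (ℕ × ℕ) × ℕ =>
      ∀ i < x.1.1, assignment e x.2 i = assignment e x.1.2 i := by
  have hl : Computable fun x : (ℕ × ℕ) × ℕ => List.range x.1.1 :=
    (Primrec.list_range.comp (Primrec.fst.comp Primrec.fst)).to_comp
  have h1 := computable_list_map ((computable_assignment he).comp
    (Computable.snd.comp Computable.fst) Computable.snd).to₂ hl
  have h2 := computable_list_map ((computable_assignment he).comp
    (Computable.snd.comp (Computable.fst.comp Computable.fst)) Computable.snd).to₂ hl
  refine (asig_zero_of_computable (Primrec.eq.decide.to_comp.comp h1 h2)).of_iff fun x => ?_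
  simp [List.map_inj_left, Subtype.ext_iff]

section Assignments

variable {M : Type} [L.Structure M] {e : ℕ → M}

/-- Only finitely many values of an assignment matter, so quantifiers over assignments can be
replaced by number quantifiers in the complexity count. -/
theorem exists_realize_iff (he : Function.Surjective e) {φ : InfFormula L} {b : ℕ}
    (hφ : φ.freeVars ⊆ Set.Iio b) (p : (ℕ → M) → Prop) (l : ℕ)
    (hp : ∀ v w : ℕ → M, (∀ i < l, v i = w i) → p v → p w) :
    (∃ v : ℕ → M, p v ∧ φ.Realize v) ↔
      ∃ s, p (assignment e s) ∧ φ.Realize (assignment e s) := by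
  refine ⟨fun ⟨v, h1, h2⟩ => ?_, fun ⟨s, h⟩ => ⟨_, h⟩⟩
  obtain ⟨s, -, hs⟩ := exists_assignment he v (max l b)
  exact ⟨s, hp _ _ (fun i hi => (hs i (lt_max_of_lt_left hi)).symm) h1,
    (φ.realize_congr fun i hi => hs i (lt_max_of_lt_right (hφ hi))).2 h2⟩

variable [Primcodable (Σ k, L.Functions k)] [Primcodable (Σ k, L.Relations k)]

theorem extRealize_assignment_iff (he : Function.Surjective e) (k j l s : ℕ) :
    (family L e k j).ExtRealize l (assignment e s) ↔
      ∃ t, (∀ i < l, assignment e t i = assignment e s i) ∧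
        (family L e k j).Realize (assignment e t) :=
  exists_realize_iff he (freeVars_family e k j) (fun w => ∀ i < l, w i = assignment e s i) l
    fun _ _ h h' i hi => (h i hi).symm.trans (h' i hi)

theorem isComplete_iff (he : Function.Surjective e) (m l j : ℕ) :
    IsComplete L e m l j ↔ (∃ t, (family L e m j).Realize (assignment e t)) ∧
      ∀ s t g, (family L e m j).Realize (assignment e s) →
        (family L e m j).Realize (assignment e t) →
          (family L e m g).ExtRealize l (assignment e s) →
            (family L e m g).ExtRealize l (assignment e t) := by
  have hex := exists_realize_iff he (freeVars_family (L := L) e m j) (fun _ => True) 0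
    fun _ _ _ _ => trivial
  simp only [true_and] at hex
  rw [IsComplete, hex]
  refine and_congr_right fun _ => ⟨fun h s t g h1 h2 => h _ _ h1 h2 g, fun h a b ha hb g hg => ?_⟩
  obtain ⟨s, -, hs⟩ := exists_assignment he a (max l (familyBound m j))
  obtain ⟨t, -, ht⟩ := exists_assignment he b (max l (familyBound m j))
  refine (h s t g ?_ ?_ (hg.congr fun i hi => (hs i (lt_max_of_lt_left hi)).symm)).congr
    fun i hi => ht i (lt_max_of_lt_left hi)
  · exact (realize_congr _ fun i hi =>
      hs i (lt_max_of_lt_right (freeVars_family e m j hi))).2 ha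
  · exact (realize_congr _ fun i hi =>
      ht i (lt_max_of_lt_right (freeVars_family e m j hi))).2 hb

end Assignments

variable [Primcodable (Σ k, L.Functions k)] [Primcodable (Σ k, L.Relations k)]
variable {D : Set ℕ} [L.Structure D] {e : ℕ → D}

theorem qfFamily_eq_of_formulaCheck {c : ℕ} (hc : formulaCheck
    (termCheck fun f : Σ k, L.Functions k => f.1) (fun R : Σ k, L.Relations k => R.1) c = true) :
    ∃ (θ : L.Formula ℕ) (hθ : θ.IsQF), formulaCode θ = c ∧ qfFamily L c = qf θ hθ := by
  obtain ⟨θ, hθ, rfl⟩ := exists_formulaCode hc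
  exact ⟨θ, hθ, rfl, qfFamily_formulaCode θ hθ⟩

theorem qfFamily_eq_of_not_formulaCheck {c : ℕ} (hc : formulaCheck
    (termCheck fun f : Σ k, L.Functions k => f.1) (fun R : Σ k, L.Relations k => R.1) c = false) :
    qfFamily L c = qf ⊥ BoundedFormula.isQF_bot := by
  refine qfFamily_of_not ?_
  rintro ⟨θ, hθ, rfl⟩
  rw [formulaCheck_formulaCode θ rfl hθ] at hc
  cases hc

/-- The evaluator gives meaningless answers on numbers that are not codes; conjunction with the
recognizer makes them false, as the default `⊥` of `qfFamily` demands. -/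
theorem asig_realize_qfFamily (hL : IsComputableLanguage L) (hA : IsComputableStructure L D)
    (hc : Computable fun i => (e i : ℕ)) :
    ASig 0 fun x : ℕ × ℕ => (family L e 0 x.1).Realize (assignment e x.2) := by
  obtain ⟨-, ⟨F, hF, hF'⟩, P, hP, hP'⟩ := hA
  have h1 := (computable_formulaCheck (computable_termCheck hL.1) hL.2).comp
    (Computable.fst (α := ℕ) (β := ℕ))
  have h2 := (computable_formulaEval (computable_termEval (computable_assignment hc) hF) hP).comp
    (Computable.snd (α := ℕ) (β := ℕ)) Computable.fst
  refine (ASig.and (asig_zero_of_computable h1) (asig_zero_of_computable h2)).of_iff fun x => ?_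
  cases hx : formulaCheck (termCheck fun f : Σ k, L.Functions k => f.1)
      (fun R : Σ k, L.Relations k => R.1) x.1 with
  | false =>
    rw [family, qfFamily_eq_of_not_formulaCheck hx]
    simp only [Bool.false_eq_true, false_and, false_iff]
    exact id
  | true =>
    obtain ⟨θ, hθ, h, h'⟩ := qfFamily_eq_of_formulaCheck hx
    rw [family, h', ← h]
    simp only [true_and]
    exact formulaEval_formulaCode hF' hP' _ θ rfl default hθ

theorem effPi_qfFamily (hL : IsComputableLanguage L) (X : Set ℕ) (e : ℕ → D) :
    EffPi X 0 (family L e 0) := by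
  refine ⟨fun c => bif formulaCheck (termCheck fun f : Σ k, L.Functions k => f.1)
      (fun R : Σ k, L.Relations k => R.1) c then c else 0,
    Computable.cond (computable_formulaCheck (computable_termCheck hL.1) hL.2) Computable.id
      (Computable.const 0), fun c => ?_⟩
  cases hx : formulaCheck (termCheck fun f : Σ k, L.Functions k => f.1)
      (fun R : Σ k, L.Relations k => R.1) c with
  | false =>
    refine ⟨_, ⟨⊥, BoundedFormula.isQF_bot, rfl, by simp only [hx]; rfl⟩, ?_⟩
    rw [family, qfFamily_eq_of_not_formulaCheck hx]
    exact Refines.refl _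
  | true =>
    obtain ⟨θ, hθ, h, h'⟩ := qfFamily_eq_of_formulaCheck hx
    refine ⟨_, ⟨θ, hθ, rfl, by simp only [hx]; exact h.symm⟩, ?_⟩
    rw [family, h']
    exact Refines.refl _

theorem APi.extRealize {k : ℕ} (he : Function.Surjective e) (hc : Computable fun i => (e i : ℕ))
    (h : APi (2 * k) fun x : ℕ × ℕ => (family L e k x.1).Realize (assignment e x.2)) :
    ASig (2 * k + 1) fun x : ℕ × ℕ × ℕ =>
      (family L e k x.1).ExtRealize x.2.1 (assignment e x.2.2) := by
  refine (APi.ex_sig (p := fun z : (ℕ × ℕ × ℕ) × ℕ =>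
    (∀ i < z.1.2.1, assignment e z.2 i = assignment e z.1.2.2 i) ∧
      (family L e k z.1.1).Realize (assignment e z.2)) ?_).of_iff
    fun x => (extRealize_assignment_iff he k x.1 x.2.1 x.2.2).symm
  refine APi.and ?_ ?_
  · exact (((asig_assignment_agree hc).zero_pi).mono (Nat.zero_le _)).comap
      (f := fun z : (ℕ × ℕ × ℕ) × ℕ => (z.1.2, z.2))
      ((Computable.snd.comp Computable.fst).pair Computable.snd)
  · exact h.comap (f := fun z : (ℕ × ℕ × ℕ) × ℕ => (z.1.1, z.2))
      ((Computable.fst.comp Computable.fst).pair Computable.snd)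

/-- Each level costs two quantifiers: extending an assignment turns `Π_{2k}` into `Σ_{2k+1}`, and
the universally quantified implication between two such statements is `Π_{2k+2}`. -/
theorem api_realize_family (hL : IsComputableLanguage L) (hA : IsComputableStructure L D)
    (he : Function.Surjective e) (hc : Computable fun i => (e i : ℕ)) (k : ℕ) :
    APi (2 * k) fun x : ℕ × ℕ => (family L e k x.1).Realize (assignment e x.2) := by
  induction k with
  | zero => exact (asig_realize_qfFamily hL hA hc).zero_pi
  | succ k ih =>
    have hext := APi.extRealize he hc ih
    have hlen : Computable fun z : (ℕ × ℕ) × ℕ => codeLength z.1.1 :=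
      computable_codeLength.comp (Computable.fst.comp Computable.fst)
    have h1 := hext.comap (f := fun z : (ℕ × ℕ) × ℕ => (z.2, codeLength z.1.1, z.1.2))
      (Computable.snd.pair (hlen.pair (Computable.snd.comp Computable.fst)))
    have h2 := hext.comap (f := fun z : (ℕ × ℕ) × ℕ => (z.2, codeLength z.1.1, z.1.1))
      (Computable.snd.pair (hlen.pair (Computable.fst.comp Computable.fst)))
    exact (APi.all (APi.imp h1.succ h2.pi_succ)).of_iff fun x =>
      (realize_family_succ e k x.1 (assignment e x.2)).symm

theorem asig_extRealize_family (hL : IsComputableLanguage L) (hA : IsComputableStructure L D)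
    (he : Function.Surjective e) (hc : Computable fun i => (e i : ℕ)) (k : ℕ) :
    ASig (2 * k + 1) fun x : ℕ × ℕ × ℕ =>
      (family L e k x.1).ExtRealize x.2.1 (assignment e x.2.2) :=
  APi.extRealize he hc (api_realize_family hL hA he hc k)

/-- Consistency is `Σ_{2m+1}`, and the other clause is a universally quantified implication between
`Σ_{2m+1}` statements. -/
theorem api_isComplete (hL : IsComputableLanguage L) (hA : IsComputableStructure L D)
    (he : Function.Surjective e) (hc : Computable fun i => (e i : ℕ)) (m : ℕ) :
    APi (2 * m + 2) fun x : ℕ × ℕ => IsComplete L e m x.1 x.2 := by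
  have hT := api_realize_family hL hA he hc m
  have hE := asig_extRealize_family hL hA he hc m
  have fst2 {α β γ : Type} [Primcodable α] [Primcodable β] [Primcodable γ] :
      Computable fun z : (α × β) × γ => z.1.1 := Computable.fst.comp Computable.fst
  have snd2 {α β γ : Type} [Primcodable α] [Primcodable β] [Primcodable γ] :
      Computable fun z : (α × β) × γ => z.1.2 := Computable.snd.comp Computable.fst
  have hs : Computable fun z : (((ℕ × ℕ) × ℕ) × ℕ) × ℕ => z.1.1.2 := snd2.comp Computable.fst
  have hj : Computable fun z : (((ℕ × ℕ) × ℕ) × ℕ) × ℕ => z.1.1.1.2 := snd2.comp fst2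
  have hl : Computable fun z : (((ℕ × ℕ) × ℕ) × ℕ) × ℕ => z.1.1.1.1 := fst2.comp fst2
  have h1 := hT.comap (f := fun z : (ℕ × ℕ) × ℕ => (z.1.2, z.2)) (snd2.pair Computable.snd)
  have h2 := hT.comap (f := fun z : (((ℕ × ℕ) × ℕ) × ℕ) × ℕ => (z.1.1.1.2, z.1.1.2)) (hj.pair hs)
  have h3 := hT.comap (f := fun z : (((ℕ × ℕ) × ℕ) × ℕ) × ℕ => (z.1.1.1.2, z.1.2)) (hj.pair snd2)
  have h4 := hE.comap (f := fun z : (((ℕ × ℕ) × ℕ) × ℕ) × ℕ => (z.2, z.1.1.1.1, z.1.1.2))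
    (Computable.snd.pair (hl.pair hs))
  have h5 := hE.comap (f := fun z : (((ℕ × ℕ) × ℕ) × ℕ) × ℕ => (z.2, z.1.1.1.1, z.1.2))
    (Computable.snd.pair (hl.pair snd2))
  refine (APi.and h1.ex_sig.pi_succ (APi.all (APi.all (APi.all (APi.imp
    (h2.sig_succ.succ) (APi.imp h3.sig_succ.succ (APi.imp h4.succ h5.pi_succ))))))).of_iff
    fun x => (isComplete_iff he m x.1 x.2).symm

/-- The guard at level `k + 1` is `Π_{2k+1}`, hence `Σ_{2k+2}`, and the formula can absorb
`Σ_{n+k+1}`. This is where `k + 1 ≤ n` is used. -/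
theorem effPi_family (hL : IsComputableLanguage L) (hA : IsComputableStructure L D)
    (he : Function.Surjective e) (hc : Computable fun i => (e i : ℕ)) {n k : ℕ} (hk : k ≤ n) :
    EffPi (zeroJump n) k (family L e k) := by
  induction k with
  | zero => exact effPi_qfFamily hL _ e
  | succ k ih =>
    have hlen : Computable fun z : ℕ × ℕ => codeLength z.1 :=
      computable_codeLength.comp Computable.fst
    have hS := (asig_extRealize_family hL hA he hc k).comap
      (f := fun z : ℕ × ℕ => (z.2, codeLength z.1, z.1))
      (Computable.snd.pair (hlen.pair Computable.fst))
    refine (((ih (Nat.le_of_succ_le hk)).neg.comap (Computable.snd (α := ℕ))).guardedInf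
      (computable_varsFrom.comp hlen ((computable_familyBound k).comp Computable.snd))
      (hS.not.sig_succ.mono (l := n + k + 1) (by omega))).of_refines fun s => ?_
    rw [family]
    exact Refines.refl _

end Complexity

-- Effectiveness of the canonical sentence, and the theorem

section Main

variable [Primcodable (Σ k, L.Functions k)] [Primcodable (Σ k, L.Relations k)]

theorem EffPi.and {α : Type} [Primcodable α] {X : Set ℕ} {k : ℕ} {ψ χ : α → InfFormula L}
    (h : EffPi X (k + 1) ψ) (h' : EffPi X (k + 1) χ) :
    EffPi X (k + 1) fun a => (ψ a).and (χ a) :=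
  (h.neg.or h'.neg).neg

theorem EffSigma.closedInf {n k : ℕ} {σ : ℕ → InfFormula L} (h : EffSigma (zeroJump n) k σ)
    {b : ℕ → ℕ} (hb : Computable b) {S : ℕ → Prop} (hS : ASig (n + k + 1) S) :
    EffPi (zeroJump n) (k + 1) fun _ : Unit => InfFormula.closedInf S b σ :=
  (h.comap (Computable.snd (α := Unit))).guardedInf
    (computable_varsFrom.comp (Computable.const 0) (hb.comp Computable.snd))
    (hS.comap Computable.snd)

theorem asig_of_le {α : Type} [Primcodable α] {f g : α → ℕ} (hf : Computable f)
    (hg : Computable g) (k : ℕ) : ASig k fun x => f x ≤ g x :=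
  ((asig_zero_of_computable (Primrec.nat_le.decide.to_comp.comp hf hg)).of_iff
    fun x => by simp).mono (Nat.zero_le k)

theorem computable_max {α : Type} [Primcodable α] {f g : α → ℕ} (hf : Computable f)
    (hg : Computable g) : Computable fun x => max (f x) (g x) :=
  Primrec.nat_max.to_comp.comp hf hg

variable {D : Set ℕ} [L.Structure D] {e : ℕ → D}

/-- The tightest count: completeness, a `Π_{2m+2}` guard, stands inside a `Σ_{m+1}` disjunction,
which with oracle `0⁽ᵐ⁺²⁾` absorbs exactly `Σ_{2m+3}`. -/
theorem effPi_coverSentence (hL : IsComputableLanguage L) (hA : IsComputableStructure L D)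
    (he : Function.Surjective e) (hc : Computable fun i => (e i : ℕ)) (m : ℕ) :
    EffPi (zeroJump (m + 2)) (m + 2) fun _ : Unit => coverSentence L e m := by
  have h1 := effPi_family hL hA he hc (show m ≤ m + 2 by omega)
  have h2 := (h1.comap (Computable.snd (α := ℕ))).guardedSup
    (xs := fun z => varsFrom z.1 (familyBound m z.2))
    (computable_varsFrom.comp Computable.fst ((computable_familyBound m).comp Computable.snd))
    (ASig.of_pi_lt (api_isComplete hL hA he hc m) (show 2 * m + 2 < m + 2 + m + 1 by omega))
  exact h2.closedInf Computable.id (((asig_of_le (Computable.const 0) (Computable.const 0) _).of_iff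
    fun _ => by simp))

section Indices

theorem computable_unpair_fst : Computable fun z : ℕ => z.unpair.1 :=
  Computable.fst.comp Primrec.unpair.to_comp

theorem computable_unpair_snd_fst : Computable fun z : ℕ => z.unpair.2.unpair.1 :=
  computable_unpair_fst.comp (Computable.snd.comp Primrec.unpair.to_comp)

theorem computable_unpair_snd_snd : Computable fun z : ℕ => z.unpair.2.unpair.2 :=
  (Computable.snd.comp Primrec.unpair.to_comp).comp (Computable.snd.comp Primrec.unpair.to_comp)

end Indices

/-- Here the guard stands on the outer `Π_{m+2}` conjunction, where anything up to `Σ_{2m+4}` is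
absorbed. -/
theorem effPi_refuteSentence (hL : IsComputableLanguage L) (hA : IsComputableStructure L D)
    (he : Function.Surjective e) (hc : Computable fun i => (e i : ℕ)) {m k : ℕ} (hk : k ≤ m) :
    EffPi (zeroJump (m + 2)) (m + 2) fun _ : Unit => refuteSentence L e m k := by
  have h1 := (effPi_family hL hA he hc (show m ≤ m + 2 by omega)).neg.mono (Nat.le_succ m)
  have h2 := (effPi_family hL hA he hc (show k ≤ m + 2 by omega)).neg.mono
    (show k ≤ m + 1 by omega)
  refine ((h1.comap computable_unpair_snd_fst).or
    (h2.comap computable_unpair_snd_snd)).closedInf (computable_max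
      ((computable_familyBound k).comp computable_unpair_snd_snd)
      ((computable_familyBound m).comp computable_unpair_snd_fst)) ?_
  refine ASig.and ?_ (ASig.and (asig_of_le ((computable_familyBound k).comp
    computable_unpair_snd_snd) computable_unpair_fst _) ?_)
  · exact (ASig.of_pi_lt (api_isComplete hL hA he hc m)
      (show 2 * m + 2 < m + 2 + (m + 1) + 1 by omega)).comap
      (computable_unpair_fst.pair computable_unpair_snd_fst)
  · have h3 := (api_realize_family hL hA he hc m).comap
      (f := fun z : ℕ × ℕ => (z.1.unpair.2.unpair.1, z.2))
      ((computable_unpair_snd_fst.comp Computable.fst).pair Computable.snd)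
    have h4 := (api_realize_family hL hA he hc k).comap
      (f := fun z : ℕ × ℕ => (z.1.unpair.2.unpair.2, z.2))
      ((computable_unpair_snd_snd.comp Computable.fst).pair Computable.snd)
    refine (ASig.ex (((h4.not.mono (show 2 * k ≤ m + 2 + (m + 1) + 1 by omega))).and
      (h3.sig_succ.mono (by omega)))).of_iff fun z => ?_
    simp only [and_comm (b := ¬ _)]
    exact (exists_realize_iff he (freeVars_family e m _)
      (fun v => ¬ (family L e k z.unpair.2.unpair.2).Realize v) (familyBound k _)
      fun v w h h' hw => h' ((realize_congr _ fun i hi =>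
        h i (freeVars_family e k _ hi)).2 hw)).symm

theorem effPi_entailSentence (hL : IsComputableLanguage L) (hA : IsComputableStructure L D)
    (he : Function.Surjective e) (hc : Computable fun i => (e i : ℕ)) (m : ℕ) :
    EffPi (zeroJump (m + 2)) (m + 2) fun _ : Unit => entailSentence L e m := by
  have h0 := effPi_family hL hA he hc (show m ≤ m + 2 by omega)
  have h1 := h0.neg.mono (Nat.le_succ m)
  have h2 := (h0.comap (computable_unpair_snd_snd.comp (Computable.fst (β := ℕ)))).guardedSup
    (xs := fun z => varsFrom z.1.unpair.1 (familyBound m z.1.unpair.2.unpair.2))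
    (computable_varsFrom.comp (computable_unpair_fst.comp Computable.fst)
      (((computable_familyBound m).comp computable_unpair_snd_snd).comp Computable.fst))
    (S := fun z => z.2 = 0)
    ((asig_of_le Computable.snd (Computable.const 0) _).of_iff fun z => by simp)
  refine ((h1.comap computable_unpair_snd_fst).or h2).closedInf (computable_max
      computable_unpair_fst ((computable_familyBound m).comp computable_unpair_snd_fst)) ?_
  refine ASig.and ?_ ?_
  · exact (ASig.of_pi_lt (api_isComplete hL hA he hc m)
      (show 2 * m + 2 < m + 2 + (m + 1) + 1 by omega)).comap
      (computable_unpair_fst.pair computable_unpair_snd_fst)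
  · have h3 := (api_realize_family hL hA he hc m).comap
      (f := fun z : ℕ × ℕ => (z.1.unpair.2.unpair.1, z.2))
      ((computable_unpair_snd_fst.comp Computable.fst).pair Computable.snd)
    have h4 := (asig_extRealize_family hL hA he hc m).comap
      (f := fun z : ℕ × ℕ => (z.1.unpair.2.unpair.2, z.1.unpair.1, z.2))
      ((computable_unpair_snd_snd.comp Computable.fst).pair
        ((computable_unpair_fst.comp Computable.fst).pair Computable.snd))
    refine (ASig.ex ((h4.mono (show 2 * m + 1 ≤ m + 2 + (m + 1) + 1 by omega)).and
      (h3.sig_succ.mono (by omega)))).of_iff fun z => ?_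
    simp only [and_comm (b := ExtRealize _ _ _)]
    exact (exists_realize_iff he (freeVars_family e m _)
      (fun v => (family L e m z.unpair.2.unpair.2).ExtRealize z.unpair.1 v) z.unpair.1
      fun v w h h' => h'.congr h).symm

theorem effPi_canonicalSentence (hL : IsComputableLanguage L) (hA : IsComputableStructure L D)
    (he : Function.Surjective e) (hc : Computable fun i => (e i : ℕ)) (m : ℕ) :
    EffPi (zeroJump (m + 2)) (m + 2) fun _ : Unit => canonicalSentence L e m :=
  (effPi_coverSentence hL hA he hc m).and
    ((effPi_refuteSentence hL hA he hc le_rfl).and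
      ((effPi_refuteSentence hL hA he hc (Nat.zero_le m)).and
        (effPi_entailSentence hL hA he hc m)))

/-- The universal theory of a structure with a `Π_1` Scott sentence is a Scott sentence. -/
theorem isScottSentence_family_one {M : Type} [L.Structure M] [Nonempty M] (e : ℕ → M)
    {φ : InfFormula L} (hφ : φ.IsPi 1) (hS : IsScottSentence M φ) {s : ℕ}
    (hs : codeLength s = 0) [Countable M] : IsScottSentence M (family L e 1 s) := by
  have hsent : (family L e 1 s).IsSentence :=
    Set.subset_empty_iff.1 ((freeVars_family e 1 s).trans (by simp [familyBound, hs]))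
  refine ⟨hsent, fun N _ _ _ => ⟨fun h => (hS.2 N).1 fun v => ?_, ?_⟩⟩
  · have hM : φ.Models M := (hS.2 M).2 ⟨FirstOrder.Language.Equiv.refl L M⟩
    have hN := (realize_family_succ e 0 s v).1 (h v)
    obtain ⟨I, xs, ψ, rfl, hψ⟩ := hφ
    rw [realize_iInf]
    intro i
    rw [realize_alls]
    intro w _
    obtain ⟨θ, hθ, hi⟩ := hψ i
    by_contra hcon
    have hfam : family L e 0 (formulaCode θ.not) = qf θ.not hθ.not := qfFamily_formulaCode _ _
    -- A failure of the matrix `θ` in `N` is an existential fact about the empty tuple, so it occurs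
    -- in `M` too, against `φ`.
    have := hN (formulaCode θ.not) ⟨w, fun i hi => absurd hi (by omega), by
      rw [hfam]
      rw [hi] at hcon
      exact hcon⟩
    rw [hfam] at this
    obtain ⟨t, -, ht⟩ := this
    have h1 := (realize_alls _ _ _).1 ((realize_iInf _ _ _).1 (hM t) i) t fun _ _ => rfl
    rw [hi] at h1
    exact ht h1
  · rintro ⟨f⟩
    rw [hsent.models_iff (f ∘ e), realize_equiv, realize_family_succ]
    exact fun j h => h.congr fun i hi => absurd hi (by omega)

end Main

end ScottAnalysis

theorem mainTheorem11 (L : FirstOrder.Language.{0, 0})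
    [Primcodable (Σ k, L.Functions k)] [Primcodable (Σ k, L.Relations k)]
    (hL : IsComputableLanguage L)
    (D : Set ℕ) (hD : D.Nonempty) [L.Structure D] (hA : IsComputableStructure L D)
    (n : ℕ) (h : ∃ φ : InfFormula L, φ.IsPi n ∧ IsScottSentence D φ) :
    ∃ φ : InfFormula L, IsComputablePi (zeroJump n) n φ ∧ IsScottSentence D φ := by
  obtain ⟨φ, hφ, hS⟩ := h
  obtain ⟨e, he, hc⟩ := exists_computable_enumeration hD hA.1
  have : Nonempty D := hD.to_subtype
  match n, hφ with
  | 0, ⟨θ, hθ, hθφ⟩ => exact ⟨φ, ⟨_, θ, hθ, hθφ, rfl⟩, hS⟩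
  | 1, hφ =>
    obtain ⟨f, -, hf⟩ := effPi_family hL hA he hc (le_refl 1)
    obtain ⟨ψ, h1, h2⟩ := hf (Encodable.encode ([] : List ℕ))
    -- Member `[]` is taken because the universal theory of the empty tuple is a sentence.
    exact ⟨ψ, ⟨_, h1⟩, InfFormula.IsScottSentence.of_refines h2
      (isScottSentence_family_one e hφ hS (by simp [codeLength]))⟩
  | m + 2, hφ =>
    obtain ⟨f, -, hf⟩ := effPi_canonicalSentence hL hA he hc m
    obtain ⟨ψ, h1, h2⟩ := hf ()
    exact ⟨ψ, ⟨_, h1⟩, InfFormula.IsScottSentence.of_refines h2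
      (isScottSentence_canonicalSentence he hφ hS)⟩
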